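/- Let $M$ be a closed (compact, without boundary) smooth manifold, $f:M\to\mathbb{R}$ a smooth Morse function with set of critical points $\mathrm{Crit} f$, and $g$ a smooth Riemannian metric on $M$. For $q\in M$ let $\alpha(q)$ and $\omega(q)$ be the sets of limit points, as $t\to-\infty$ and $t\to\infty$, of the trajectory through $q$ of the negative gradient field $-\nabla f$, and for $x\in\mathrm{Crit} f$ put $W^u(x)=\{q:\alpha(q)=\{x\}\}$ and $W^s(x)=\{q:\omega(q)=\{x\}\}$. Assume the Morse–Smale condition: $T_qW^u(x)+T_qW^s(y)=T_qM$ for all $x,y\in\mathrm{Crit} f$ and $q\in W^u(x)\cap W^s(y)$. Put $M_{xy}=W^u(x)\cap W^s(y)$ and, for a regular value $a\in(f(y),f(x))$ of $f$, $\hat M_{xy}=\hat M_{xy}(a)=M_{xy}\cap f^{-1}(a)$. An orientation of a submanifold $S\subseteq M$ is an orientation of its tangent bundle $TS$, and a coorientation of $S$ is an orientation of its normal bundle $\mathcal{V}S=TM|_S/TS$. An orientation of a zero-dimensional vector space is a sign. Fix an orientation of $W^u(x)$ for every $x\in\mathrm{Crit} f$ (if $x$ has Morse index $0$, then $W^u(x)=\{x\}$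 and this is a sign, for example $+$). Then, for all $x,y\in\mathrm{Crit} f$, the following hold. 1. There is a unique coorientation $[\mathcal{V}W^s(y)]$ of $W^s(y)$ that at the point $y$ corresponds to the given orientation of $T_yW^u(y)$ under the isomorphism $T_yW^u(y)\cong T_yM/T_yW^s(y)=\mathcal{V}_yW^s(y)$. 2. $M_{xy}$ is a smooth submanifold of $M$, and there is a unique orientation $[M_{xy}]_{ind}$ of it such that at every $p\in M_{xy}$, under the splitting $T_pW^u(x)\cong T_pM_{xy}\oplus\mathcal{V}_pW^s(y)$, $$[T_pW^u(x)]=[T_pM_{xy}]_{ind}\oplus[\mathcal{V}_pW^s(y)].$$ 3. For every regular value $a\in(f(y),f(x))$ of $f$, $\hat M_{xy}$ is a smooth submanifold of $M$, and there is a unique orientation $[\hat M_{xy}]_{ind}$ of it such that at every $p\in\hat M_{xy}$, under the splitting $T_pM_{xy}=\mathbb{R}\,\nabla f(p)\oplus T_p\hat M_{xy}$, $$[T_pM_{xy}]_{ind}=\langle-\nabla f(p)\rangle\oplus[T_p\hat M_{xy}]_{ind},$$ where $\langle-\nabla f(p)\rangle$ denotes the orientation of the line given by the vector $-\nabla f(p)$.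 -/

import Mathlib

open Set Filter Topology Module
open scoped Manifold ContDiff

noncomputable section

namespace MorseFlow

/-! ### Orientations of finite-dimensional real vector spaces -/

/-- An orientation of a finite-dimensional real vector space `V`. If `V` is the zero space,
there are exactly two of them (a sign). -/
abbrev VectorOrientation (V : Type*) [AddCommGroup V] [Module ℝ V] : Type _ :=
  Orientation ℝ V (Fin (finrank ℝ V))

/-- The ordered basis `b` represents the orientation `o`. -/
def Represents {V : Type*} [AddCommGroup V] [Module ℝ V] {k : ℕ}
    (b : Basis (Fin k) ℝ V) (o : VectorOrientation V) : Prop :=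
  (b.reindex (finCongr (show k = finrank ℝ V by simp [finrank_eq_card_basis b]))).orientation = o

/-! ### Submanifolds of a manifold, their tangent spaces, orientations and coorientations -/

section Submanifold

variable {n : ℕ} {M : Type*} [TopologicalSpace M] [ChartedSpace (EuclideanSpace ℝ (Fin n)) M]

/-- `S` is a smooth (embedded) submanifold of `M` without boundary: around each of its points
there is a smooth chart of `M` in which `S` is a linear subspace of fixed dimension. -/
def IsSubmanifold (S : Set M) : Prop :=
  ∃ k : ℕ, ∀ p ∈ S, ∃ φ ∈ IsManifold.maximalAtlas (𝓡 n) ∞ M, p ∈ φ.source ∧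
    ∃ V : Submodule ℝ (EuclideanSpace ℝ (Fin n)), finrank ℝ V = k ∧
      ∀ q ∈ φ.source, q ∈ S ↔ φ q ∈ V

/-- The tangent space `T_p S ⊆ T_p M` of `S ⊆ M`: the space spanned by the velocities at time `0`
of the smooth curves in `S` through `p`. -/
def tangentOf (n : ℕ) {M : Type*} [TopologicalSpace M]
    [ChartedSpace (EuclideanSpace ℝ (Fin n)) M] (S : Set M) (p : M) :
    Submodule ℝ (TangentSpace (𝓡 n) p) :=
  Submodule.span ℝ {v | ∃ γ : ℝ → M, ContMDiffAt 𝓘(ℝ, ℝ) (𝓡 n) ∞ γ 0 ∧ γ 0 = p ∧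
    (∀ᶠ t in 𝓝 (0 : ℝ), γ t ∈ S) ∧
    (mfderiv 𝓘(ℝ, ℝ) (𝓡 n) γ 0 (1 : ℝ) : EuclideanSpace ℝ (Fin n)) = v}

/-- The fibre `V_p S = T_p M / T_p S` of the normal bundle of `S`. -/
abbrev NormalSpace (n : ℕ) {M : Type*} [TopologicalSpace M]
    [ChartedSpace (EuclideanSpace ℝ (Fin n)) M] (S : Set M) (p : M) : Type :=
  TangentSpace (𝓡 n) p ⧸ tangentOf n S p

/-- The tangent vectors `v₁, …, v_k` form a basis of `T_p S` that satisfies `P`. -/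
def IsTangentBasis (S : Set M) (p : M) {k : ℕ} (v : Fin k → TangentSpace (𝓡 n) p)
    (P : Basis (Fin k) ℝ (tangentOf n S p) → Prop := fun _ => True) : Prop :=
  ∃ b : Basis (Fin k) ℝ (tangentOf n S p), (∀ i, (b i : TangentSpace (𝓡 n) p) = v i) ∧ P b

/-- The classes of `v₁, …, v_k` form a basis of the normal space of `S` at `p` that
satisfies `P`. -/
def IsNormalBasis (S : Set M) (p : M) {k : ℕ} (v : Fin k → TangentSpace (𝓡 n) p)
    (P : Basis (Fin k) ℝ (NormalSpace n S p) → Prop := fun _ => True) : Prop :=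
  ∃ b : Basis (Fin k) ℝ (NormalSpace n S p), (∀ i, b i = (tangentOf n S p).mkQ (v i)) ∧ P b

variable [IsManifold (𝓡 n) ∞ M]

/-- An orientation of the tangent bundle `TS`: an orientation of each fibre `T_p S`, such that
around each point there is a continuous local frame of `TS` which represents either the given
orientation at all points or the opposite one at all points. (In positive dimension one may
always take the first alternative; in dimension zero the only frame is the empty one, which
represents the sign `+`.) -/
structure TangentOrientation (S : Set M) where
  fibre : ∀ p : S, VectorOrientation (tangentOf n S (p : M))
  locally_constant : ∀ p : S, ∃ U ∈ 𝓝 p, ∃ (k : ℕ)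
    (X : Fin k → ∀ q : S, TangentSpace (𝓡 n) (q : M)),
    (∀ i, ContinuousOn (fun q : S => (⟨(q : M), X i q⟩ : TangentBundle (𝓡 n) M)) U) ∧
    ((∀ q ∈ U, IsTangentBasis S (q : M) (fun i => X i q) fun b => Represents b (fibre q)) ∨
     (∀ q ∈ U, IsTangentBasis S (q : M) (fun i => X i q) fun b => Represents b (-fibre q)))

/-- A coorientation of `S`, i.e. an orientation of its normal bundle `TM|_S / TS`. -/
structure NormalOrientation (S : Set M) where
  fibre : ∀ p : S, VectorOrientation (NormalSpace n S (p : M))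
  locally_constant : ∀ p : S, ∃ U ∈ 𝓝 p, ∃ (k : ℕ)
    (X : Fin k → ∀ q : S, TangentSpace (𝓡 n) (q : M)),
    (∀ i, ContinuousOn (fun q : S => (⟨(q : M), X i q⟩ : TangentBundle (𝓡 n) M)) U) ∧
    ((∀ q ∈ U, IsNormalBasis S (q : M) (fun i => X i q) fun b => Represents b (fibre q)) ∨
     (∀ q ∈ U, IsNormalBasis S (q : M) (fun i => X i q) fun b => Represents b (-fibre q)))

/-- `v₁, …, v_k` is a positively oriented basis of `T_p S`. -/
def TangentOrientation.Pos {S : Set M} (o : TangentOrientation (n := n) S) (p : S) {k : ℕ}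
    (v : Fin k → TangentSpace (𝓡 n) (p : M)) : Prop :=
  IsTangentBasis S (p : M) v fun b => Represents b (o.fibre p)

/-- The classes of `v₁, …, v_k` are a positively oriented basis of the normal space
of `S` at `p`. -/
def NormalOrientation.Pos {S : Set M} (o : NormalOrientation (n := n) S) (p : S) {k : ℕ}
    (v : Fin k → TangentSpace (𝓡 n) (p : M)) : Prop :=
  IsNormalBasis S (p : M) v fun b => Represents b (o.fibre p)

end Submanifold

/-! ### Morse functions, gradient flows, stable and unstable manifolds -/

section Morse

variable {n : ℕ} {M : Type*} [TopologicalSpace M] [ChartedSpace (EuclideanSpace ℝ (Fin n)) M]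

/-- The critical points of `f`. -/
def Crit (n : ℕ) {M : Type*} [TopologicalSpace M] [ChartedSpace (EuclideanSpace ℝ (Fin n)) M]
    (f : M → ℝ) : Set M :=
  {x | mfderiv (𝓡 n) 𝓘(ℝ, ℝ) f x = 0}

/-- The Hessian of `f` at `x` in the chart around `x`. -/
def hessian (f : M → ℝ) (x : M) (v w : EuclideanSpace ℝ (Fin n)) : ℝ :=
  fderiv ℝ (fderiv ℝ (f ∘ (extChartAt (𝓡 n) x).symm)) (extChartAt (𝓡 n) x x) v w

/-- All critical points of `f` are nondegenerate. -/
def IsMorse (n : ℕ) {M : Type*} [TopologicalSpace M] [ChartedSpace (EuclideanSpace ℝ (Fin n)) M]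
    (f : M → ℝ) : Prop :=
  ∀ x ∈ Crit n f, ∀ v : EuclideanSpace ℝ (Fin n), (∀ w, hessian f x v w = 0) → v = 0

variable [IsManifold (𝓡 n) ∞ M]

variable (n M) in
/-- Smooth Riemannian metrics on `M`. -/
abbrev SmoothMetric : Type _ :=
  Bundle.ContMDiffRiemannianMetric (𝓡 n) ∞ (EuclideanSpace ℝ (Fin n))
    (fun p : M => TangentSpace (𝓡 n) p)

theorem exists_gradient (g : SmoothMetric n M) (f : M → ℝ) (p : M) :
    ∃ v : TangentSpace (𝓡 n) p, ∀ w : TangentSpace (𝓡 n) p,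
      g.inner p v w = (mfderiv (𝓡 n) 𝓘(ℝ, ℝ) f p w : ℝ) := by
  have : FiniteDimensional ℝ (TangentSpace (𝓡 n) p) :=
    inferInstanceAs (FiniteDimensional ℝ (EuclideanSpace ℝ (Fin n)))
  let L : TangentSpace (𝓡 n) p →ₗ[ℝ] Module.Dual ℝ (TangentSpace (𝓡 n) p) :=
    { toFun := fun v => (g.inner p v).toLinearMap
      map_add' := fun a b => by ext w; simp
      map_smul' := fun a b => by ext w; simp }
  have hL : Function.Injective L := by
    rw [injective_iff_map_eq_zero]
    intro v hv
    by_contra h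
    have h1 := g.pos p v h
    have h2 : g.inner p v v = 0 := congrArg (fun l : Module.Dual ℝ _ => l v) hv
    exact h1.ne' h2
  obtain ⟨v, hv⟩ := (LinearMap.injective_iff_surjective_of_finrank_eq_finrank
    (Subspace.dual_finrank_eq (K := ℝ)).symm).1 hL
      (mfderiv (𝓡 n) 𝓘(ℝ, ℝ) f p).toLinearMap
  exact ⟨v, fun w => congrArg (fun l : Module.Dual ℝ _ => l w) hv⟩

/-- The gradient `∇f` of `f` with respect to the metric `g`, i.e. `g(∇f, ·) = df`. -/
def grad (g : SmoothMetric n M) (f : M → ℝ) (p : M) : TangentSpace (𝓡 n) p :=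
  (exists_gradient g f p).choose

theorem inner_grad (g : SmoothMetric n M) (f : M → ℝ) (p : M) (w : TangentSpace (𝓡 n) p) :
    g.inner p (grad g f p) w = (mfderiv (𝓡 n) 𝓘(ℝ, ℝ) f p w : ℝ) :=
  (exists_gradient g f p).choose_spec w

/-- `γ : ℝ → M` is the trajectory of the negative gradient flow through `q`. -/
def IsTrajectory (g : SmoothMetric n M) (f : M → ℝ) (q : M) (γ : ℝ → M) : Prop :=
  IsMIntegralCurve (I := 𝓡 n) γ (fun p => -grad g f p) ∧ γ 0 = q

/-- The limit points `lim γ(t_k)`, `t_k → -∞`. -/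
def alphaLimitSet (γ : ℝ → M) : Set M :=
  {p | ∃ t : ℕ → ℝ, Tendsto t atTop atBot ∧ Tendsto (fun k => γ (t k)) atTop (𝓝 p)}

/-- The limit points `lim γ(t_k)`, `t_k → ∞`. -/
def omegaLimitSet (γ : ℝ → M) : Set M :=
  {p | ∃ t : ℕ → ℝ, Tendsto t atTop atTop ∧ Tendsto (fun k => γ (t k)) atTop (𝓝 p)}

/-- The unstable manifold `W^u(x)`. -/
def unstable (g : SmoothMetric n M) (f : M → ℝ) (x : M) : Set M :=
  {q | ∃ γ, IsTrajectory g f q γ ∧ alphaLimitSet γ = {x}}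

/-- The stable manifold `W^s(x)`. -/
def stable (g : SmoothMetric n M) (f : M → ℝ) (x : M) : Set M :=
  {q | ∃ γ, IsTrajectory g f q γ ∧ omegaLimitSet γ = {x}}

/-- The connecting manifold `M_{xy} = W^u(x) ∩ W^s(y)`. -/
def connecting (g : SmoothMetric n M) (f : M → ℝ) (x y : M) : Set M :=
  unstable g f x ∩ stable g f y

/-- The space of connecting orbits, realized as `M_{xy} ∩ f⁻¹(a)`. -/
def orbitSpace (g : SmoothMetric n M) (f : M → ℝ) (x y : M) (a : ℝ) : Set M :=
  connecting g f x y ∩ f ⁻¹' {a}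

/-- `a` is a regular value of `f`. -/
def IsRegularValue (n : ℕ) {M : Type*} [TopologicalSpace M]
    [ChartedSpace (EuclideanSpace ℝ (Fin n)) M] (f : M → ℝ) (a : ℝ) : Prop :=
  ∀ p, f p = a → p ∉ Crit n f

/-- All unstable and stable manifolds of critical points intersect transversally. -/
def IsMorseSmale (g : SmoothMetric n M) (f : M → ℝ) : Prop :=
  ∀ x ∈ Crit n f, ∀ y ∈ Crit n f, ∀ q ∈ unstable g f x ∩ stable g f y,
    tangentOf n (unstable g f x) q ⊔ tangentOf n (stable g f y) q = ⊤

theorem isTrajectory_const (g : SmoothMetric n M) (f : M → ℝ) {x : M} (hx : x ∈ Crit n f) :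
    IsTrajectory g f x (fun _ => x) := by
  have h0 : grad g f x = 0 := by
    by_contra h
    have h1 := g.pos x _ h
    rw [inner_grad, show mfderiv (𝓡 n) 𝓘(ℝ, ℝ) f x = 0 from hx] at h1
    exact lt_irrefl _ h1
  exact ⟨isMIntegralCurve_const (by simp [h0]), rfl⟩

theorem mem_unstable_self [T2Space M] (g : SmoothMetric n M) (f : M → ℝ) {x : M}
    (hx : x ∈ Crit n f) : x ∈ unstable g f x := by
  refine ⟨_, isTrajectory_const g f hx, ?_⟩
  ext p
  constructor
  · rintro ⟨t, -, h⟩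
    exact tendsto_nhds_unique h tendsto_const_nhds
  · rintro rfl
    exact ⟨fun k => -(k : ℝ), tendsto_neg_atTop_atBot.comp tendsto_natCast_atTop_atTop,
      tendsto_const_nhds⟩

theorem mem_stable_self [T2Space M] (g : SmoothMetric n M) (f : M → ℝ) {x : M}
    (hx : x ∈ Crit n f) : x ∈ stable g f x := by
  refine ⟨_, isTrajectory_const g f hx, ?_⟩
  ext p
  constructor
  · rintro ⟨t, -, h⟩
    exact tendsto_nhds_unique h tendsto_const_nhds
  · rintro rfl
    exact ⟨fun k => (k : ℝ), tendsto_natCast_atTop_atTop, tendsto_const_nhds⟩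

/-! ### Induced orientations -/

/-- `ν` orients the normal space of `W^s(y)` at `y` by the orientation `o` of `T_y W^u(y)`, through
the isomorphism `T_y W^u(y) ≅ T_y M / T_y W^s(y)`. -/
def IsInducedCoorientation [T2Space M] (g : SmoothMetric n M) (f : M → ℝ) {y : M}
    (hy : y ∈ Crit n f) (o : TangentOrientation (n := n) (unstable g f y))
    (ν : NormalOrientation (n := n) (stable g f y)) : Prop :=
  ∀ (k : ℕ) (v : Fin k → TangentSpace (𝓡 n) y), IsTangentBasis (unstable g f y) y v →
    (ν.Pos ⟨y, mem_stable_self g f hy⟩ v ↔ o.Pos ⟨y, mem_unstable_self g f hy⟩ v)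

/-- At each `p ∈ M_{xy}` the orientation `o` of `T_p W^u(x)` is the sum of the orientations `o'`
of `T_p M_{xy}` and `ν` of the normal space of `W^s(y)`, under the splitting
`T_p W^u(x) ≅ T_p M_{xy} ⊕ T_p M / T_p W^s(y)`. -/
def IsInducedOrientation (g : SmoothMetric n M) (f : M → ℝ) (x y : M)
    (o : TangentOrientation (n := n) (unstable g f x))
    (ν : NormalOrientation (n := n) (stable g f y))
    (o' : TangentOrientation (n := n) (connecting g f x y)) : Prop :=
  ∀ (p : M) (hp : p ∈ connecting g f x y) (k m : ℕ) (a : Fin k → TangentSpace (𝓡 n) p)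
    (w : Fin m → TangentSpace (𝓡 n) p),
    IsTangentBasis (connecting g f x y) p a →
    (∀ j, w j ∈ tangentOf n (unstable g f x) p) → IsNormalBasis (stable g f y) p w →
    (o.Pos ⟨p, hp.1⟩ (Fin.append a w) ↔ (o'.Pos ⟨p, hp⟩ a ↔ ν.Pos ⟨p, hp.2⟩ w))

/-- At each point `p` of the orbit space, the orientation `o'` of `T_p M_{xy}` is the sum of the
orientation of the line spanned by `-∇f(p)` and the orientation `o''` of the tangent space of the
orbit space. -/
def IsInducedOrbitOrientation (g : SmoothMetric n M) (f : M → ℝ) (x y : M) (a : ℝ)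
    (o' : TangentOrientation (n := n) (connecting g f x y))
    (o'' : TangentOrientation (n := n) (orbitSpace g f x y a)) : Prop :=
  ∀ (p : M) (hp : p ∈ orbitSpace g f x y a) (k : ℕ) (c : Fin k → TangentSpace (𝓡 n) p),
    IsTangentBasis (orbitSpace g f x y a) p c →
    (o'.Pos ⟨p, hp.1⟩ (Fin.cons (-grad g f p) c : Fin (k + 1) → TangentSpace (𝓡 n) p) ↔
      o''.Pos ⟨p, hp⟩ c)

end Morse

end MorseFlow

end

open MorseFlow

/-!
The theorem is reduced to linear algebra by describing all the submanifolds involved by local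
equations, and all orientations by signs of determinants.

*Local equations.* Let `y` be a critical point. The time-`τ` map `ψ` of the negative gradient flow
fixes `y`, and by nondegeneracy its linearization there is diagonalizable with positive eigenvalues
different from `1` (`exists_eigenbasis_neg_grad`). Bounded orbits of such a map near the fixed point
are the solutions of the Lyapunov–Perron equation in the space of bounded sequences, to which the
implicit function theorem applies; this gives a submersion `F` near `y` whose zeros are the points
with forward orbit near `y` (`exists_local_stable_diagonal`). Because `f` decreases along the flow,
these are the points of `Wˢ(y)` near `y` (`IsGradientFlow.tendsto_of_forall_mem` and
`IsGradientFlow.eventually_forall_mem`), so `F` is a local equation of `Wˢ(y)` at `y`. A point of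
`Wˢ(y)` is moved close to `y` by some `ψᵏ`, and `F ∘ ψᵏ` is a local equation there
(`StableEquation.exists_localEquation`). The unstable manifolds are the stable manifolds of `-f`.
Intersections under the transversality assumption, and with regular level sets, have local equations
as well (`LocalEquation.inter`). A set with local equations is a submanifold, its tangent spaces are
the kernels of the derivatives of the equations, and it has continuous tangent and normal frames.
The smoothness of the flow that this needs is proved with the same tools: integral curves solve an
integral equation in the space of continuous curves, and superposition operators on such spaces
are smooth.

*Orientations.* Given a continuous family of linear maps to `ℝᵏ` that are injective on the tangent
spaces of a set, an orientation of the set is locally the sign of the determinants of the images of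
bases (`TangentOrientation.exists_sign`), and conversely a family of such signs is an orientation
(`existsUnique_tangentOrientation`). The same holds for coorientations and maps whose kernels are
the tangent spaces, for instance the derivatives of the equations.

*The coorientation of `Wˢ(y)`.* Near `y` the determinants of `dF` and `d(F ∘ ψ)` differ by a
positive factor, since at `y` the factor is a product of eigenvalues. Hence at each point of `Wˢ(y)`
the sign of the determinant of `d(F ∘ ψᵏ)` does not depend on `k`, once `k` is large; this is the
coorientation (`StableEquation.exists_coorientation`). It is unique because `Wˢ(y)` is connected:
two coorientations agree on an open and closed set, and each trajectory in `Wˢ(y)` comes close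
to `y` (`StableEquation.coorientation_ext`).

*The orientations of `M_xy` and of its level sets.* They are prescribed at every point, so only
their continuity has to be shown. If `l` is injective on the tangent space of `M_xy` and `F` is an
equation of `Wˢ(y)`, the matrix of `(l, dF)` on a basis adapted to
`T Wᵘ(x) ≅ T M_xy ⊕ V Wˢ(y)` is block triangular; so the prescribed orientation is locally
the sign of the determinant of `l`, up to a constant sign (`existsUnique_inducedOrientation`). For the level sets the same argument applies to
the determinant of `(-df, l)`, since `-df` is positive on `-∇f`
(`existsUnique_inducedLevelOrientation`).
-/

namespace MorseFlow

/-! ### Superposition operators -/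

section Superposition

open BoundedContinuousFunction

variable {α E F : Type} [TopologicalSpace α]
  [NormedAddCommGroup E] [NormedAddCommGroup F]

section Proper

variable [ProperSpace E]

theorem exists_bound_comp {h : E → F} (hh : Continuous h) (x : α →ᵇ E) :
    ∃ C, ∀ a, ‖h (x a)‖ ≤ C := by
  obtain ⟨C, hC⟩ := (isCompact_closedBall (0 : E) ‖x‖).exists_bound_of_continuousOn hh.continuousOn
  exact ⟨C, fun a => hC _ (by simpa using x.norm_coe_le_norm a)⟩

/-- The superposition (Nemytskii) operator `x ↦ h ∘ x` on bounded continuous functions. -/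
noncomputable def superposition (h : E → F) (hh : Continuous h) (x : α →ᵇ E) : α →ᵇ F :=
  ofNormedAddCommGroup (h ∘ x) (hh.comp x.continuous) (exists_bound_comp hh x).choose
    (exists_bound_comp hh x).choose_spec

@[simp]
theorem superposition_apply (h : E → F) (hh : Continuous h) (x : α →ᵇ E) (a : α) :
    superposition h hh x a = h (x a) := rfl

/-- Continuity is uniform along a bounded function with values in a proper space, because its
range is relatively compact. -/
theorem exists_delta_of_continuous {h : E → F} (hh : Continuous h) (x : α →ᵇ E) {ε : ℝ}
    (hε : 0 < ε) :
    ∃ δ > 0, ∀ a, ∀ z, ‖z - x a‖ < δ → ‖h z - h (x a)‖ < ε := by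
  have hu := (isCompact_closedBall (0 : E) (‖x‖ + 1)).uniformContinuousOn_of_continuous
    hh.continuousOn
  obtain ⟨δ, hδ, H⟩ := Metric.uniformContinuousOn_iff.1 hu ε hε
  refine ⟨min δ 1, lt_min hδ one_pos, fun a z hz => ?_⟩
  have h1 := x.norm_coe_le_norm a
  have h2 : ‖z‖ ≤ ‖x a‖ + ‖z - x a‖ := by
    simpa using norm_add_le (x a) (z - x a)
  have h3 : ‖z - x a‖ < 1 := hz.trans_le (min_le_right _ _)
  have := H z (by simp; linarith) (x a) (by simp; linarith)
    (by rw [dist_eq_norm]; exact hz.trans_le (min_le_left _ _))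
  rwa [dist_eq_norm] at this

theorem continuous_superposition {h : E → F} (hh : Continuous h) :
    Continuous (superposition h hh : (α →ᵇ E) → (α →ᵇ F)) := by
  refine Metric.continuous_iff.2 fun x ε hε => ?_
  obtain ⟨δ, hδ, H⟩ := exists_delta_of_continuous hh x (half_pos hε)
  refine ⟨δ, hδ, fun y hy => lt_of_le_of_lt ?_ (half_lt_self hε)⟩
  refine (BoundedContinuousFunction.dist_le (half_pos hε).le).2 fun a => ?_
  rw [dist_eq_norm]
  refine (H a (y a) ?_).le
  rw [← dist_eq_norm]
  exact (BoundedContinuousFunction.dist_coe_le_dist a).trans_lt hy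

end Proper

variable [NormedSpace ℝ E] [NormedSpace ℝ F]

variable (α E F) in
/-- Pointwise application of a bounded continuous family of operators to a bounded continuous
function. -/
noncomputable def pointwiseApply : (α →ᵇ (E →L[ℝ] F)) →L[ℝ] (α →ᵇ E) →L[ℝ] (α →ᵇ F) :=
  LinearMap.mkContinuous₂
    (LinearMap.mk₂ ℝ
      (fun (A : α →ᵇ (E →L[ℝ] F)) (x : α →ᵇ E) => ofNormedAddCommGroup (fun a => A a (x a))
        (A.continuous.clm_apply x.continuous) (‖A‖ * ‖x‖) fun a =>
          (A a).le_opNorm_of_le (x.norm_coe_le_norm a) |>.trans <| by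
            gcongr; exact A.norm_coe_le_norm a)
      (fun A B x => by ext a; simp)
      (fun c A x => by ext a; simp)
      (fun A x y => by ext a; simp)
      (fun c A x => by ext a; simp))
    1 (fun A x => by
      rw [one_mul]
      exact (norm_le (by positivity)).2 fun a =>
        ((A a).le_opNorm_of_le (x.norm_coe_le_norm a)).trans <| by
          gcongr; exact A.norm_coe_le_norm a)

@[simp]
theorem pointwiseApply_apply (A : α →ᵇ (E →L[ℝ] F)) (x : α →ᵇ E) (a : α) :
    pointwiseApply α E F A x a = A a (x a) := rfl

variable [ProperSpace E]

/-- The derivative of `x ↦ h ∘ x` at `x` is multiplication by `h' ∘ x`: the mean value inequality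
for `h` holds with a remainder that is uniform over the range of `x`. -/
theorem hasFDerivAt_superposition {h : E → F} (hh : ContDiff ℝ 1 h) (x : α →ᵇ E) :
    HasFDerivAt (superposition h hh.continuous : (α →ᵇ E) → (α →ᵇ F))
      (pointwiseApply α E F (superposition (fderiv ℝ h) (hh.continuous_fderiv one_ne_zero) x))
      x := by
  rw [hasFDerivAt_iff_isLittleO, Asymptotics.isLittleO_iff]
  intro ε hε
  obtain ⟨δ, hδ, H⟩ := exists_delta_of_continuous (hh.continuous_fderiv one_ne_zero) x hε
  filter_upwards [Metric.ball_mem_nhds x hδ] with y hy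
  refine (norm_le (by positivity)).2 fun a => ?_
  have hya : ‖y a - x a‖ < δ := by
    rw [← dist_eq_norm]
    exact (BoundedContinuousFunction.dist_coe_le_dist a).trans_lt hy
  have key := (convex_ball (x a) δ).norm_image_sub_le_of_norm_hasFDerivWithin_le'
    (f := h) (f' := fderiv ℝ h) (φ := fderiv ℝ h (x a)) (C := ε) (x := x a) (y := y a)
    (fun z _ => (hh.differentiable one_ne_zero z).hasFDerivAt.hasFDerivWithinAt)
    (fun z hz => (H a z (by simpa [dist_eq_norm] using hz)).le)
    (Metric.mem_ball_self hδ) (by simpa [dist_eq_norm] using hya)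
  refine key.trans ?_
  gcongr
  exact (y - x).norm_coe_le_norm a

theorem contDiff_nat_superposition (n : ℕ) : ∀ {F : Type} [NormedAddCommGroup F]
    [NormedSpace ℝ F] {h : E → F} (hh : ContDiff ℝ ∞ h),
    ContDiff ℝ n (superposition h hh.continuous : (α →ᵇ E) → (α →ᵇ F)) := by
  -- the derivative of the operator of `h` is built from the operator of `fderiv h`, so
  -- smoothness is gained one order at a time, for all targets `F` simultaneously
  induction n with
  | zero => exact fun hh => contDiff_zero.2 (continuous_superposition _)
  | succ n ih =>
    intro F _ _ h hh
    have h1 : ContDiff ℝ 1 h := hh.of_le (by exact_mod_cast le_top)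
    have hd : ContDiff ℝ ∞ (fderiv ℝ h) := (contDiff_infty_iff_fderiv.1 hh).2
    rw [Nat.cast_add, Nat.cast_one]
    exact contDiff_succ_iff_hasFDerivAt.2
      ⟨_, (pointwiseApply α E F).contDiff.comp (ih hd), hasFDerivAt_superposition h1⟩

theorem contDiff_superposition {h : E → F} (hh : ContDiff ℝ ∞ h) :
    ContDiff ℝ ∞ (superposition h hh.continuous : (α →ᵇ E) → (α →ᵇ F)) :=
  contDiff_infty.2 fun n => contDiff_nat_superposition n hh

end Superposition

/-! ### The smooth implicit function theorem on Banach spaces -/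

section Implicit

/-- The inverse function theorem, with smoothness of the inverse on a whole neighbourhood. -/
theorem exists_smooth_localInverse {E F : Type*} [NormedAddCommGroup E] [NormedSpace ℝ E]
    [CompleteSpace E] [NormedAddCommGroup F] [NormedSpace ℝ F] {f : E → F} {a : E} {O : Set E}
    (hO : IsOpen O) (ha : a ∈ O) (hf : ContDiffOn ℝ ∞ f O) (f' : E ≃L[ℝ] F)
    (hf' : HasFDerivAt f (f' : E →L[ℝ] F) a) :
    ∃ e : OpenPartialHomeomorph E F, a ∈ e.source ∧ e.source ⊆ O ∧ (∀ x, e x = f x) ∧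
      ContDiffOn ℝ ∞ e e.source ∧ ContDiffOn ℝ ∞ e.symm e.target ∧
      ∀ x ∈ e.source, ∃ A : E ≃L[ℝ] F, HasFDerivAt f (A : E →L[ℝ] F) x := by
  have hfa : ContDiffAt ℝ ∞ f a := hf.contDiffAt (hO.mem_nhds ha)
  have h1 : (1 : WithTop ℕ∞) ≤ ∞ := by exact_mod_cast le_top
  let e₀ := hfa.toOpenPartialHomeomorph f hf' (by simp)
  have hcont : ContinuousOn (fderiv ℝ f) O := hf.continuousOn_fderiv_of_isOpen hO h1
  have hopen : IsOpen (O ∩ fderiv ℝ f ⁻¹' range ((↑) : (E ≃L[ℝ] F) → E →L[ℝ] F)) :=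
    hcont.isOpen_inter_preimage hO (ContinuousLinearEquiv.isOpen (𝕜 := ℝ))
  -- on this open set the derivative stays invertible, so that the inverse is smooth there
  set O' := O ∩ fderiv ℝ f ⁻¹' range ((↑) : (E ≃L[ℝ] F) → E →L[ℝ] F)
  let e := e₀.restrOpen O' hopen
  have hsrc : e.source = e₀.source ∩ O' := e₀.restrOpen_source O' hopen
  have hef : ∀ x, e x = f x := fun x => rfl
  have hA : ∀ x ∈ e.source, ∃ A : E ≃L[ℝ] F, HasFDerivAt f (A : E →L[ℝ] F) x := by
    intro x hx
    rw [hsrc] at hx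
    obtain ⟨A, hA⟩ := hx.2.2
    refine ⟨A, ?_⟩
    rw [hA]
    exact ((hf.contDiffAt (hO.mem_nhds hx.2.1)).differentiableAt (by simp)).hasFDerivAt
  have hsub : e.source ⊆ O := fun x hx => by rw [hsrc] at hx; exact hx.2.1
  refine ⟨e, ?_, hsub, hef, ?_, ?_, hA⟩
  · rw [hsrc]
    exact ⟨hfa.mem_toOpenPartialHomeomorph_source hf' (by simp), ha, f', hf'.fderiv.symm⟩
  · exact (hf.mono hsub).congr fun x _ => hef x
  · intro y hy
    have hx : e.symm y ∈ e.source := e.map_target hy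
    obtain ⟨A, hA⟩ := hA _ hx
    have hfx : ContDiffAt ℝ ∞ e (e.symm y) := hf.contDiffAt (hO.mem_nhds (hsub hx))
    exact (e.contDiffAt_symm hy hA hfx).contDiffWithinAt

/-- The implicit function theorem for a smooth equation `G (p, y) = 0` in Banach spaces. The last
clause, injectivity of the partial derivative along the solutions, makes it possible to compute the
derivative of the solution by exhibiting a solution of the linearized equation. -/
theorem exists_smooth_implicit {P Y Z : Type*} [NormedAddCommGroup P] [NormedSpace ℝ P]
    [CompleteSpace P] [NormedAddCommGroup Y] [NormedSpace ℝ Y] [CompleteSpace Y]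
    [NormedAddCommGroup Z] [NormedSpace ℝ Z]
    {G : P × Y → Z} (hG : ContDiff ℝ ∞ G) {p₀ : P} {y₀ : Y} (h0 : G (p₀, y₀) = 0)
    (A : Y ≃L[ℝ] Z) (B : P →L[ℝ] Z)
    (hA : HasFDerivAt G (B.coprod (A : Y →L[ℝ] Z)) (p₀, y₀)) :
    ∃ (U : Set P) (V : Set Y) (s : P → Y), IsOpen U ∧ p₀ ∈ U ∧ IsOpen V ∧ y₀ ∈ V ∧
      ContDiffOn ℝ ∞ s U ∧ (∀ p ∈ U, ∀ y ∈ V, G (p, y) = 0 → y = s p) ∧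
      (∀ p ∈ U, G (p, s p) = 0) ∧ s p₀ = y₀ ∧
      ∀ p ∈ U, ∀ v, fderiv ℝ G (p, s p) (0, v) = 0 → v = 0 := by
  -- the inverse function theorem is applied to `(p, y) ↦ (p, G (p, y))`
  let f : P × Y → P × Z := fun z => (z.1, G z)
  have hf : ContDiff ℝ ∞ f := contDiff_fst.prodMk hG
  let f' : (P × Y) ≃L[ℝ] (P × Z) := ContinuousLinearEquiv.equivOfInverse
    ((ContinuousLinearMap.fst ℝ P Y).prod (B.coprod (A : Y →L[ℝ] Z)))
    ((ContinuousLinearMap.fst ℝ P Z).prod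
      ((A.symm : Z →L[ℝ] Y) ∘L (ContinuousLinearMap.snd ℝ P Z -
        B ∘L ContinuousLinearMap.fst ℝ P Z)))
    (fun z => by simp) (fun z => by simp)
  have hf' : HasFDerivAt f (f' : (P × Y) →L[ℝ] (P × Z)) (p₀, y₀) :=
    (hasFDerivAt_fst (𝕜 := ℝ)).prodMk hA
  obtain ⟨e, hmem, -, hef, -, hes, hd⟩ := exists_smooth_localInverse isOpen_univ (mem_univ _)
    hf.contDiffOn f' hf'
  have hsn : e.source ∈ 𝓝 (p₀, y₀) := e.open_source.mem_nhds hmem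
  obtain ⟨U₁, hU₁, V₁, hV₁, hUV⟩ := mem_nhds_prod_iff.1 hsn
  obtain ⟨U₂, hU₂, hU₂o, hpU₂⟩ := mem_nhds_iff.1 hU₁
  obtain ⟨V, hV, hVo, hyV⟩ := mem_nhds_iff.1 hV₁
  have ef0 : e (p₀, y₀) = (p₀, 0) := by rw [hef]; exact Prod.ext rfl h0
  have ht0 : (p₀, (0 : Z)) ∈ e.target := ef0 ▸ e.map_source hmem
  have hto : IsOpen {p : P | (p, (0 : Z)) ∈ e.target} :=
    e.open_target.preimage (by fun_prop)
  have hinv : ∀ p, (p, (0 : Z)) ∈ e.target →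
      (e.symm (p, 0)).1 = p ∧ G (e.symm (p, 0)) = 0 := by
    intro p hp
    have := e.right_inv hp
    rw [hef] at this
    exact Prod.ext_iff.1 this
  refine ⟨U₂ ∩ {p | (p, (0 : Z)) ∈ e.target}, V, fun p => (e.symm (p, 0)).2, hU₂o.inter hto,
    ⟨hpU₂, ht0⟩, hVo, hyV, ?_, ?_, ?_, ?_, ?_⟩
  · exact contDiff_snd.comp_contDiffOn (hes.comp (by fun_prop) fun p hp => hp.2)
  · intro p hp y hy h
    dsimp only
    have hs : (p, y) ∈ e.source := hUV ⟨hU₂ hp.1, hV hy⟩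
    have : e (p, y) = (p, 0) := by rw [hef]; exact Prod.ext rfl h
    rw [← this, e.left_inv hs]
  · intro p hp
    have := hinv p hp.2
    have hz : (p, (e.symm (p, 0)).2) = e.symm (p, 0) := Prod.ext this.1.symm rfl
    exact (congrArg G hz).trans this.2
  · dsimp only
    rw [← ef0, e.left_inv hmem]
  · intro p hp v hv
    have hz : (p, (e.symm (p, 0)).2) = e.symm (p, 0) := Prod.ext (hinv p hp.2).1.symm rfl
    obtain ⟨A', hA'⟩ := hd _ (e.map_target hp.2)
    rw [hz] at hv
    have h2 : HasFDerivAt f ((ContinuousLinearMap.fst ℝ P Y).prod (fderiv ℝ G (e.symm (p, 0))))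
        (e.symm (p, 0)) :=
      (hasFDerivAt_fst (𝕜 := ℝ)).prodMk (hG.differentiable (by simp) _).hasFDerivAt
    have h3 := congrArg (fun L : (P × Y) →L[ℝ] (P × Z) => L (0, v)) (hA'.unique h2)
    simp only [ContinuousLinearEquiv.coe_coe, ContinuousLinearMap.prod_apply, hv,
      ContinuousLinearMap.coe_fst'] at h3
    have h4 : ((0 : P), v) = 0 := A'.injective (by rw [h3, map_zero]; rfl)
    exact (Prod.ext_iff.1 h4).2

/-- A function that is smooth near a point agrees near that point with a globally smooth one. -/
theorem exists_contDiff_eventuallyEq {E F : Type*} [NormedAddCommGroup E] [NormedSpace ℝ E]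
    [FiniteDimensional ℝ E] [NormedAddCommGroup F] [NormedSpace ℝ F] {f : E → F} {x : E}
    {O : Set E} (hO : O ∈ 𝓝 x) (hf : ContDiffOn ℝ ∞ f O) :
    ∃ g : E → F, ContDiff ℝ ∞ g ∧ g =ᶠ[𝓝 x] f := by
  obtain ⟨O₁, hO₁, hO₁o, hxO⟩ := mem_nhds_iff.1 hO
  obtain ⟨r, hr, hrO⟩ := Metric.mem_nhds_iff.1 (hO₁o.mem_nhds hxO)
  let β : ContDiffBump x := ⟨r / 4, r / 2, by positivity, by linarith⟩
  refine ⟨fun z => β z • f z, ?_, ?_⟩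
  · rw [contDiff_iff_contDiffAt]
    intro z
    by_cases hz : z ∈ O₁
    · exact β.contDiff.contDiffAt.smul ((hf.mono hO₁).contDiffAt (hO₁o.mem_nhds hz))
    · have : z ∉ tsupport β := by
        rw [β.tsupport_eq]
        intro h
        exact hz (hrO (lt_of_le_of_lt (Metric.mem_closedBall.1 h) (half_lt_self hr)))
      have h0 : (fun z => β z • f z) =ᶠ[𝓝 z] fun _ => 0 := by
        filter_upwards [notMem_tsupport_iff_eventuallyEq.1 this] with w hw
        simp [hw]
      exact contDiffAt_const.congr_of_eventuallyEq h0
  · filter_upwards [β.eventuallyEq_one] with z hz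
    simp [hz]

end Implicit

/-! ### The local stable manifold of a hyperbolic fixed point -/

section LocalStable

open BoundedContinuousFunction

variable {ι : Type} [Fintype ι]

/-- A linear map into sequences of vectors, with a uniform bound on all coordinates, as a bounded
operator into the space of bounded sequences. -/
noncomputable def seqOp {X : Type} [NormedAddCommGroup X] [NormedSpace ℝ X]
    (f : X →ₗ[ℝ] (ℕ → ι → ℝ)) (C : ℝ) (hC : 0 ≤ C) (h : ∀ x k i, |f x k i| ≤ C * ‖x‖) :
    X →L[ℝ] (ℕ →ᵇ (ι → ℝ)) :=
  LinearMap.mkContinuous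
    { toFun := fun x => ofNormedAddCommGroupDiscrete (f x) (C * ‖x‖) fun k =>
        (pi_norm_le_iff_of_nonneg (by positivity)).2 (h x k)
      map_add' := fun x y => by ext k i; simp
      map_smul' := fun c x => by ext k i; simp }
    C fun x => (norm_le (by positivity)).2 fun k =>
      (pi_norm_le_iff_of_nonneg (by positivity)).2 (h x k)

theorem norm_seqOp_le {X : Type} [NormedAddCommGroup X] [NormedSpace ℝ X]
    (f : X →ₗ[ℝ] (ℕ → ι → ℝ)) (C : ℝ) (hC : 0 ≤ C) (h : ∀ x k i, |f x k i| ≤ C * ‖x‖) :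
    ‖seqOp f C hC h‖ ≤ C :=
  LinearMap.mkContinuous_norm_le _ hC _

theorem abs_apply_le_norm (v : ℕ →ᵇ (ι → ℝ)) (k : ℕ) (i : ι) : |v k i| ≤ ‖v‖ :=
  (norm_le_pi_norm (v k) i).trans (v.norm_coe_le_norm k)

/-- The sequence shifted to the right, with initial value `0`. -/
def shiftRight (v : ℕ → ι → ℝ) : ℕ → ι → ℝ
  | 0 => 0
  | k + 1 => v k

theorem abs_shiftRight_le (v : ℕ →ᵇ (ι → ℝ)) (k : ℕ) (i : ι) : |shiftRight v k i| ≤ ‖v‖ := by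
  cases k with
  | zero => simp [shiftRight]
  | succ k => exact abs_apply_le_norm v k i

/-- The linear part of the Lyapunov–Perron equation for the map with linear part `diag μ`:
contracting coordinates are propagated forwards, `v (k + 1) i = μ i * v k i`, and expanding ones
backwards, `v k i = (μ i)⁻¹ * v (k + 1) i`. -/
noncomputable def perronLinear (μ : ι → ℝ) : (ℕ →ᵇ (ι → ℝ)) →ₗ[ℝ] (ℕ → ι → ℝ) where
  toFun v k i := if 1 < μ i then (μ i)⁻¹ * v (k + 1) i else μ i * shiftRight v k i
  map_add' v w := by
    funext k i
    cases k <;> by_cases h : 1 < μ i <;> simp [h, shiftRight, mul_add]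
  map_smul' c v := by
    funext k i
    cases k <;> by_cases h : 1 < μ i <;> simp [h, shiftRight] <;> ring

/-- The way the nonlinear part enters the Lyapunov–Perron equation. -/
noncomputable def perronSource (μ : ι → ℝ) : (ℕ →ᵇ (ι → ℝ)) →ₗ[ℝ] (ℕ → ι → ℝ) where
  toFun w k i := if 1 < μ i then -((μ i)⁻¹ * w k i) else shiftRight w k i
  map_add' v w := by
    funext k i
    cases k <;> by_cases h : 1 < μ i <;> simp [h, shiftRight] <;> ring
  map_smul' c v := by
    funext k i
    cases k <;> by_cases h : 1 < μ i <;> simp [h, shiftRight] <;> ring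

/-- The way the contracting part of the initial value enters the Lyapunov–Perron equation. -/
noncomputable def perronInitial (μ : ι → ℝ) : (ι → ℝ) →ₗ[ℝ] (ℕ → ι → ℝ) where
  toFun ξ k i := if 1 < μ i then 0 else if k = 0 then ξ i else 0
  map_add' v w := by
    funext k i
    by_cases hk : k = 0 <;> by_cases h : 1 < μ i <;> simp [h, hk]
  map_smul' c v := by
    funext k i
    by_cases hk : k = 0 <;> by_cases h : 1 < μ i <;> simp [h, hk]

/-- Hyperbolicity makes the linear part of the Lyapunov–Perron equation a contraction: its norm is
at most the largest of the numbers `min (μ i) (μ i)⁻¹`. -/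
theorem exists_perron_contraction (μ : ι → ℝ) (hpos : ∀ i, 0 < μ i) (hne : ∀ i, μ i ≠ 1) :
    ∃ T : (ℕ →ᵇ (ι → ℝ)) →L[ℝ] (ℕ →ᵇ (ι → ℝ)), ‖T‖ < 1 ∧ ∀ v k, T v k = perronLinear μ v k := by
  obtain ⟨c, hc0, hc1, hc⟩ : ∃ c : ℝ, 0 ≤ c ∧ c < 1 ∧ ∀ i, min (μ i) (μ i)⁻¹ ≤ c := by
    rcases isEmpty_or_nonempty ι with h | h
    · exact ⟨0, le_rfl, one_pos, fun i => h.elim i⟩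
    · obtain ⟨j, hj⟩ := Finite.exists_max fun i => min (μ i) (μ i)⁻¹
      refine ⟨min (μ j) (μ j)⁻¹, le_min (hpos j).le (inv_pos.2 (hpos j)).le, ?_, hj⟩
      rcases lt_or_gt_of_ne (hne j) with h1 | h1
      · exact (min_le_left _ _).trans_lt h1
      · exact (min_le_right _ _).trans_lt (inv_lt_one_of_one_lt₀ h1)
  refine ⟨seqOp (perronLinear μ) c hc0 fun v k i => ?_,
    (norm_seqOp_le _ _ _ _).trans_lt hc1, fun v k => rfl⟩
  by_cases h : 1 < μ i
  · have h1 : (μ i)⁻¹ ≤ c := by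
      refine le_trans (le_min ?_ le_rfl) (hc i)
      exact (inv_lt_one_of_one_lt₀ h).le.trans h.le
    simp only [perronLinear, LinearMap.coe_mk, AddHom.coe_mk, h, if_true, abs_mul,
      abs_of_pos (inv_pos.2 (hpos i))]
    exact mul_le_mul h1 (abs_apply_le_norm v _ i) (abs_nonneg _) hc0
  · have h1 : μ i ≤ c := by
      refine le_trans (le_min le_rfl ?_) (hc i)
      have h2 : μ i ≤ 1 := not_lt.1 h
      exact h2.trans ((one_le_inv₀ (hpos i)).2 h2)
    simp only [perronLinear, LinearMap.coe_mk, AddHom.coe_mk, h, if_false, abs_mul,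
      abs_of_pos (hpos i)]
    exact mul_le_mul h1 (abs_shiftRight_le v _ i) (abs_nonneg _) hc0

theorem exists_perron_source (μ : ι → ℝ) :
    ∃ B : (ℕ →ᵇ (ι → ℝ)) →L[ℝ] (ℕ →ᵇ (ι → ℝ)), ∀ v k, B v k = perronSource μ v k := by
  let C := 1 + ∑ i, |(μ i)⁻¹|
  have hC0 : 0 ≤ C := add_nonneg zero_le_one (Finset.sum_nonneg fun i _ => abs_nonneg _)
  refine ⟨seqOp (perronSource μ) C hC0 fun v k i => ?_, fun v k => rfl⟩
  have hi : |(μ i)⁻¹| ≤ ∑ i, |(μ i)⁻¹| :=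
    Finset.single_le_sum (f := fun i => |(μ i)⁻¹|) (fun i _ => abs_nonneg _) (Finset.mem_univ i)
  by_cases h : 1 < μ i
  · simp only [perronSource, LinearMap.coe_mk, AddHom.coe_mk, h, if_true, abs_neg, abs_mul]
    exact mul_le_mul (by linarith) (abs_apply_le_norm v _ i) (abs_nonneg _) hC0
  · simp only [perronSource, LinearMap.coe_mk, AddHom.coe_mk, h, if_false]
    refine (abs_shiftRight_le v _ i).trans (le_mul_of_one_le_left (norm_nonneg _) ?_)
    exact le_add_of_nonneg_right (Finset.sum_nonneg fun i _ => abs_nonneg _)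

theorem exists_perron_initial (μ : ι → ℝ) :
    ∃ D : (ι → ℝ) →L[ℝ] (ℕ →ᵇ (ι → ℝ)), ∀ v k, D v k = perronInitial μ v k := by
  refine ⟨seqOp (perronInitial μ) 1 zero_le_one fun v k i => ?_, fun v k => rfl⟩
  rw [one_mul]
  by_cases h : 1 < μ i
  · simp [perronInitial, h]
  · by_cases hk : k = 0
    · simpa [perronInitial, h, hk] using norm_le_pi_norm v i
    · simp [perronInitial, h, hk]

/-- Solutions of the Lyapunov–Perron equation are the bounded orbits whose initial value has the
prescribed contracting coordinates. -/
theorem perron_eq_zero_iff (μ : ι → ℝ) (hpos : ∀ i, 0 < μ i) (φ : (ι → ℝ) → ι → ℝ) (ξ : ι → ℝ)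
    (v w : ℕ →ᵇ (ι → ℝ)) (hw : ∀ k i, w k i = φ (v k) i - μ i * v k i) :
    (∀ k, v k - perronLinear μ v k - perronSource μ w k - perronInitial μ ξ k = 0) ↔
      (∀ k, v (k + 1) = φ (v k)) ∧ ∀ i, ¬ 1 < μ i → v 0 i = ξ i := by
  constructor
  · intro H
    have H' : ∀ k i, v k i - perronLinear μ v k i - perronSource μ w k i
        - perronInitial μ ξ k i = 0 := fun k i => congrFun (H k) i
    constructor
    · intro k
      funext i
      by_cases h : 1 < μ i
      · have := H' k i
        simp only [perronLinear, perronSource, perronInitial, LinearMap.coe_mk, AddHom.coe_mk, h,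
          if_true, hw] at this
        have hm := (hpos i).ne'
        field_simp at this
        linarith
      · have := H' (k + 1) i
        simp only [perronLinear, perronSource, perronInitial, LinearMap.coe_mk, AddHom.coe_mk, h,
          if_false, shiftRight, hw, Nat.add_eq_zero_iff, one_ne_zero, and_false] at this
        linarith
    · intro i h
      have := H' 0 i
      simp only [perronLinear, perronSource, perronInitial, LinearMap.coe_mk, AddHom.coe_mk, h,
        if_false, if_true, shiftRight, Pi.zero_apply] at this
      linarith
  · rintro ⟨H1, H2⟩ k
    funext i
    by_cases h : 1 < μ i
    · have hm := (hpos i).ne'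
      simp only [perronLinear, perronSource, perronInitial, LinearMap.coe_mk, AddHom.coe_mk, h,
        if_true, hw, H1, Pi.sub_apply, Pi.zero_apply]
      field_simp
      ring
    · cases k with
      | zero =>
        simp [perronLinear, perronSource, perronInitial, h, shiftRight, H2 i h]
      | succ k =>
        simp [perronLinear, perronSource, perronInitial, h, shiftRight, hw, H1]

theorem iterate_eq_of_orbit {X : Type*} {φ : X → X} {v : ℕ → X} (h : ∀ k, v (k + 1) = φ (v k))
    (k : ℕ) : φ^[k] (v 0) = v k := by
  induction k with
  | zero => rfl
  | succ k ih => rw [Function.iterate_succ_apply', ih, h]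

/-- The local stable manifold theorem for a hyperbolic fixed point with diagonal linearization:
near `0`, the points whose forward orbit stays near `0` are the zeros of a submersion `F`
with values in the expanding coordinates. -/
theorem exists_local_stable_diagonal {φ : (ι → ℝ) → ι → ℝ} (hφ : ContDiff ℝ ∞ φ) (h0 : φ 0 = 0)
    (μ : ι → ℝ) (hpos : ∀ i, 0 < μ i) (hne : ∀ i, μ i ≠ 1)
    (hd : ∀ v i, fderiv ℝ φ 0 v i = μ i * v i) :
    ∃ (F : (ι → ℝ) → {i // 1 < μ i} → ℝ) (O : Set (ι → ℝ)), IsOpen O ∧ 0 ∈ O ∧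
      ContDiffOn ℝ ∞ F O ∧ F 0 = 0 ∧
      (∀ v : ι → ℝ, (∀ i, ¬ 1 < μ i → v i = 0) → fderiv ℝ F 0 v = fun i : {i // 1 < μ i} => v i.1) ∧
      (∀ W ∈ 𝓝 (0 : ι → ℝ), ∀ᶠ z in 𝓝 0, F z = 0 → ∀ k, φ^[k] z ∈ W) ∧
      ∃ W ∈ 𝓝 (0 : ι → ℝ), ∀ z, (∀ k, φ^[k] z ∈ W) → F z = 0 := by
  obtain ⟨T, hT, hTa⟩ := exists_perron_contraction μ hpos hne
  obtain ⟨B, hB⟩ := exists_perron_source μ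
  obtain ⟨D, hD⟩ := exists_perron_initial μ
  let L : (ι → ℝ) →L[ℝ] (ι → ℝ) := fderiv ℝ φ 0
  -- the nonlinear part of `φ`
  let h : (ι → ℝ) → ι → ℝ := fun z => φ z - L z
  have hh : ContDiff ℝ ∞ h := hφ.sub L.contDiff
  have hh0 : h 0 = 0 := by simp [h, h0]
  have hfh : fderiv ℝ h 0 = 0 := by
    have h1 : HasFDerivAt h (fderiv ℝ φ 0 - L) 0 :=
      ((hφ.differentiable (by simp) 0).hasFDerivAt).sub L.hasFDerivAt
    rw [h1.fderiv]
    exact sub_self _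
  let N : (ℕ →ᵇ (ι → ℝ)) → (ℕ →ᵇ (ι → ℝ)) := superposition h hh.continuous
  have hN : ContDiff ℝ ∞ N := contDiff_superposition hh
  have hN0 : N 0 = 0 := by ext k; simp [N, hh0]
  have hN' : HasFDerivAt N (0 : (ℕ →ᵇ (ι → ℝ)) →L[ℝ] (ℕ →ᵇ (ι → ℝ))) 0 := by
    have := hasFDerivAt_superposition (α := ℕ) (hh.of_le (m := 1) (by exact_mod_cast le_top)) 0
    refine this.congr_fderiv ?_
    ext v k
    simp [hfh]
  -- the Lyapunov–Perron equation for the orbit `z.2`, with contracting initial coordinates `z.1`;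
  -- its derivative in `z.2` at the origin is `1 - T`, which is invertible
  let G : (ι → ℝ) × (ℕ →ᵇ (ι → ℝ)) → (ℕ →ᵇ (ι → ℝ)) :=
    fun z => z.2 - T z.2 - B (N z.2) - D z.1
  have hG : ContDiff ℝ ∞ G :=
    ((contDiff_snd.sub (T.contDiff.comp contDiff_snd)).sub
      (B.contDiff.comp (hN.comp contDiff_snd))).sub (D.contDiff.comp contDiff_fst)
  have hG0 : G (0, 0) = 0 := by simp [G, hN0]
  let A : (ℕ →ᵇ (ι → ℝ)) ≃L[ℝ] (ℕ →ᵇ (ι → ℝ)) :=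
    ContinuousLinearEquiv.ofUnit (Units.oneSub T hT)
  have hAa : ∀ v, A v = v - T v := fun v => rfl
  have hGd : HasFDerivAt G ((-D).coprod (A : (ℕ →ᵇ (ι → ℝ)) →L[ℝ] (ℕ →ᵇ (ι → ℝ)))) (0, 0) := by
    have hs : HasFDerivAt (fun z : (ι → ℝ) × (ℕ →ᵇ (ι → ℝ)) => z.2)
      (ContinuousLinearMap.snd ℝ (ι → ℝ) (ℕ →ᵇ (ι → ℝ))) (0, 0) := hasFDerivAt_snd
    have hf : HasFDerivAt (fun z : (ι → ℝ) × (ℕ →ᵇ (ι → ℝ)) => z.1)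
      (ContinuousLinearMap.fst ℝ (ι → ℝ) (ℕ →ᵇ (ι → ℝ))) (0, 0) := hasFDerivAt_fst
    have hNs : HasFDerivAt (fun z : (ι → ℝ) × (ℕ →ᵇ (ι → ℝ)) => N z.2)
      ((0 : (ℕ →ᵇ (ι → ℝ)) →L[ℝ] (ℕ →ᵇ (ι → ℝ))) ∘L
        ContinuousLinearMap.snd ℝ (ι → ℝ) (ℕ →ᵇ (ι → ℝ))) (0, 0) :=
      HasFDerivAt.comp (f := fun z : (ι → ℝ) × (ℕ →ᵇ (ι → ℝ)) => z.2) (0, 0) hN' hs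
    refine (((hs.sub (T.hasFDerivAt.comp _ hs)).sub (B.hasFDerivAt.comp _ hNs)).sub
      (D.hasFDerivAt.comp _ hf)).congr_fderiv ?_
    refine ContinuousLinearMap.ext fun z => ?_
    simp [hAa]
    abel
  obtain ⟨U, V, s, hU, h0U, hV, h0V, hs, huniq, hsol, hs0, hinj⟩ :=
    exists_smooth_implicit hG hG0 A (-D) hGd
  have hsol_iff : ∀ ξ v, G (ξ, v) = 0 ↔ (∀ k, v (k + 1) = φ (v k)) ∧
      ∀ i, ¬ 1 < μ i → v 0 i = ξ i := by
    intro ξ v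
    rw [← perron_eq_zero_iff μ hpos φ ξ v (N v) fun k i => by
      simp only [N, superposition_apply, h, Pi.sub_apply]; rw [← hd]]
    simp only [G, ← hTa, ← hB, ← hD]
    exact BoundedContinuousFunction.ext_iff
  let ev : (ℕ →ᵇ (ι → ℝ)) →L[ℝ] (ι → ℝ) := BoundedContinuousFunction.evalCLM ℝ 0
  let R : (ι → ℝ) →L[ℝ] ({i // 1 < μ i} → ℝ) :=
    ContinuousLinearMap.pi fun i => ContinuousLinearMap.proj i.1
  have hsd : DifferentiableAt ℝ s 0 :=
    (hs.contDiffAt (hU.mem_nhds h0U)).differentiableAt (by simp)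
  have hscont : ContinuousAt s 0 := hsd.continuousAt
  -- `s z` is the small bounded orbit with the contracting coordinates of `z`, so `F z` compares the
  -- expanding coordinates of `z` with those of the initial point of this orbit
  refine ⟨fun z => R (z - ev (s z)), U, hU, h0U, ?_, ?_, ?_, ?_, ?_⟩
  · exact R.contDiff.comp_contDiffOn (contDiffOn_id.sub (ev.contDiff.comp_contDiffOn hs))
  · simp [hs0]
  · intro v hv
    have hG0' : DifferentiableAt ℝ G (0, s 0) := hG.differentiable (by simp) _
    have h1 : HasFDerivAt (fun p => G (p, s p))
        (fderiv ℝ G (0, s 0) ∘L (ContinuousLinearMap.id ℝ _).prod (fderiv ℝ s 0)) 0 :=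
      HasFDerivAt.comp (f := fun p => (p, s p)) 0 hG0'.hasFDerivAt
        ((hasFDerivAt_id _).prodMk hsd.hasFDerivAt)
    have h2 : HasFDerivAt (fun p => G (p, s p))
        (0 : (ι → ℝ) →L[ℝ] (ℕ →ᵇ (ι → ℝ))) 0 :=
      (hasFDerivAt_const (0 : ℕ →ᵇ (ι → ℝ)) (0 : ι → ℝ)).congr_of_eventuallyEq (by
        filter_upwards [hU.mem_nhds h0U] with p hp using hsol p hp)
    have h3 := congrArg (fun l => l v) (h1.unique h2)
    simp only [ContinuousLinearMap.comp_apply, ContinuousLinearMap.prod_apply,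
      ContinuousLinearMap.id_apply, zero_apply] at h3
    -- `v` has no contracting coordinates, so that to first order the orbit `s` does not move
    have hDv : D v = 0 := by
      ext k i
      rw [hD]
      by_cases h : 1 < μ i <;> simp [perronInitial, h, hv]
    have h4 : fderiv ℝ G (0, s 0) (v, 0) = 0 := by
      rw [hs0, hGd.fderiv]; simp [hDv]
    have h5 : fderiv ℝ G (0, s 0) (0, fderiv ℝ s 0 v) = 0 := by
      have : ((0 : ι → ℝ), fderiv ℝ s 0 v) = (v, fderiv ℝ s 0 v) - (v, 0) := by simp
      rw [this, map_sub, h3, h4, sub_zero]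
    have h6 := hinj 0 h0U _ h5
    have h7 : HasFDerivAt (fun z => R (z - ev (s z)))
        (R ∘L (ContinuousLinearMap.id ℝ _ - ev ∘L fderiv ℝ s 0)) 0 :=
      R.hasFDerivAt.comp 0 ((hasFDerivAt_id _).sub (ev.hasFDerivAt.comp 0 hsd.hasFDerivAt))
    rw [h7.fderiv]
    simp [h6]
    rfl
  · intro W hW
    obtain ⟨r, hr, hrW⟩ := Metric.mem_nhds_iff.1 hW
    have h1 : ∀ᶠ z in 𝓝 0, s z ∈ Metric.ball (0 : ℕ →ᵇ (ι → ℝ)) r :=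
      hscont (by rw [hs0]; exact Metric.ball_mem_nhds _ hr)
    filter_upwards [h1, hU.mem_nhds h0U] with z hz hzU hFz k
    obtain ⟨h2, h3⟩ := (hsol_iff _ _).1 (hsol z hzU)
    have h4 : s z 0 = z := by
      funext i
      by_cases h : 1 < μ i
      · have := congrFun hFz ⟨i, h⟩
        exact (sub_eq_zero.1 this).symm
      · exact h3 i h
    have h5 := iterate_eq_of_orbit h2 k
    rw [h4] at h5
    rw [h5]
    refine hrW ?_
    rw [mem_ball_zero_iff] at hz ⊢
    exact ((s z).norm_coe_le_norm k).trans_lt hz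
  · obtain ⟨r, hr, hrV⟩ := Metric.mem_nhds_iff.1 (hV.mem_nhds h0V)
    refine ⟨U ∩ Metric.closedBall 0 (r / 2),
      inter_mem (hU.mem_nhds h0U) (Metric.closedBall_mem_nhds _ (by positivity)), fun z hz => ?_⟩
    let v : ℕ →ᵇ (ι → ℝ) := ofNormedAddCommGroupDiscrete (fun k => φ^[k] z) (r / 2) fun k => by
      simpa using (hz k).2
    have hvV : v ∈ V := by
      refine hrV ?_
      rw [mem_ball_zero_iff]
      refine lt_of_le_of_lt ((norm_le (by positivity)).2 fun k => ?_) (half_lt_self hr)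
      exact mem_closedBall_zero_iff.1 (hz k).2
    have hv : v = s z := huniq z (hz 0).1 v hvV ((hsol_iff z v).2
      ⟨fun k => Function.iterate_succ_apply' φ k z, fun i _ => rfl⟩)
    have hv0 : ev (s z) = z := by rw [← hv]; rfl
    simp [hv0]

end LocalStable

/-! ### Smooth local flows of smooth vector fields -/

section LocalFlow

open BoundedContinuousFunction

variable {E : Type} [NormedAddCommGroup E]

variable (E) in
/-- Curves parametrized by `[-1, 1]`. -/
abbrev UnitCurve : Type := Icc (-1 : ℝ) 1 →ᵇ E

/-- The extension of a curve to the real line by its end points. -/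
noncomputable def UnitCurve.extend (x : UnitCurve E) : ℝ → E :=
  IccExtend (by norm_num : (-1 : ℝ) ≤ 1) x

theorem UnitCurve.continuous_extend (x : UnitCurve E) : Continuous x.extend :=
  x.continuous.Icc_extend'

theorem UnitCurve.extend_of_mem (x : UnitCurve E) {s : ℝ} (hs : s ∈ Icc (-1 : ℝ) 1) :
    x.extend s = x ⟨s, hs⟩ := IccExtend_of_mem _ _ hs

theorem UnitCurve.norm_extend_le (x : UnitCurve E) (s : ℝ) : ‖x.extend s‖ ≤ ‖x‖ :=
  x.norm_coe_le_norm _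

variable [NormedSpace ℝ E]

theorem UnitCurve.norm_integral_le (x : UnitCurve E) (s : Icc (-1 : ℝ) 1) :
    ‖∫ r in (0 : ℝ)..s, x.extend r‖ ≤ 1 * ‖x‖ := by
  refine (intervalIntegral.norm_integral_le_of_norm_le_const
    (fun r _ => x.norm_extend_le r)).trans ?_
  rw [mul_comm]
  gcongr
  simpa using abs_le.2 s.2

variable (E) in
/-- The primitive of a curve, as a bounded operator. -/
noncomputable def curveIntegral : UnitCurve E →L[ℝ] UnitCurve E :=
  LinearMap.mkContinuous
    { toFun := fun x => ofNormedAddCommGroup (fun s : Icc (-1 : ℝ) 1 =>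
        ∫ r in (0 : ℝ)..s, x.extend r)
        ((intervalIntegral.continuous_primitive
          (fun a b => x.continuous_extend.intervalIntegrable a b) 0).comp continuous_subtype_val)
        (1 * ‖x‖) x.norm_integral_le
      map_add' := fun x y => by
        ext s
        exact intervalIntegral.integral_add (x.continuous_extend.intervalIntegrable _ _)
          (y.continuous_extend.intervalIntegrable _ _)
      map_smul' := fun c x => by
        ext s
        exact intervalIntegral.integral_smul c x.extend }
    1 fun x => (norm_le (by positivity)).2 x.norm_integral_le

theorem curveIntegral_apply (x : UnitCurve E) (s : Icc (-1 : ℝ) 1) :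
    curveIntegral E x s = ∫ r in (0 : ℝ)..s, x.extend r := rfl

variable (E) in
/-- The constant curves. -/
noncomputable def constCurve : E →L[ℝ] UnitCurve E :=
  LinearMap.mkContinuous
    { toFun := fun ξ => const _ ξ
      map_add' := fun x y => rfl
      map_smul' := fun c x => rfl }
    1 fun ξ => by rw [one_mul]; exact norm_const_le ξ

@[simp]
theorem constCurve_apply (ξ : E) (s : Icc (-1 : ℝ) 1) : constCurve E ξ s = ξ := rfl

/-- The integral equation `x(s) = ξ + ε ∫₀ˢ X(x(r)) dr` for the flow of `ε X`, whose solutions are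
the integral curves of `X`, run at speed `ε`. At `ε = 0` its derivative in `x` is the identity. -/
noncomputable def flowEquation (X : E → E) [ProperSpace E] (hX : Continuous X)
    (z : (E × ℝ) × UnitCurve E) : UnitCurve E :=
  z.2 - constCurve E z.1.1 - z.1.2 • curveIntegral E (superposition X hX z.2)

variable [ProperSpace E]

theorem contDiff_flowEquation {X : E → E} (hX : ContDiff ℝ ∞ X) :
    ContDiff ℝ ∞ (flowEquation X hX.continuous) := by
  refine (contDiff_snd.sub ((constCurve E).contDiff.comp contDiff_fst.fst)).sub ?_
  exact contDiff_fst.snd.smul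
    ((curveIntegral E).contDiff.comp ((contDiff_superposition hX).comp contDiff_snd))

theorem fderiv_flowEquation {X : E → E} (hX : ContDiff ℝ ∞ X) (z w : (E × ℝ) × UnitCurve E) :
    fderiv ℝ (flowEquation X hX.continuous) z w =
      w.2 - constCurve E w.1.1 - (z.1.2 • curveIntegral E (pointwiseApply _ E E
        (superposition (fderiv ℝ X) (hX.continuous_fderiv (by simp)) z.2) w.2) +
        w.1.2 • curveIntegral E (superposition X hX.continuous z.2)) := by
  have h1 : ContDiff ℝ 1 X := hX.of_le (by exact_mod_cast le_top)
  have hx : HasFDerivAt (fun z : (E × ℝ) × UnitCurve E => z.2)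
    (ContinuousLinearMap.snd ℝ (E × ℝ) (UnitCurve E)) z := hasFDerivAt_snd
  have hp : HasFDerivAt (fun z : (E × ℝ) × UnitCurve E => z.1)
    (ContinuousLinearMap.fst ℝ (E × ℝ) (UnitCurve E)) z := hasFDerivAt_fst
  have hN := HasFDerivAt.comp (f := fun z : (E × ℝ) × UnitCurve E => z.2) z
    (hasFDerivAt_superposition h1 z.2) hx
  have := (hx.sub ((constCurve E).hasFDerivAt.comp z hp.fst)).sub
    (hp.snd.smul ((curveIntegral E).hasFDerivAt.comp z hN))
  have h2 : HasFDerivAt (flowEquation X hX.continuous) _ z := this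
  rw [h2.fderiv]
  simp

/-- A smooth vector field has a local flow, smooth in the initial value: apply the implicit function
theorem to `flowEquation` at `ε = 0` and rescale time. Moreover, at a zero of the
vector field, an eigenvector of the linearization of the field with eigenvalue `c` is
an eigenvector of the linearization of the time-`t` map with eigenvalue `exp (c t)`. -/
theorem exists_local_flow {X : E → E} (hX : ContDiff ℝ ∞ X) (ξ₀ : E) {W : Set E}
    (hW : W ∈ 𝓝 ξ₀) :
    ∃ (δ : ℝ) (U : Set E) (Φ : ℝ → E → E), 0 < δ ∧ IsOpen U ∧ ξ₀ ∈ U ∧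
      (∀ t ∈ Ioo (-δ) δ, ContDiffOn ℝ ∞ (Φ t) U) ∧ (∀ ξ ∈ U, Φ 0 ξ = ξ) ∧
      (∀ ξ ∈ U, ∀ t ∈ Ioo (-δ) δ, Φ t ξ ∈ W) ∧
      (∀ ξ ∈ U, ∀ t ∈ Ioo (-δ) δ, HasDerivAt (fun t => Φ t ξ) (X (Φ t ξ)) t) ∧
      (X ξ₀ = 0 → (∀ V ∈ 𝓝 ξ₀, ∀ᶠ ξ in 𝓝 ξ₀, ∀ t ∈ Ioo (-δ) δ, Φ t ξ ∈ V) ∧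
        ∀ (c : ℝ) (e : E), fderiv ℝ X ξ₀ e = c • e →
          ∀ t ∈ Ioo (-δ) δ, fderiv ℝ (Φ t) ξ₀ e = Real.exp (c * t) • e) := by
  set G := flowEquation X hX.continuous with hGdef
  have hG : ContDiff ℝ ∞ G := contDiff_flowEquation hX
  have hG0 : G ((ξ₀, 0), constCurve E ξ₀) = 0 := by simp [G, flowEquation]
  let B : (E × ℝ) →L[ℝ] UnitCurve E :=
    -((constCurve E) ∘L ContinuousLinearMap.fst ℝ E ℝ) -
      (ContinuousLinearMap.snd ℝ E ℝ).smulRight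
        (curveIntegral E (superposition X hX.continuous (constCurve E ξ₀)))
  have hGd : HasFDerivAt G (B.coprod (ContinuousLinearEquiv.refl ℝ (UnitCurve E) :
      UnitCurve E →L[ℝ] UnitCurve E)) ((ξ₀, 0), constCurve E ξ₀) := by
    refine ((hG.differentiable (by simp)) _).hasFDerivAt.congr_fderiv ?_
    refine ContinuousLinearMap.ext fun w => ?_
    rw [fderiv_flowEquation hX]
    simp [B]
    abel
  obtain ⟨U, V, s, hU, h0U, hV, h0V, hs, huniq, hsol, hs0, hinj⟩ :=
    exists_smooth_implicit hG hG0 (ContinuousLinearEquiv.refl ℝ (UnitCurve E)) B hGd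
  have hscont : ContinuousAt s (ξ₀, 0) := (hs.contDiffAt (hU.mem_nhds h0U)).continuousAt
  obtain ⟨r, hr, hrW⟩ := Metric.mem_nhds_iff.1 hW
  have hev : ∀ᶠ p in 𝓝 ((ξ₀, 0) : E × ℝ), p ∈ U ∧ s p ∈ Metric.ball (constCurve E ξ₀) r :=
    (hU.eventually_mem h0U).and (hscont (by rw [hs0]; exact Metric.ball_mem_nhds _ hr))
  obtain ⟨U₁, hU₁, hU₁o, h0U₁⟩ := eventually_nhds_iff.1 hev
  obtain ⟨U₂, hU₂, I, hI, hUI⟩ := mem_nhds_prod_iff.1 (hU₁o.mem_nhds h0U₁)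
  obtain ⟨δ', hδ', hδI⟩ := Metric.mem_nhds_iff.1 hI
  obtain ⟨U₃, hU₃, hU₃o, h0U₃⟩ := mem_nhds_iff.1 hU₂
  obtain ⟨δ, hδ, hδδ'⟩ := exists_between hδ'
  have hmem : ∀ ξ ∈ U₃, (ξ, δ) ∈ U ∧ s (ξ, δ) ∈ Metric.ball (constCurve E ξ₀) r := fun ξ hξ =>
    hU₁ _ (hUI ⟨hU₃ hξ, hδI (by simpa [abs_of_pos hδ] using hδδ')⟩)
  have htδ : ∀ t ∈ Ioo (-δ) δ, t / δ ∈ Ioo (-1 : ℝ) 1 := fun t ht =>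
    ⟨by rw [lt_div_iff₀ hδ]; linarith [ht.1], by rw [div_lt_iff₀ hδ]; linarith [ht.2]⟩
  have htδ' : ∀ t ∈ Ioo (-δ) δ, t / δ ∈ Icc (-1 : ℝ) 1 := fun t ht => Ioo_subset_Icc_self (htδ t ht)
  have hσ : ContDiffOn ℝ ∞ (fun ξ => s (ξ, δ)) U₃ :=
    hs.comp (by fun_prop) fun ξ hξ => (hmem ξ hξ).1
  have heq : ∀ ξ ∈ U₃, ∀ a (ha : a ∈ Icc (-1 : ℝ) 1), (s (ξ, δ)).extend a =
      ξ + δ • ∫ r in (0 : ℝ)..a, X ((s (ξ, δ)).extend r) := by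
    intro ξ hξ a ha
    have h1 := DFunLike.congr_fun (hsol _ (hmem ξ hξ).1) ⟨a, ha⟩
    simp only [hGdef, flowEquation, coe_sub, coe_smul, Pi.sub_apply, constCurve_apply,
      curveIntegral_apply, coe_zero, Pi.zero_apply] at h1
    rw [UnitCurve.extend_of_mem _ ha]
    rw [sub_sub, sub_eq_zero] at h1
    exact h1
  -- the solution for `ε = δ` runs at speed `δ` through the times in `[-1, 1]`
  refine ⟨δ, U₃, fun t ξ => (s (ξ, δ)).extend (t / δ), hδ, hU₃o, h0U₃, ?_, ?_, ?_, ?_, ?_⟩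
  · intro t ht
    exact (BoundedContinuousFunction.evalCLM ℝ
      (projIcc (-1 : ℝ) 1 (by norm_num) (t / δ))).contDiff.comp_contDiffOn hσ
  · intro ξ hξ
    simp only [zero_div]
    rw [heq ξ hξ 0 (by norm_num)]
    simp
  · intro ξ hξ t ht
    refine hrW ?_
    simp only [UnitCurve.extend_of_mem _ (htδ' t ht)]
    exact (BoundedContinuousFunction.dist_coe_le_dist _).trans_lt (hmem ξ hξ).2
  · intro ξ hξ t ht
    set x := s (ξ, δ)
    have hc : Continuous fun r => X (x.extend r) := hX.continuous.comp x.continuous_extend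
    have h1 : HasDerivAt (fun a => ξ + δ • ∫ r in (0 : ℝ)..a, X (x.extend r))
        (δ • X (x.extend (t / δ))) (t / δ) := by
      have := (hc.integral_hasStrictDerivAt 0 (t / δ)).hasDerivAt.const_smul δ
      simpa using this.const_add ξ
    have h2 : HasDerivAt x.extend (δ • X (x.extend (t / δ))) (t / δ) :=
      h1.congr_of_eventuallyEq (by
        filter_upwards [isOpen_Ioo.mem_nhds (htδ t ht)] with a ha
        exact heq ξ hξ a (Ioo_subset_Icc_self ha))
    have h3 := h2.scomp t ((hasDerivAt_id t).div_const δ)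
    refine h3.congr_deriv ?_
    rw [smul_smul, one_div, inv_mul_cancel₀ hδ.ne', one_smul]
  · intro hX0
    have hsup : superposition X hX.continuous (constCurve E ξ₀) = 0 := by
      ext a; simp [hX0]
    have hsδ : s (ξ₀, δ) = constCurve E ξ₀ := by
      refine (huniq _ (hmem ξ₀ h0U₃).1 _ h0V ?_).symm
      simp [hGdef, flowEquation, hsup]
    have hσ0 : ContDiffAt ℝ ∞ (fun ξ => s (ξ, δ)) ξ₀ := hσ.contDiffAt (hU₃o.mem_nhds h0U₃)
    refine ⟨fun V hV => ?_, ?_⟩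
    · obtain ⟨ρ, hρ, hρV⟩ := Metric.mem_nhds_iff.1 hV
      have : ∀ᶠ ξ in 𝓝 ξ₀, s (ξ, δ) ∈ Metric.ball (constCurve E ξ₀) ρ :=
        hσ0.continuousAt (by rw [hsδ]; exact Metric.ball_mem_nhds _ hρ)
      filter_upwards [this] with ξ hξ t ht
      refine hρV ?_
      simp only [UnitCurve.extend_of_mem _ (htδ' t ht)]
      exact (BoundedContinuousFunction.dist_coe_le_dist _).trans_lt hξ
    · intro c e he t ht
      have hσd := (hσ0.differentiableAt (by simp)).hasFDerivAt
      have h1 : HasFDerivAt (fun ξ => G ((ξ, δ), s (ξ, δ)))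
          (fderiv ℝ G ((ξ₀, δ), s (ξ₀, δ)) ∘L
            ((ContinuousLinearMap.inl ℝ E ℝ).prod (fderiv ℝ (fun ξ => s (ξ, δ)) ξ₀))) ξ₀ :=
        HasFDerivAt.comp (f := fun ξ => ((ξ, δ), s (ξ, δ))) ξ₀
          (hG.differentiable (by simp) _).hasFDerivAt
          ((hasFDerivAt_prodMk_left ξ₀ δ).prodMk hσd)
      have h2 : HasFDerivAt (fun ξ => G ((ξ, δ), s (ξ, δ))) (0 : E →L[ℝ] UnitCurve E) ξ₀ :=
        (hasFDerivAt_const (0 : UnitCurve E) ξ₀).congr_of_eventuallyEq (by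
          filter_upwards [hU₃o.mem_nhds h0U₃] with ξ hξ using hsol _ (hmem ξ hξ).1)
      have h3 := congrArg (fun l => l e) (h1.unique h2)
      simp only [ContinuousLinearMap.comp_apply, ContinuousLinearMap.prod_apply,
        ContinuousLinearMap.inl_apply, zero_apply] at h3
      -- the solution of the linearized integral equation with initial value `e`
      let Z : UnitCurve E := ofNormedAddCommGroup
        (fun a : Icc (-1 : ℝ) 1 => Real.exp (c * δ * a) • e) (by fun_prop)
        (Real.exp |c * δ| * ‖e‖) fun a => by
          rw [norm_smul, Real.norm_eq_abs, Real.abs_exp]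
          gcongr
          refine (le_abs_self _).trans ?_
          rw [abs_mul]
          exact mul_le_of_le_one_right (abs_nonneg _) (abs_le.2 a.2)
      have hZ : fderiv ℝ G ((ξ₀, δ), s (ξ₀, δ)) ((e, 0), Z) = 0 := by
        rw [hGdef, fderiv_flowEquation hX]
        ext a
        simp only [zero_smul, add_zero, coe_sub, coe_smul, Pi.sub_apply, constCurve_apply,
          curveIntegral_apply, coe_zero, Pi.zero_apply]
        have hd : ∀ r : ℝ, HasDerivAt (fun r : ℝ => Real.exp (c * δ * r) • e)
            ((Real.exp (c * δ * r) * (c * δ)) • e) r := fun r => by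
          have := (((hasDerivAt_id r).const_mul (c * δ)).exp).smul_const e
          simpa using this
        have hint : ∫ r in (0 : ℝ)..a, (Real.exp (c * δ * r) * (c * δ)) • e =
            Real.exp (c * δ * a) • e - e := by
          rw [intervalIntegral.integral_eq_sub_of_hasDerivAt (fun r _ => hd r)
            ((by fun_prop : Continuous fun r : ℝ =>
              (Real.exp (c * δ * r) * (c * δ)) • e).intervalIntegrable _ _)]
          simp
        rw [← intervalIntegral.integral_smul]
        have hcongr : ∫ r in (0 : ℝ)..a, δ • UnitCurve.extend (pointwiseApply (Icc (-1 : ℝ) 1) E E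
            (superposition (fderiv ℝ X) (hX.continuous_fderiv (by simp)) (s (ξ₀, δ))) Z) r =
            ∫ r in (0 : ℝ)..a, (Real.exp (c * δ * r) * (c * δ)) • e := by
          refine intervalIntegral.integral_congr fun r hr => ?_
          have hr' : r ∈ Icc (-1 : ℝ) 1 :=
            uIcc_subset_Icc (by norm_num) a.2 hr
          simp only [UnitCurve.extend_of_mem _ hr', pointwiseApply_apply, superposition_apply,
            hsδ, constCurve_apply]
          change δ • fderiv ℝ X ξ₀ (Real.exp (c * δ * r) • e) = _
          rw [map_smul, he, smul_smul, smul_smul]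
          congr 1
          ring
        rw [hcongr, hint]
        change Real.exp (c * δ * a) • e - e - (Real.exp (c * δ * a) • e - e) = 0
        exact sub_self _
      have h5 : fderiv ℝ G ((ξ₀, δ), s (ξ₀, δ))
          (0, fderiv ℝ (fun ξ => s (ξ, δ)) ξ₀ e - Z) = 0 := by
        have : ((0 : E × ℝ), fderiv ℝ (fun ξ => s (ξ, δ)) ξ₀ e - Z) =
            ((e, 0), fderiv ℝ (fun ξ => s (ξ, δ)) ξ₀ e) - ((e, 0), Z) := by simp
        rw [this, map_sub, h3, hZ, sub_zero]
      -- `Z` and the derivative of `s` both solve the linearized equation, which has one solution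
      have h6 := sub_eq_zero.1 (hinj _ (hmem ξ₀ h0U₃).1 _ h5)
      let ev : UnitCurve E →L[ℝ] E :=
        BoundedContinuousFunction.evalCLM ℝ (projIcc (-1 : ℝ) 1 (by norm_num) (t / δ))
      have h7 : HasFDerivAt (fun ξ => (s (ξ, δ)).extend (t / δ))
          (ev ∘L fderiv ℝ (fun ξ => s (ξ, δ)) ξ₀) ξ₀ :=
        HasFDerivAt.comp (f := fun ξ => s (ξ, δ)) ξ₀ ev.hasFDerivAt hσd
      rw [h7.fderiv, ContinuousLinearMap.comp_apply, h6]
      change Z (projIcc (-1 : ℝ) 1 _ (t / δ)) = _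
      rw [projIcc_of_mem _ (htδ' t ht)]
      change Real.exp (c * δ * (t / δ)) • e = _
      congr 2
      field_simp

end LocalFlow

/-! ### Orientations of vector spaces and signs of determinants -/

section LinearOrientation

variable {V : Type*} [AddCommGroup V] [Module ℝ V] {k : ℕ}

/-- The determinant of the images of `v₁, …, v_k` under `Λ : V → ℝᵏ`. -/
noncomputable def detAlong (Λ : V →ₗ[ℝ] (Fin k → ℝ)) : V [⋀^Fin k]→ₗ[ℝ] ℝ :=
  Matrix.detRowAlternating.compLinearMap Λ

theorem detAlong_apply (Λ : V →ₗ[ℝ] (Fin k → ℝ)) (v : Fin k → V) :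
    detAlong Λ v = Matrix.det (Matrix.of fun i => Λ (v i)) := rfl

theorem detAlong_basis (Λ : V →ₗ[ℝ] (Fin k → ℝ)) (b b' : Basis (Fin k) ℝ V) :
    detAlong Λ b' = detAlong Λ b * b.det b' := by
  have h := congrArg (fun f => f b') ((detAlong Λ).eq_smul_basis_det b)
  simpa using h

theorem detAlong_ne_zero {Λ : V →ₗ[ℝ] (Fin k → ℝ)} (hΛ : ∀ v, Λ v = 0 → v = 0)
    (b : Basis (Fin k) ℝ V) : detAlong Λ b ≠ 0 := by
  have hinj : Function.Injective Λ := (injective_iff_map_eq_zero Λ).2 hΛ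
  have hli : LinearIndependent ℝ fun i => Λ (b i) :=
    b.linearIndependent.map' Λ (LinearMap.ker_eq_bot.2 hinj)
  rw [detAlong_apply]
  have := Matrix.linearIndependent_rows_iff_isUnit.1
    (show LinearIndependent ℝ (Matrix.of fun i => Λ (b i)).row from hli)
  exact ((Matrix.isUnit_iff_isUnit_det _).1 this).ne_zero

/-- Whether a basis represents `o` is the sign of its determinant relative to a basis that does. -/
theorem represents_iff_of_represents {o : VectorOrientation V} {b b' : Basis (Fin k) ℝ V}
    (h : Represents b o) : Represents b' o ↔ 0 < b.det b' := by
  have e : k = finrank ℝ V := by simp [finrank_eq_card_basis b]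
  unfold Represents at h ⊢
  rw [← h, eq_comm, Basis.orientation_eq_iff_det_pos, Basis.det_reindex]
  have : (⇑(b'.reindex (finCongr e)) ∘ ⇑(finCongr e)) = b' := by
    funext i; simp
  rw [this]

theorem represents_neg_iff {o : VectorOrientation V} {b : Basis (Fin k) ℝ V} :
    Represents b (-o) ↔ ¬ Represents b o := by
  unfold Represents
  constructor
  · intro h h'
    exact Module.Ray.ne_neg_self o (h'.symm.trans h)
  · intro h
    have h1 := (Basis.orientation_ne_iff_eq_neg _ o).1 (Ne.symm h)
    rw [h1]
    exact (neg_neg (G := Module.Ray ℝ (V [⋀^Fin (finrank ℝ V)]→ₗ[ℝ] ℝ)) _).symm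

/-- The orientation for which the positive bases are those with `s * det (Λ b) > 0`. -/
theorem exists_vectorOrientation {Λ : V →ₗ[ℝ] (Fin k → ℝ)} (hΛ : ∀ v, Λ v = 0 → v = 0)
    {s : ℝ} (hs : s ≠ 0) (hk : Nonempty (Basis (Fin k) ℝ V)) :
    ∃ o : VectorOrientation V, ∀ b : Basis (Fin k) ℝ V, Represents b o ↔ 0 < s * detAlong Λ b := by
  obtain ⟨b₀⟩ := hk
  have e : k = finrank ℝ V := by simp [finrank_eq_card_basis b₀]
  have h0 := detAlong_ne_zero hΛ b₀
  have hr : Represents b₀ ((b₀.reindex (finCongr e)).orientation) := rfl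
  have key : ∀ b : Basis (Fin k) ℝ V, s * detAlong Λ b = (s * detAlong Λ b₀) * b₀.det b := by
    intro b; rw [detAlong_basis Λ b₀ b]; ring
  rcases lt_or_gt_of_ne (mul_ne_zero hs h0) with h | h
  · refine ⟨-(b₀.reindex (finCongr e)).orientation, fun b => ?_⟩
    rw [represents_neg_iff, represents_iff_of_represents hr, key, not_lt]
    exact ⟨fun h' => mul_pos_of_neg_of_neg h (lt_of_le_of_ne h' (b₀.isUnit_det b).ne_zero),
      fun h' => (neg_of_mul_pos_right h' h.le).le⟩
  · refine ⟨(b₀.reindex (finCongr e)).orientation, fun b => ?_⟩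
    rw [represents_iff_of_represents hr, key, mul_pos_iff_of_pos_left h]

/-- There are only two orientations, so one basis tells them apart. -/
theorem vectorOrientation_ext {o o' : VectorOrientation V} {b : Basis (Fin k) ℝ V}
    (h : Represents b o ↔ Represents b o') : o = o' := by
  by_cases hb : Represents b o
  · exact hb.symm.trans (h.1 hb)
  · have h1 := represents_neg_iff.2 hb
    have h2 := represents_neg_iff.2 (fun h' => hb (h.2 h'))
    exact neg_injective (h1.symm.trans h2)

/-- If `b` represents `o`, the sign of `det (Λ b)` determines the positive bases. -/
theorem represents_iff_detAlong {Λ : V →ₗ[ℝ] (Fin k → ℝ)} {o : VectorOrientation V}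
    {b b' : Basis (Fin k) ℝ V} (h : Represents b o) (h0 : detAlong Λ b ≠ 0) :
    Represents b' o ↔ 0 < detAlong Λ b * detAlong Λ b' := by
  rw [represents_iff_of_represents h, detAlong_basis Λ b b', ← mul_assoc,
    mul_pos_iff_of_pos_left (mul_self_pos.2 h0)]

end LinearOrientation

/-! ### Coordinates on tangent spaces -/

section Coordinates

variable {n : ℕ} {M : Type*} [TopologicalSpace M] [ChartedSpace (EuclideanSpace ℝ (Fin n)) M]

/-- The derivative at `q` of the preferred chart around `p`, which identifies `T_q M` with `ℝⁿ`
for all `q` near `p`. -/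
noncomputable def chartDeriv (n : ℕ) {M : Type*} [TopologicalSpace M]
    [ChartedSpace (EuclideanSpace ℝ (Fin n)) M] (p q : M) :
    TangentSpace (𝓡 n) q →L[ℝ] EuclideanSpace ℝ (Fin n) :=
  mfderiv (𝓡 n) 𝓘(ℝ, EuclideanSpace ℝ (Fin n)) (extChartAt (𝓡 n) p) q

variable [IsManifold (𝓡 n) ∞ M]

theorem chartDeriv_eq_trivialization {p q : M}
    (hq : q ∈ (chartAt (EuclideanSpace ℝ (Fin n)) p).source) (v : TangentSpace (𝓡 n) q) :
    (trivializationAt (EuclideanSpace ℝ (Fin n)) (TangentSpace (𝓡 n)) p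
      (⟨q, v⟩ : TangentBundle (𝓡 n) M)).2 = chartDeriv n p q v := by
  have h := TangentBundle.continuousLinearMapAt_trivializationAt (I := 𝓡 n) (𝕜 := ℝ) hq
  unfold chartDeriv
  rw [← h]
  rw [Bundle.Trivialization.continuousLinearMapAt_apply_of_mem]
  exact hq

theorem chartDeriv_bijective {p q : M}
    (hq : q ∈ (chartAt (EuclideanSpace ℝ (Fin n)) p).source) :
    Function.Bijective (chartDeriv n p q) := by
  obtain ⟨e, he⟩ := isInvertible_mfderiv_extChartAt (I := 𝓡 n) (x := p) (y := q)
    (by rwa [extChartAt_source])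
  unfold chartDeriv
  rw [← he]
  exact e.bijective

/-- The identification of `T_q M` with `ℝⁿ` by the chart around `p`. -/
noncomputable def chartEquiv {p q : M}
    (hq : q ∈ (chartAt (EuclideanSpace ℝ (Fin n)) p).source) :
    TangentSpace (𝓡 n) q ≃ₗ[ℝ] EuclideanSpace ℝ (Fin n) :=
  LinearEquiv.ofBijective (chartDeriv n p q).toLinearMap (chartDeriv_bijective hq)

@[simp]
theorem chartEquiv_apply {p q : M}
    (hq : q ∈ (chartAt (EuclideanSpace ℝ (Fin n)) p).source) (v : TangentSpace (𝓡 n) q) :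
    chartEquiv hq v = chartDeriv n p q v := rfl

/-- A section of the tangent bundle which is continuous at `p` is continuous at `p` in the
coordinates given by the chart around `p`. -/
theorem continuousAt_chartDeriv {T : Type*} [TopologicalSpace T] {π : T → M} {t₀ : T}
    {X : ∀ t, TangentSpace (𝓡 n) (π t)}
    (hX : ContinuousAt (fun t => (⟨π t, X t⟩ : TangentBundle (𝓡 n) M)) t₀) :
    ContinuousAt (fun t => chartDeriv n (π t₀) (π t) (X t)) t₀ := by
  obtain ⟨h1, h2⟩ := (FiberBundle.continuousAt_totalSpace _ _).1 hX
  refine h2.congr ?_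
  filter_upwards [h1.eventually (chart_source_mem_nhds (EuclideanSpace ℝ (Fin n)) (π t₀))]
    with t ht
  exact chartDeriv_eq_trivialization ht (X t)

/-- A section which has continuous coordinates in the chart around `p` is continuous. -/
theorem continuousOn_of_chartDeriv {T : Type*} [TopologicalSpace T] {π : T → M} {U : Set T}
    (hπ : ContinuousOn π U) {p : M}
    (hU : ∀ t ∈ U, π t ∈ (chartAt (EuclideanSpace ℝ (Fin n)) p).source)
    {X : ∀ t, TangentSpace (𝓡 n) (π t)}
    (hX : ContinuousOn (fun t => chartDeriv n p (π t) (X t)) U) :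
    ContinuousOn (fun t => (⟨π t, X t⟩ : TangentBundle (𝓡 n) M)) U := by
  let e := trivializationAt (EuclideanSpace ℝ (Fin n)) (TangentSpace (𝓡 n)) p
  have h := e.continuousOn_invFun.comp (hπ.prodMk hX) (fun t ht => by
    rw [e.target_eq]; exact ⟨hU t ht, mem_univ _⟩)
  refine h.congr fun t ht => ?_
  have hs : (⟨π t, X t⟩ : TangentBundle (𝓡 n) M) ∈ e.source := by
    rw [e.mem_source]; exact hU t ht
  have h1 : e (⟨π t, X t⟩ : TangentBundle (𝓡 n) M) = (π t, chartDeriv n p (π t) (X t)) :=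
    Prod.ext (e.coe_fst hs) (chartDeriv_eq_trivialization (hU t ht) (X t))
  change _ = e.toOpenPartialHomeomorph.symm (π t, chartDeriv n p (π t) (X t))
  rw [← h1]
  exact (e.toOpenPartialHomeomorph.left_inv hs).symm

end Coordinates

/-! ### Orientations and coorientations given by signs of determinants -/

section SignForms

variable {n : ℕ} {M : Type*} [TopologicalSpace M] [ChartedSpace (EuclideanSpace ℝ (Fin n)) M]

/-- The linear map `T_q M → ℝᵏ` which is `A q` in the coordinates of the chart around `p`. -/
noncomputable def formAt (n : ℕ) {M : Type*} [TopologicalSpace M]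
    [ChartedSpace (EuclideanSpace ℝ (Fin n)) M] {k : ℕ} (p : M)
    (A : M → EuclideanSpace ℝ (Fin n) →L[ℝ] (Fin k → ℝ)) (q : M) :
    TangentSpace (𝓡 n) q →ₗ[ℝ] (Fin k → ℝ) :=
  (A q).toLinearMap ∘ₗ (chartDeriv n p q).toLinearMap

theorem formAt_apply {k : ℕ} (p : M) (A : M → EuclideanSpace ℝ (Fin n) →L[ℝ] (Fin k → ℝ)) (q : M)
    (v : TangentSpace (𝓡 n) q) : formAt n p A q v = A q (chartDeriv n p q v) := rfl

theorem isTangentBasis_iff {S : Set M} {p : M} {k : ℕ} {v : Fin k → TangentSpace (𝓡 n) p}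
    {P : Basis (Fin k) ℝ (tangentOf n S p) → Prop} {b : Basis (Fin k) ℝ (tangentOf n S p)}
    (hb : ∀ i, (b i : TangentSpace (𝓡 n) p) = v i) : IsTangentBasis S p v P ↔ P b := by
  constructor
  · rintro ⟨b', hb', hP⟩
    have : b' = b := Basis.eq_of_apply_eq fun i => Subtype.ext ((hb' i).trans (hb i).symm)
    exact this ▸ hP
  · exact fun hP => ⟨b, hb, hP⟩

theorem isNormalBasis_iff {S : Set M} {p : M} {k : ℕ} {v : Fin k → TangentSpace (𝓡 n) p}
    {P : Basis (Fin k) ℝ (NormalSpace n S p) → Prop} {b : Basis (Fin k) ℝ (NormalSpace n S p)}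
    (hb : ∀ i, b i = (tangentOf n S p).mkQ (v i)) : IsNormalBasis S p v P ↔ P b := by
  constructor
  · rintro ⟨b', hb', hP⟩
    have : b' = b := Basis.eq_of_apply_eq fun i => (hb' i).trans (hb i).symm
    exact this ▸ hP
  · exact fun hP => ⟨b, hb, hP⟩

theorem IsTangentBasis.imp {S : Set M} {p : M} {k : ℕ} {v : Fin k → TangentSpace (𝓡 n) p}
    {P Q : Basis (Fin k) ℝ (tangentOf n S p) → Prop} (h : IsTangentBasis S p v P)
    (hPQ : ∀ b, P b → Q b) : IsTangentBasis S p v Q :=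
  let ⟨b, hb, hP⟩ := h; ⟨b, hb, hPQ b hP⟩

theorem IsNormalBasis.imp {S : Set M} {p : M} {k : ℕ} {v : Fin k → TangentSpace (𝓡 n) p}
    {P Q : Basis (Fin k) ℝ (NormalSpace n S p) → Prop} (h : IsNormalBasis S p v P)
    (hPQ : ∀ b, P b → Q b) : IsNormalBasis S p v Q :=
  let ⟨b, hb, hP⟩ := h; ⟨b, hb, hPQ b hP⟩

theorem pos_mul_iff_of_mul_pos {a b x : ℝ} (h : 0 < a * b) : 0 < b * x ↔ 0 < a * x := by
  rcases mul_pos_iff.1 h with ⟨ha, hb⟩ | ⟨ha, hb⟩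
  · rw [mul_pos_iff_of_pos_left ha, mul_pos_iff_of_pos_left hb]
  · rw [← neg_mul_neg b, ← neg_mul_neg a, mul_pos_iff_of_pos_left (neg_pos.2 ha),
      mul_pos_iff_of_pos_left (neg_pos.2 hb)]

/-- The determinant of a continuous family of linear forms along continuous vector fields is
continuous; this turns continuous frames into locally constant signs. -/
theorem continuousAt_det_form {T : Type*} [TopologicalSpace T] {π : T → M} {t₀ : T} {k : ℕ}
    (hπ : ContinuousAt π t₀) {A : M → EuclideanSpace ℝ (Fin n) →L[ℝ] (Fin k → ℝ)}
    (hA : ContinuousAt A (π t₀)) {X : Fin k → ∀ t, TangentSpace (𝓡 n) (π t)} {p : M}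
    (hX : ∀ i, ContinuousAt (fun t => chartDeriv n p (π t) (X i t)) t₀) :
    ContinuousAt (fun t => detAlong (formAt n p A (π t)) fun i => X i t) t₀ := by
  have hdet : Continuous fun m : Matrix (Fin k) (Fin k) ℝ => m.det := continuous_id.matrix_det
  refine hdet.continuousAt.comp (continuousAt_pi.2 fun i => ?_)
  exact (hA.comp_of_eq hπ rfl).clm_apply (hX i)

theorem detAlong_subtype {S : Set M} {p : M} {k : ℕ}
    (Λ : TangentSpace (𝓡 n) p →ₗ[ℝ] (Fin k → ℝ)) {v : Fin k → TangentSpace (𝓡 n) p}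
    {b : Basis (Fin k) ℝ (tangentOf n S p)} (hb : ∀ i, (b i : TangentSpace (𝓡 n) p) = v i) :
    detAlong (Λ ∘ₗ (tangentOf n S p).subtype) b = detAlong Λ v := by
  simp only [detAlong_apply, LinearMap.comp_apply, Submodule.subtype_apply, hb]

theorem detAlong_liftQ {S : Set M} {p : M} {k : ℕ}
    (Λ : TangentSpace (𝓡 n) p →ₗ[ℝ] (Fin k → ℝ)) (hΛ : tangentOf n S p ≤ LinearMap.ker Λ)
    {v : Fin k → TangentSpace (𝓡 n) p}
    {b : Basis (Fin k) ℝ (NormalSpace n S p)} (hb : ∀ i, b i = (tangentOf n S p).mkQ (v i)) :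
    detAlong ((tangentOf n S p).liftQ Λ hΛ) b = detAlong Λ v := by
  simp only [detAlong_apply, hb, Submodule.mkQ_apply, Submodule.liftQ_apply]

theorem finrank_tangentSpace (p : M) : finrank ℝ (TangentSpace (𝓡 n) p) = n :=
  (show finrank ℝ (EuclideanSpace ℝ (Fin n)) = n by simp)

instance (p : M) : FiniteDimensional ℝ (TangentSpace (𝓡 n) p) :=
  inferInstanceAs (FiniteDimensional ℝ (EuclideanSpace ℝ (Fin n)))

variable [IsManifold (𝓡 n) ∞ M]

theorem TangentOrientation.pos_of_basis {S : Set M} (o : TangentOrientation (n := n) S) (p : S)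
    {k : ℕ} {v : Fin k → TangentSpace (𝓡 n) (p : M)} {b : Basis (Fin k) ℝ (tangentOf n S (p : M))}
    (hb : ∀ i, (b i : TangentSpace (𝓡 n) (p : M)) = v i) :
    o.Pos p v ↔ Represents b (o.fibre p) := isTangentBasis_iff hb

theorem NormalOrientation.pos_of_basis {S : Set M} (o : NormalOrientation (n := n) S) (p : S)
    {k : ℕ} {v : Fin k → TangentSpace (𝓡 n) (p : M)} {b : Basis (Fin k) ℝ (NormalSpace n S (p : M))}
    (hb : ∀ i, b i = (tangentOf n S (p : M)).mkQ (v i)) :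
    o.Pos p v ↔ Represents b (o.fibre p) := isNormalBasis_iff hb

/-- Near `p`, an orientation of `S` is given by the sign of `det (A (v₁), …, A (v_k))`, up to a
global sign, for any continuous family `A` of linear maps which is injective on `T_p S`. -/
theorem TangentOrientation.exists_sign {S : Set M} (o : TangentOrientation (n := n) S) (p : S)
    {k : ℕ} {A : M → EuclideanSpace ℝ (Fin n) →L[ℝ] (Fin k → ℝ)} (hA : ContinuousAt A p)
    (hinj : ∀ v ∈ tangentOf n S (p : M), formAt n (p : M) A p v = 0 → v = 0) :
    ∃ s : ℝ, s ≠ 0 ∧ ∀ᶠ q : S in 𝓝 p, ∀ v : Fin k → TangentSpace (𝓡 n) (q : M),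
      IsTangentBasis S (q : M) v →
        (o.Pos q v ↔ 0 < s * detAlong (formAt n (p : M) A q) v) := by
  obtain ⟨U, hU, k', X, hX, hpos⟩ := o.locally_constant p
  have hpU : p ∈ U := mem_of_mem_nhds hU
  have hbasis : ∀ q ∈ U, IsTangentBasis S (q : M) fun i => X i q := by
    intro q hq
    rcases hpos with h | h
    · exact (h q hq).imp fun _ _ => trivial
    · exact (h q hq).imp fun _ _ => trivial
  -- if the frame has the wrong number of vectors, no tangent basis has `k` elements
  by_cases hk : k' = k
  swap
  · refine ⟨1, one_ne_zero, ?_⟩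
    filter_upwards [hU] with q hq v hv
    obtain ⟨b, -⟩ := hbasis q hq
    obtain ⟨b', -⟩ := hv
    exact absurd (by simpa using (finrank_eq_card_basis b).symm.trans (finrank_eq_card_basis b')) hk
  subst hk
  set d : S → ℝ := fun q => detAlong (formAt n (p : M) A q) fun i => X i q with hd
  have hdc : ContinuousAt d p := continuousAt_det_form continuous_subtype_val.continuousAt hA
    fun i => continuousAt_chartDeriv ((hX i).continuousAt hU)
  have hd0 : d p ≠ 0 := by
    obtain ⟨b, hb, -⟩ := hbasis p hpU
    rw [hd]
    dsimp only
    rw [← detAlong_subtype _ hb]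
    exact detAlong_ne_zero (fun v hv => Subtype.ext (hinj v v.2 hv)) b
  have hev : ∀ᶠ q : S in 𝓝 p, 0 < d p * d q := by
    have : ContinuousAt (fun q => d p * d q) p := continuousAt_const.mul hdc
    exact this.eventually (lt_mem_nhds (mul_self_pos.2 hd0))
  -- the sign of the determinant on the frame `X`, compared with a basis `v`
  have key : ∀ q : S, 0 < d p * d q → ∀ (o' : VectorOrientation (tangentOf n S (q : M)))
      (v : Fin k' → TangentSpace (𝓡 n) (q : M)) (b' : Basis (Fin k') ℝ (tangentOf n S (q : M))),
      (∀ i, (b' i : TangentSpace (𝓡 n) (q : M)) = v i) →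
      IsTangentBasis S (q : M) (fun i => X i q) (fun b => Represents b o') →
      (Represents b' o' ↔ 0 < d p * detAlong (formAt n (p : M) A q) v) := by
    intro q hq o' v b' hb' hXo
    obtain ⟨b, hb, hbo⟩ := hXo
    have h1 := detAlong_subtype (formAt n (p : M) A q) hb
    have h2 := detAlong_subtype (formAt n (p : M) A q) hb'
    have hdq : d q ≠ 0 := fun h => by simp [h] at hq
    rw [represents_iff_detAlong (Λ := formAt n (p : M) A q ∘ₗ (tangentOf n S (q : M)).subtype) hbo
      (by rw [h1]; exact hdq), h1, h2]
    change 0 < d q * _ ↔ _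
    exact pos_mul_iff_of_mul_pos hq
  rcases hpos with hpos | hpos
  · refine ⟨d p, hd0, ?_⟩
    filter_upwards [hU, hev] with q hqU hq v hv
    obtain ⟨b', hb', -⟩ := hv
    rw [o.pos_of_basis q hb']
    exact key q hq _ v b' hb' (hpos q hqU)
  · refine ⟨-d p, neg_ne_zero.2 hd0, ?_⟩
    filter_upwards [hU, hev] with q hqU hq v hv
    obtain ⟨b', hb', -⟩ := hv
    rw [o.pos_of_basis q hb']
    have h1 := key q hq _ v b' hb' (hpos q hqU)
    rw [represents_neg_iff] at h1
    have h2 : detAlong (formAt n (p : M) A q) v ≠ 0 := by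
      obtain ⟨b, hb, -⟩ := hpos q hqU
      rw [← detAlong_subtype _ hb', detAlong_basis _ b b', detAlong_subtype _ hb]
      exact mul_ne_zero (fun h => by simp [hd, h] at hq) (b.isUnit_det b').ne_zero
    rw [← not_iff_not, h1, neg_mul, neg_pos, not_lt]
    exact ⟨le_of_lt, fun h => lt_of_le_of_ne h (mul_ne_zero hd0 h2).symm⟩

/-- Near `p`, a coorientation of `S` is given by the sign of `det (A (v₁), …, A (v_k))`, up to a
global sign, for any continuous family `A` of linear maps which vanishes exactly on the tangent
spaces of `S`. -/
theorem NormalOrientation.exists_sign {S : Set M} (o : NormalOrientation (n := n) S) (p : S)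
    {k : ℕ} {A : M → EuclideanSpace ℝ (Fin n) →L[ℝ] (Fin k → ℝ)} (hA : ContinuousAt A p)
    (hker : ∀ᶠ q : S in 𝓝 p, tangentOf n S (q : M) = LinearMap.ker (formAt n (p : M) A q)) :
    ∃ s : ℝ, s ≠ 0 ∧ ∀ᶠ q : S in 𝓝 p, ∀ v : Fin k → TangentSpace (𝓡 n) (q : M),
      IsNormalBasis S (q : M) v →
        (o.Pos q v ↔ 0 < s * detAlong (formAt n (p : M) A q) v) := by
  obtain ⟨U, hU, k', X, hX, hpos⟩ := o.locally_constant p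
  have hpU : p ∈ U := mem_of_mem_nhds hU
  have hbasis : ∀ q ∈ U, IsNormalBasis S (q : M) fun i => X i q := by
    intro q hq
    rcases hpos with h | h
    · exact (h q hq).imp fun _ _ => trivial
    · exact (h q hq).imp fun _ _ => trivial
  -- if the frame has the wrong number of vectors, no normal basis has `k` elements
  by_cases hk : k' = k
  swap
  · refine ⟨1, one_ne_zero, ?_⟩
    filter_upwards [hU] with q hq v hv
    obtain ⟨b, -⟩ := hbasis q hq
    obtain ⟨b', -⟩ := hv
    exact absurd (by simpa using (finrank_eq_card_basis b).symm.trans (finrank_eq_card_basis b')) hk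
  subst hk
  set d : S → ℝ := fun q => detAlong (formAt n (p : M) A q) fun i => X i q with hd
  have hdc : ContinuousAt d p := continuousAt_det_form continuous_subtype_val.continuousAt hA
    fun i => continuousAt_chartDeriv ((hX i).continuousAt hU)
  have hne : ∀ q : S, tangentOf n S (q : M) = LinearMap.ker (formAt n (p : M) A q) →
      ∀ v : Fin k' → TangentSpace (𝓡 n) (q : M), IsNormalBasis S (q : M) v →
      detAlong (formAt n (p : M) A q) v ≠ 0 := by
    rintro q hq v ⟨b, hb, -⟩
    rw [← detAlong_liftQ _ hq.le hb]
    refine detAlong_ne_zero (fun v hv => ?_) b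
    have : LinearMap.ker ((tangentOf n S (q : M)).liftQ (formAt n (p : M) A q) hq.le) = ⊥ := by
      rw [Submodule.ker_liftQ, ← hq, Submodule.mkQ_map_self]
    exact LinearMap.ker_eq_bot'.1 this v hv
  have hd0 : d p ≠ 0 := hne p hker.self_of_nhds _ (hbasis p hpU)
  have hev : ∀ᶠ q : S in 𝓝 p, 0 < d p * d q := by
    have : ContinuousAt (fun q => d p * d q) p := continuousAt_const.mul hdc
    exact this.eventually (lt_mem_nhds (mul_self_pos.2 hd0))
  -- the sign of the determinant on the frame `X`, compared with a basis `v`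
  have key : ∀ q : S, tangentOf n S (q : M) = LinearMap.ker (formAt n (p : M) A q) →
      0 < d p * d q → ∀ (o' : VectorOrientation (NormalSpace n S (q : M)))
      (v : Fin k' → TangentSpace (𝓡 n) (q : M)) (b' : Basis (Fin k') ℝ (NormalSpace n S (q : M))),
      (∀ i, b' i = (tangentOf n S (q : M)).mkQ (v i)) →
      IsNormalBasis S (q : M) (fun i => X i q) (fun b => Represents b o') →
      (Represents b' o' ↔ 0 < d p * detAlong (formAt n (p : M) A q) v) := by
    intro q hqk hq o' v b' hb' hXo
    obtain ⟨b, hb, hbo⟩ := hXo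
    have h1 := detAlong_liftQ (formAt n (p : M) A q) hqk.le hb
    have h2 := detAlong_liftQ (formAt n (p : M) A q) hqk.le hb'
    have hdq : d q ≠ 0 := fun h => by simp [h] at hq
    rw [represents_iff_detAlong
      (Λ := (tangentOf n S (q : M)).liftQ (formAt n (p : M) A q) hqk.le) hbo
      (by rw [h1]; exact hdq), h1, h2]
    change 0 < d q * _ ↔ _
    exact pos_mul_iff_of_mul_pos hq
  rcases hpos with hpos | hpos
  · refine ⟨d p, hd0, ?_⟩
    filter_upwards [hU, hev, hker] with q hqU hq hqk v hv
    obtain ⟨b', hb', -⟩ := hv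
    rw [o.pos_of_basis q hb']
    exact key q hqk hq _ v b' hb' (hpos q hqU)
  · refine ⟨-d p, neg_ne_zero.2 hd0, ?_⟩
    filter_upwards [hU, hev, hker] with q hqU hq hqk v hv
    have h2 := hne q hqk v hv
    obtain ⟨b', hb', -⟩ := hv
    rw [o.pos_of_basis q hb']
    have h1 := key q hqk hq _ v b' hb' (hpos q hqU)
    rw [represents_neg_iff] at h1
    rw [← not_iff_not, h1, neg_mul, neg_pos, not_lt]
    exact ⟨le_of_lt, fun h => lt_of_le_of_ne h (mul_ne_zero hd0 h2).symm⟩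

/-- Local continuous frames of the tangent spaces of `S`. -/
def HasTangentFrames (n : ℕ) {M : Type*} [TopologicalSpace M]
    [ChartedSpace (EuclideanSpace ℝ (Fin n)) M] [IsManifold (𝓡 n) ∞ M] (S : Set M) (k : ℕ) : Prop :=
  ∀ p : S, ∃ U ∈ 𝓝 p, ∃ X : Fin k → ∀ q : S, TangentSpace (𝓡 n) (q : M),
    (∀ i, ContinuousOn (fun q : S => (⟨(q : M), X i q⟩ : TangentBundle (𝓡 n) M)) U) ∧
    ∀ q ∈ U, IsTangentBasis S (q : M) fun i => X i q

/-- Local continuous frames of the normal spaces of `S`. -/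
def HasNormalFrames (n : ℕ) {M : Type*} [TopologicalSpace M]
    [ChartedSpace (EuclideanSpace ℝ (Fin n)) M] [IsManifold (𝓡 n) ∞ M] (S : Set M) (k : ℕ) : Prop :=
  ∀ p : S, ∃ U ∈ 𝓝 p, ∃ X : Fin k → ∀ q : S, TangentSpace (𝓡 n) (q : M),
    (∀ i, ContinuousOn (fun q : S => (⟨(q : M), X i q⟩ : TangentBundle (𝓡 n) M)) U) ∧
    ∀ q ∈ U, IsNormalBasis S (q : M) fun i => X i q

/-- A family of notions of positive bases of the tangent spaces of `S` which is locally given by the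
sign of a determinant comes from a unique orientation of `S`. -/
theorem existsUnique_tangentOrientation {S : Set M} {k : ℕ} (hS : HasTangentFrames n S k)
    (Q : ∀ q : S, (Fin k → TangentSpace (𝓡 n) (q : M)) → Prop)
    (hQ : ∀ p : S, ∃ (A : M → EuclideanSpace ℝ (Fin n) →L[ℝ] (Fin k → ℝ)) (s : ℝ),
      ContinuousAt A p ∧ s ≠ 0 ∧
      (∀ v ∈ tangentOf n S (p : M), formAt n (p : M) A p v = 0 → v = 0) ∧
      ∀ᶠ q : S in 𝓝 p, ∀ v : Fin k → TangentSpace (𝓡 n) (q : M), IsTangentBasis S (q : M) v →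
        (Q q v ↔ 0 < s * detAlong (formAt n (p : M) A q) v)) :
    ∃! o : TangentOrientation (n := n) S, ∀ (q : S) (v : Fin k → TangentSpace (𝓡 n) (q : M)),
      IsTangentBasis S (q : M) v → (o.Pos q v ↔ Q q v) := by
  have hbasis : ∀ p : S, Nonempty (Basis (Fin k) ℝ (tangentOf n S (p : M))) := fun p => by
    obtain ⟨U, hU, X, -, hb⟩ := hS p
    exact ⟨(hb p (mem_of_mem_nhds hU)).choose⟩
  have hfib : ∀ p : S, ∃ o : VectorOrientation (tangentOf n S (p : M)),
      ∀ (v : Fin k → TangentSpace (𝓡 n) (p : M)) (b : Basis (Fin k) ℝ (tangentOf n S (p : M))),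
        (∀ i, (b i : TangentSpace (𝓡 n) (p : M)) = v i) → (Represents b o ↔ Q p v) := by
    intro p
    obtain ⟨A, s, -, hs, hinj, hev⟩ := hQ p
    obtain ⟨o, ho⟩ := exists_vectorOrientation
      (Λ := formAt n (p : M) A p ∘ₗ (tangentOf n S (p : M)).subtype)
      (fun v hv => Subtype.ext (hinj v v.2 hv)) hs (hbasis p)
    refine ⟨o, fun v b hb => ?_⟩
    rw [ho, detAlong_subtype _ hb]
    exact (hev.self_of_nhds v ⟨b, hb, trivial⟩).symm
  choose o ho using hfib
  refine ⟨⟨o, fun p => ?_⟩, ?_, ?_⟩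
  · obtain ⟨A, s, hA, hs, hinj, hev⟩ := hQ p
    obtain ⟨U, hU, X, hX, hb⟩ := hS p
    set d : S → ℝ := fun q => detAlong (formAt n (p : M) A q) fun i => X i q with hd
    have hdc : ContinuousAt d p := continuousAt_det_form continuous_subtype_val.continuousAt hA
      fun i => continuousAt_chartDeriv ((hX i).continuousAt hU)
    have hd0 : d p ≠ 0 := by
      obtain ⟨b, hb, -⟩ := hb p (mem_of_mem_nhds hU)
      rw [hd]
      dsimp only
      rw [← detAlong_subtype _ hb]
      exact detAlong_ne_zero (fun v hv => Subtype.ext (hinj v v.2 hv)) b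
    have hsc : ContinuousAt (fun q => s * d q) p := continuousAt_const.mul hdc
    rcases lt_or_gt_of_ne (mul_ne_zero hs hd0) with h | h
    · obtain ⟨U', hU', H⟩ := ((hsc.eventually (gt_mem_nhds h)).and (hev.and hU)).exists_mem
      refine ⟨U', hU', k, X, fun i => (hX i).mono fun q hq => (H q hq).2.2, Or.inr ?_⟩
      intro q hq
      obtain ⟨h1, h2, h3⟩ := H q hq
      obtain ⟨b, hb', -⟩ := hb q h3
      refine ⟨b, hb', ?_⟩
      beta_reduce
      rw [represents_neg_iff, ho q _ b hb', h2 _ ⟨b, hb', trivial⟩]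
      exact not_lt.2 h1.le
    · obtain ⟨U', hU', H⟩ := ((hsc.eventually (lt_mem_nhds h)).and (hev.and hU)).exists_mem
      refine ⟨U', hU', k, X, fun i => (hX i).mono fun q hq => (H q hq).2.2, Or.inl ?_⟩
      intro q hq
      obtain ⟨h1, h2, h3⟩ := H q hq
      obtain ⟨b, hb', -⟩ := hb q h3
      refine ⟨b, hb', ?_⟩
      beta_reduce
      rw [ho q _ b hb', h2 _ ⟨b, hb', trivial⟩]
      exact h1
  · rintro q v ⟨b, hb, -⟩
    rw [TangentOrientation.pos_of_basis _ q hb]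
    exact ho q v b hb
  · rintro ⟨o', h'⟩ H
    have : o' = o := by
      funext p
      obtain ⟨b⟩ := hbasis p
      refine vectorOrientation_ext (b := b) ?_
      rw [ho p _ b fun i => rfl, ← H p _ ⟨b, fun i => rfl, trivial⟩]
      exact (TangentOrientation.pos_of_basis ⟨o', h'⟩ p fun i => rfl).symm
    subst this
    rfl

/-- A family of notions of positive bases of the normal spaces of `S` which is locally given by the
sign of a determinant comes from a coorientation of `S`. -/
theorem exists_normalOrientation {S : Set M} {k : ℕ} (hS : HasNormalFrames n S k)
    (Q : ∀ q : S, (Fin k → TangentSpace (𝓡 n) (q : M)) → Prop)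
    (hQ : ∀ p : S, ∃ (A : M → EuclideanSpace ℝ (Fin n) →L[ℝ] (Fin k → ℝ)) (s : ℝ),
      ContinuousAt A p ∧ s ≠ 0 ∧
      tangentOf n S (p : M) = LinearMap.ker (formAt n (p : M) A p) ∧
      ∀ᶠ q : S in 𝓝 p, ∀ v : Fin k → TangentSpace (𝓡 n) (q : M), IsNormalBasis S (q : M) v →
        (Q q v ↔ 0 < s * detAlong (formAt n (p : M) A q) v)) :
    ∃ o : NormalOrientation (n := n) S, ∀ (q : S) (v : Fin k → TangentSpace (𝓡 n) (q : M)),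
      IsNormalBasis S (q : M) v → (o.Pos q v ↔ Q q v) := by
  have hbasis : ∀ p : S, Nonempty (Basis (Fin k) ℝ (NormalSpace n S (p : M))) := fun p => by
    obtain ⟨U, hU, X, -, hb⟩ := hS p
    exact ⟨(hb p (mem_of_mem_nhds hU)).choose⟩
  have hinj : ∀ (p : M) (Λ : TangentSpace (𝓡 n) p →ₗ[ℝ] (Fin k → ℝ))
      (h : tangentOf n S p = LinearMap.ker Λ) (v : NormalSpace n S p),
      (tangentOf n S p).liftQ Λ h.le v = 0 → v = 0 := by
    intro p Λ h v hv
    have : LinearMap.ker ((tangentOf n S p).liftQ Λ h.le) = ⊥ := by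
      rw [Submodule.ker_liftQ, ← h, Submodule.mkQ_map_self]
    exact LinearMap.ker_eq_bot'.1 this v hv
  have hfib : ∀ p : S, ∃ o : VectorOrientation (NormalSpace n S (p : M)),
      ∀ (v : Fin k → TangentSpace (𝓡 n) (p : M)) (b : Basis (Fin k) ℝ (NormalSpace n S (p : M))),
        (∀ i, b i = (tangentOf n S (p : M)).mkQ (v i)) → (Represents b o ↔ Q p v) := by
    intro p
    obtain ⟨A, s, -, hs, hker, hev⟩ := hQ p
    obtain ⟨o, ho⟩ := exists_vectorOrientation
      (Λ := (tangentOf n S (p : M)).liftQ (formAt n (p : M) A p) hker.le)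
      (hinj p _ hker) hs (hbasis p)
    refine ⟨o, fun v b hb => ?_⟩
    rw [ho, detAlong_liftQ _ hker.le hb]
    exact (hev.self_of_nhds v ⟨b, hb, trivial⟩).symm
  choose o ho using hfib
  refine ⟨⟨o, fun p => ?_⟩, ?_⟩
  · obtain ⟨A, s, hA, hs, hker, hev⟩ := hQ p
    obtain ⟨U, hU, X, hX, hb⟩ := hS p
    set d : S → ℝ := fun q => detAlong (formAt n (p : M) A q) fun i => X i q with hd
    have hdc : ContinuousAt d p := continuousAt_det_form continuous_subtype_val.continuousAt hA
      fun i => continuousAt_chartDeriv ((hX i).continuousAt hU)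
    have hd0 : d p ≠ 0 := by
      obtain ⟨b, hb, -⟩ := hb p (mem_of_mem_nhds hU)
      rw [hd]
      dsimp only
      rw [← detAlong_liftQ _ hker.le hb]
      exact detAlong_ne_zero (hinj p _ hker) b
    have hsc : ContinuousAt (fun q => s * d q) p := continuousAt_const.mul hdc
    rcases lt_or_gt_of_ne (mul_ne_zero hs hd0) with h | h
    · obtain ⟨U', hU', H⟩ := ((hsc.eventually (gt_mem_nhds h)).and (hev.and hU)).exists_mem
      refine ⟨U', hU', k, X, fun i => (hX i).mono fun q hq => (H q hq).2.2, Or.inr ?_⟩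
      intro q hq
      obtain ⟨h1, h2, h3⟩ := H q hq
      obtain ⟨b, hb', -⟩ := hb q h3
      refine ⟨b, hb', ?_⟩
      beta_reduce
      rw [represents_neg_iff, ho q _ b hb', h2 _ ⟨b, hb', trivial⟩]
      exact not_lt.2 h1.le
    · obtain ⟨U', hU', H⟩ := ((hsc.eventually (lt_mem_nhds h)).and (hev.and hU)).exists_mem
      refine ⟨U', hU', k, X, fun i => (hX i).mono fun q hq => (H q hq).2.2, Or.inl ?_⟩
      intro q hq
      obtain ⟨h1, h2, h3⟩ := H q hq
      obtain ⟨b, hb', -⟩ := hb q h3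
      refine ⟨b, hb', ?_⟩
      beta_reduce
      rw [ho q _ b hb', h2 _ ⟨b, hb', trivial⟩]
      exact h1
  · rintro q v ⟨b, hb, -⟩
    rw [NormalOrientation.pos_of_basis _ q hb]
    exact ho q v b hb

end SignForms

/-! ### Submanifolds given by local equations -/

section LocalEquations

variable {n m : ℕ} {M : Type*} [TopologicalSpace M] [ChartedSpace (EuclideanSpace ℝ (Fin n)) M]

/-- The map `F : M → ℝᵐ` is smooth near `p` and submersive at `p`, and `S = {F = 0}`
near `p`. -/
structure LocalEquation (n : ℕ) {m : ℕ} {M : Type*} [TopologicalSpace M]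
    [ChartedSpace (EuclideanSpace ℝ (Fin n)) M] (S : Set M) (p : M) (F : M → Fin m → ℝ) :
    Prop where
  smooth : ∀ᶠ q in 𝓝 p, ContMDiffAt (𝓡 n) 𝓘(ℝ, Fin m → ℝ) ∞ F q
  surjective : Function.Surjective (mfderiv (𝓡 n) 𝓘(ℝ, Fin m → ℝ) F p)
  mem_iff : ∀ᶠ q in 𝓝 p, q ∈ S ↔ F q = 0

/-- The derivative of `F` in the coordinates of the chart around `p`. -/
noncomputable def chartFDeriv (n : ℕ) {M : Type*} [TopologicalSpace M]
    [ChartedSpace (EuclideanSpace ℝ (Fin n)) M] {W : Type*} [NormedAddCommGroup W]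
    [NormedSpace ℝ W] (p : M) (F : M → W) (q : M) : EuclideanSpace ℝ (Fin n) →L[ℝ] W :=
  fderiv ℝ (F ∘ (extChartAt (𝓡 n) p).symm) (extChartAt (𝓡 n) p q)

variable [IsManifold (𝓡 n) ∞ M] {W : Type*} [NormedAddCommGroup W] [NormedSpace ℝ W]

/-- Smoothness of a function on the manifold, read in the chart around `p`. -/
theorem contDiffAt_chart {p q : M} (hq : q ∈ (extChartAt (𝓡 n) p).source) {F : M → W}
    (hF : ContMDiffAt (𝓡 n) 𝓘(ℝ, W) ∞ F q) :
    ContDiffAt ℝ ∞ (F ∘ (extChartAt (𝓡 n) p).symm) (extChartAt (𝓡 n) p q) := by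
  rw [← contMDiffAt_iff_contDiffAt]
  have h1 : ContMDiffAt 𝓘(ℝ, EuclideanSpace ℝ (Fin n)) (𝓡 n) ∞ (extChartAt (𝓡 n) p).symm
      (extChartAt (𝓡 n) p q) :=
    (contMDiffOn_extChartAt_symm p).contMDiffAt
      ((isOpen_extChartAt_target p).mem_nhds ((extChartAt (𝓡 n) p).map_source hq))
  refine ContMDiffAt.comp_of_eq (hg := hF) h1 ((extChartAt (𝓡 n) p).left_inv hq)

theorem eventually_contDiffAt_chart {p : M} {F : M → W}
    (hF : ∀ᶠ q in 𝓝 p, ContMDiffAt (𝓡 n) 𝓘(ℝ, W) ∞ F q) :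
    ∀ᶠ z in 𝓝 (extChartAt (𝓡 n) p p), ContDiffAt ℝ ∞ (F ∘ (extChartAt (𝓡 n) p).symm) z := by
  have h1 : Tendsto (extChartAt (𝓡 n) p).symm (𝓝 (extChartAt (𝓡 n) p p)) (𝓝 p) := by
    have := continuousAt_extChartAt_symm (I := 𝓡 n) p
    rwa [ContinuousAt, (extChartAt (𝓡 n) p).left_inv (mem_extChartAt_source p)] at this
  filter_upwards [h1.eventually hF, extChartAt_target_mem_nhds (I := 𝓡 n) p] with z hz hzt
  have := contDiffAt_chart ((extChartAt (𝓡 n) p).map_target hzt) hz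
  rwa [(extChartAt (𝓡 n) p).right_inv hzt] at this

/-- The derivative of `F` factors through the coordinates of the chart around `p`. -/
theorem mfderiv_eq_chartFDeriv {p q : M} (hq : q ∈ (extChartAt (𝓡 n) p).source) {F : M → W}
    (hF : ContMDiffAt (𝓡 n) 𝓘(ℝ, W) ∞ F q) (v : TangentSpace (𝓡 n) q) :
    mfderiv (𝓡 n) 𝓘(ℝ, W) F q v = chartFDeriv n p F q (chartDeriv n p q v) := by
  have h1 : HasMFDerivAt (𝓡 n) 𝓘(ℝ, EuclideanSpace ℝ (Fin n)) (extChartAt (𝓡 n) p) q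
      (chartDeriv n p q) :=
    (mdifferentiableAt_extChartAt (by rwa [extChartAt_source] at hq)).hasMFDerivAt
  have h2 : HasFDerivAt (F ∘ (extChartAt (𝓡 n) p).symm) (chartFDeriv n p F q)
      (extChartAt (𝓡 n) p q) :=
    ((contDiffAt_chart hq hF).differentiableAt (by simp)).hasFDerivAt
  have h3 := HasMFDerivAt.comp q h2.hasMFDerivAt h1
  have h4 : F =ᶠ[𝓝 q] (F ∘ (extChartAt (𝓡 n) p).symm) ∘ extChartAt (𝓡 n) p := by
    filter_upwards [(isOpen_extChartAt_source (I := 𝓡 n) p).mem_nhds hq] with z hz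
    exact (congrArg F ((extChartAt (𝓡 n) p).left_inv hz)).symm
  rw [(h3.congr_of_eventuallyEq h4).mfderiv]
  rfl

theorem continuousAt_chartFDeriv {p : M} {F : M → W}
    (hF : ∀ᶠ q in 𝓝 p, ContMDiffAt (𝓡 n) 𝓘(ℝ, W) ∞ F q) :
    ContinuousAt (chartFDeriv n p F) p := by
  have h1 := (eventually_contDiffAt_chart hF).self_of_nhds
  have h2 : ContinuousAt (fderiv ℝ (F ∘ (extChartAt (𝓡 n) p).symm)) (extChartAt (𝓡 n) p p) :=
    (h1.fderiv_right (m := 0) (by simp)).continuousAt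
  exact ContinuousAt.comp (f := extChartAt (𝓡 n) p) h2 (continuousAt_extChartAt p)

theorem eventually_mfderiv_eq_formAt {p : M} {F : M → Fin m → ℝ}
    (hF : ∀ᶠ q in 𝓝 p, ContMDiffAt (𝓡 n) 𝓘(ℝ, Fin m → ℝ) ∞ F q) :
    ∀ᶠ q in 𝓝 p, ∀ v : TangentSpace (𝓡 n) q,
      mfderiv (𝓡 n) 𝓘(ℝ, Fin m → ℝ) F q v = formAt n p (chartFDeriv n p F) q v := by
  filter_upwards [hF, extChartAt_source_mem_nhds (I := 𝓡 n) p] with q hq hqs v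
  exact mfderiv_eq_chartFDeriv hqs hq v

/-- If `A p` is onto and `A` is continuous at `p`, there are vectors whose images under `A q` are
a basis for all `q` near `p`. -/
theorem exists_det_ne_zero {V : Type*} [NormedAddCommGroup V] [NormedSpace ℝ V]
    {p : M} {A : M → V →L[ℝ] (Fin m → ℝ)}
    (hA : ContinuousAt A p) (hs : Function.Surjective (A p)) :
    ∃ r : Fin m → V,
      ∀ᶠ q in 𝓝 p, Matrix.det (Matrix.of fun i => A q (r i)) ≠ 0 := by
  choose r hr using fun i : Fin m => hs (Pi.single i 1)
  refine ⟨r, ?_⟩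
  have hdet : Continuous fun m : Matrix (Fin m) (Fin m) ℝ => m.det := continuous_id.matrix_det
  have h1 : ContinuousAt (fun q => Matrix.det (Matrix.of fun i => A q (r i))) p :=
    hdet.continuousAt.comp (continuousAt_pi.2 fun i => hA.clm_apply continuousAt_const)
  refine h1.eventually_ne ?_
  have : (Matrix.of fun i => A p (r i)) = (1 : Matrix (Fin m) (Fin m) ℝ) := by
    ext i j
    simp [hr, Matrix.one_apply, Pi.single_apply, eq_comm]
  rw [this, Matrix.det_one]
  exact one_ne_zero

theorem linearIndependent_of_det_ne_zero {w : Fin m → Fin m → ℝ}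
    (h : Matrix.det (Matrix.of w) ≠ 0) : LinearIndependent ℝ w :=
  Matrix.linearIndependent_rows_iff_isUnit.2
    ((Matrix.isUnit_iff_isUnit_det _).2 (isUnit_iff_ne_zero.2 h))

theorem surjective_of_det_ne_zero {V : Type*} [AddCommGroup V] [Module ℝ V]
    {L : V →ₗ[ℝ] (Fin m → ℝ)} {r : Fin m → V}
    (h : Matrix.det (Matrix.of fun i => L (r i)) ≠ 0) : Function.Surjective L := by
  have h1 := linearIndependent_of_det_ne_zero h
  have h2 := h1.span_eq_top_of_card_eq_finrank' (by simp)
  rw [← LinearMap.range_eq_top, eq_top_iff, ← h2, Submodule.span_le]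
  rintro _ ⟨i, rfl⟩
  exact ⟨r i, rfl⟩

namespace LocalEquation

variable {S : Set M} {p : M} {F : M → Fin m → ℝ}

theorem chartFDeriv_surjective (h : LocalEquation n S p F) :
    Function.Surjective (chartFDeriv n p F p) := by
  intro w
  obtain ⟨v, hv⟩ := h.surjective w
  exact ⟨chartDeriv n p p v,
    (mfderiv_eq_chartFDeriv (mem_extChartAt_source p) h.smooth.self_of_nhds v).symm.trans hv⟩

theorem eventually_exists_frame (h : LocalEquation n S p F) :
    ∃ r : Fin m → EuclideanSpace ℝ (Fin n), ∀ᶠ q in 𝓝 p,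
      Matrix.det (Matrix.of fun i => chartFDeriv n p F q (r i)) ≠ 0 :=
  exists_det_ne_zero (continuousAt_chartFDeriv h.smooth) h.chartFDeriv_surjective

theorem eventually (h : LocalEquation n S p F) : ∀ᶠ q in 𝓝 p, LocalEquation n S q F := by
  obtain ⟨r, hr⟩ := h.eventually_exists_frame
  filter_upwards [eventually_eventually_nhds.2 h.smooth, eventually_eventually_nhds.2 h.mem_iff, hr,
    extChartAt_source_mem_nhds (I := 𝓡 n) p] with q h1 h2 h3 h4
  refine ⟨h1, fun w => ?_, h2⟩
  obtain ⟨v, hv⟩ := surjective_of_det_ne_zero (L := (chartFDeriv n p F q).toLinearMap) h3 w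
  obtain ⟨u, rfl⟩ := (chartDeriv_bijective (by rwa [extChartAt_source] at h4)).2 v
  exact ⟨u, (mfderiv_eq_chartFDeriv h4 h1.self_of_nhds u).trans hv⟩

end LocalEquation

theorem mem_contDiffGroupoid_of_contDiffOn
    {e : OpenPartialHomeomorph (EuclideanSpace ℝ (Fin n)) (EuclideanSpace ℝ (Fin n))}
    (h1 : ContDiffOn ℝ ∞ e e.source) (h2 : ContDiffOn ℝ ∞ e.symm e.target) :
    e ∈ contDiffGroupoid ∞ (𝓡 n) := by
  rw [contDiffGroupoid, mem_groupoid_of_pregroupoid]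
  constructor
  · simpa [contDiffPregroupoid] using h1
  · simpa [contDiffPregroupoid] using h2

theorem trans_mem_maximalAtlas (p : M)
    {e : OpenPartialHomeomorph (EuclideanSpace ℝ (Fin n)) (EuclideanSpace ℝ (Fin n))}
    (he : e ∈ contDiffGroupoid ∞ (𝓡 n)) :
    (chartAt (EuclideanSpace ℝ (Fin n)) p).trans e ∈ IsManifold.maximalAtlas (𝓡 n) ∞ M := by
  refine mem_maximalAtlas_iff.2 fun c hc => ?_
  have hp := chart_mem_atlas (EuclideanSpace ℝ (Fin n)) p
  constructor
  · rw [OpenPartialHomeomorph.trans_symm_eq_symm_trans_symm, OpenPartialHomeomorph.trans_assoc]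
    exact (contDiffGroupoid ∞ (𝓡 n)).trans ((contDiffGroupoid ∞ (𝓡 n)).symm he)
      (HasGroupoid.compatible hp hc)
  · rw [← OpenPartialHomeomorph.trans_assoc]
    exact (contDiffGroupoid ∞ (𝓡 n)).trans (HasGroupoid.compatible hc hp) he

/-- Straightening: in a suitable chart, composed of the chart around `p` and a local
diffeomorphism `e` with derivative the identity, `S = {F = 0}` is the kernel of `dF_p`. -/
theorem LocalEquation.exists_straightening {S : Set M} {p : M} {F : M → Fin m → ℝ}
    (h : LocalEquation n S p F) :
    ∃ e : OpenPartialHomeomorph (EuclideanSpace ℝ (Fin n)) (EuclideanSpace ℝ (Fin n)),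
      extChartAt (𝓡 n) p p ∈ e.source ∧ ContDiffOn ℝ ∞ e e.source ∧
      ContDiffOn ℝ ∞ e.symm e.target ∧
      HasFDerivAt e (ContinuousLinearMap.id ℝ _) (extChartAt (𝓡 n) p p) ∧
      ∀ q ∈ (chartAt (EuclideanSpace ℝ (Fin n)) p).source, extChartAt (𝓡 n) p q ∈ e.source →
        (q ∈ S ↔ e (extChartAt (𝓡 n) p q) ∈ LinearMap.ker (chartFDeriv n p F p).toLinearMap) := by
  set φ := extChartAt (𝓡 n) p
  set f := F ∘ φ.symm
  set A := chartFDeriv n p F p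
  obtain ⟨R₀, hR₀⟩ := A.toLinearMap.exists_rightInverse_of_surjective
    (LinearMap.range_eq_top.2 h.chartFDeriv_surjective)
  let R : (Fin m → ℝ) →L[ℝ] EuclideanSpace ℝ (Fin n) := LinearMap.toContinuousLinearMap R₀
  have hR : ∀ w, A (R w) = w := fun w => congrArg (fun l => l w) hR₀
  have hev : ∀ᶠ z in 𝓝 (φ p), ContDiffAt ℝ ∞ f z ∧ (z ∈ φ.target ∧ (φ.symm z ∈ S ↔ f z = 0)) := by
    have ht : ∀ᶠ z in 𝓝 (φ p), z ∈ φ.target := extChartAt_target_mem_nhds (I := 𝓡 n) p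
    refine (eventually_contDiffAt_chart h.smooth).and (ht.and ?_)
    have h1 : Tendsto φ.symm (𝓝 (φ p)) (𝓝 p) := by
      have := continuousAt_extChartAt_symm (I := 𝓡 n) p
      rwa [ContinuousAt, (extChartAt (𝓡 n) p).left_inv (mem_extChartAt_source p)] at this
    exact h1.eventually h.mem_iff
  obtain ⟨O, hO, hOo, hpO⟩ := eventually_nhds_iff.1 hev
  have hf : ContDiffOn ℝ ∞ f O := fun z hz => (hO z hz).1.contDiffWithinAt
  -- `A (H z) = f z`, and the derivative of `H` at `φ p` is the identity
  let H : EuclideanSpace ℝ (Fin n) → EuclideanSpace ℝ (Fin n) := fun z => z - R (A z) + R (f z)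
  have hH : ContDiffOn ℝ ∞ H O :=
    (contDiffOn_id.sub (R.contDiff.comp A.contDiff).contDiffOn).add (R.contDiff.comp_contDiffOn hf)
  have hHd : HasFDerivAt H (ContinuousLinearMap.id ℝ _) (φ p) := by
    have h1 : HasFDerivAt f A (φ p) := ((hO _ hpO).1.differentiableAt (by simp)).hasFDerivAt
    have h2 := ((hasFDerivAt_id (𝕜 := ℝ) (φ p)).sub
      ((R.hasFDerivAt).comp (φ p) A.hasFDerivAt)).add (R.hasFDerivAt.comp (φ p) h1)
    refine h2.congr_fderiv ?_
    simp
  obtain ⟨e, hpe, heO, heH, he1, he2, -⟩ := exists_smooth_localInverse hOo hpO hH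
    (ContinuousLinearEquiv.refl ℝ _) hHd
  refine ⟨e, hpe, he1, he2, (funext heH : (e : _ → _) = H) ▸ hHd, fun q hq hqe => ?_⟩
  have hq' : q ∈ φ.source := by rwa [extChartAt_source]
  have h1 := (hO _ (heO hqe)).2.2
  rw [φ.left_inv hq'] at h1
  rw [h1, heH, LinearMap.mem_ker]
  have : A (H (φ q)) = f (φ q) := by simp [H, hR]
  exact (this ▸ Iff.rfl)

theorem LocalEquation.finrank_ker {S : Set M} {p : M} {F : M → Fin m → ℝ}
    (h : LocalEquation n S p F) :
    finrank ℝ (LinearMap.ker (chartFDeriv n p F p).toLinearMap) + m = n := by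
  have h1 := (chartFDeriv n p F p).toLinearMap.finrank_range_add_finrank_ker
  rw [LinearMap.range_eq_top.2 h.chartFDeriv_surjective] at h1
  simp at h1
  omega

/-- A set with local equations is a submanifold: in the straightened charts it is the kernel
of `dF`. -/
theorem isSubmanifold_of_localEquation {S : Set M}
    (h : ∀ p ∈ S, ∃ F : M → Fin m → ℝ, LocalEquation n S p F) : IsSubmanifold (n := n) S := by
  refine ⟨n - m, fun p hp => ?_⟩
  obtain ⟨F, hF⟩ := h p hp
  obtain ⟨e, hpe, he1, he2, -, hmem⟩ := hF.exists_straightening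
  refine ⟨_, trans_mem_maximalAtlas p (mem_contDiffGroupoid_of_contDiffOn he1 he2), ?_,
    LinearMap.ker (chartFDeriv n p F p).toLinearMap, ?_, ?_⟩
  · rw [OpenPartialHomeomorph.trans_source]
    exact ⟨mem_chart_source _ p, hpe⟩
  · have := hF.finrank_ker
    omega
  · intro q hq
    rw [OpenPartialHomeomorph.trans_source] at hq
    exact hmem q hq.1 hq.2

end LocalEquations

/-! ### Tangent and normal spaces of submanifolds given by local equations -/

section TangentSpaces

variable {n m : ℕ} {M : Type*} [TopologicalSpace M] [ChartedSpace (EuclideanSpace ℝ (Fin n)) M]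
  [IsManifold (𝓡 n) ∞ M]

/-- A vector in the kernel of `dF_p` is the velocity of the curve that is a straight line in a chart
that straightens `S = {F = 0}`. -/
theorem LocalEquation.exists_curve {S : Set M} {p : M} {F : M → Fin m → ℝ}
    (h : LocalEquation n S p F) (hp : p ∈ S) {v : TangentSpace (𝓡 n) p}
    (hv : mfderiv (𝓡 n) 𝓘(ℝ, Fin m → ℝ) F p v = 0) :
    ∃ γ : ℝ → M, ContMDiffAt 𝓘(ℝ, ℝ) (𝓡 n) ∞ γ 0 ∧ γ 0 = p ∧ (∀ᶠ t in 𝓝 (0 : ℝ), γ t ∈ S) ∧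
      (mfderiv 𝓘(ℝ, ℝ) (𝓡 n) γ 0 (1 : ℝ) : EuclideanSpace ℝ (Fin n)) = v := by
  obtain ⟨e, hpe, -, he2, hed, hmem⟩ := h.exists_straightening
  set φ := extChartAt (𝓡 n) p with hφ
  set w := chartDeriv n p p v with hw
  have hps := mem_extChartAt_source (I := 𝓡 n) p
  have hAw : chartFDeriv n p F p w = 0 := by
    rw [hw, ← mfderiv_eq_chartFDeriv hps h.smooth.self_of_nhds]
    exact hv
  have hA0 : chartFDeriv n p F p (e (φ p)) = 0 :=
    (hmem p (mem_chart_source _ p) hpe).1 hp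
  let c : ℝ → EuclideanSpace ℝ (Fin n) := fun t => e (φ p) + t • w
  have hc0 : c 0 = e (φ p) := by simp [c]
  have hc : ContDiff ℝ ∞ c := by fun_prop
  have hct : e (φ p) ∈ e.target := e.map_source hpe
  have hes : ContDiffAt ℝ ∞ e.symm (c 0) := by
    rw [hc0]
    exact he2.contDiffAt (e.open_target.mem_nhds hct)
  let σ : ℝ → EuclideanSpace ℝ (Fin n) := fun t => e.symm (c t)
  have hσ : ContDiffAt ℝ ∞ σ 0 := hes.comp 0 hc.contDiffAt
  have hσ0 : σ 0 = φ p := by simp only [σ, hc0, e.left_inv hpe]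
  have hσd : HasFDerivAt σ ((1 : ℝ →L[ℝ] ℝ).smulRight w) 0 := by
    have h1 : HasFDerivAt e.symm (ContinuousLinearMap.id ℝ (EuclideanSpace ℝ (Fin n))) (c 0) := by
      rw [hc0]
      exact e.hasFDerivAt_symm (f' := ContinuousLinearEquiv.refl ℝ _) hct
        (by rw [e.left_inv hpe]; exact hed)
    have h2 : HasFDerivAt c ((1 : ℝ →L[ℝ] ℝ).smulRight w) 0 := by
      have := ((hasDerivAt_id (0 : ℝ)).smul_const w).const_add (e (φ p))
      rw [one_smul] at this
      exact this.hasFDerivAt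
    exact h1.comp 0 h2
  have htgt : σ 0 ∈ φ.target := by rw [hσ0]; exact φ.map_source hps
  have hsm : ContMDiffAt 𝓘(ℝ, EuclideanSpace ℝ (Fin n)) (𝓡 n) ∞ φ.symm (σ 0) :=
    (contMDiffOn_extChartAt_symm p).contMDiffAt ((isOpen_extChartAt_target p).mem_nhds htgt)
  have hγ : ContMDiffAt 𝓘(ℝ, ℝ) (𝓡 n) ∞ (φ.symm ∘ σ) 0 :=
    hsm.comp 0 hσ.contMDiffAt
  have hγ0 : (φ.symm ∘ σ) 0 = p := by
    rw [Function.comp_apply, hσ0]; exact φ.left_inv hps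
  have hσt : ∀ᶠ t in 𝓝 (0 : ℝ), σ t ∈ φ.target :=
    hσ.continuousAt.eventually ((isOpen_extChartAt_target p).mem_nhds htgt)
  have hcs : ∀ᶠ t in 𝓝 (0 : ℝ), c t ∈ e.target :=
    hc.continuous.continuousAt.eventually (by rw [hc0]; exact e.open_target.mem_nhds hct)
  refine ⟨φ.symm ∘ σ, hγ, hγ0, ?_, ?_⟩
  · filter_upwards [hσt, hcs] with t ht htc
    have hs : φ.symm (σ t) ∈ φ.source := φ.map_target ht
    have hφσ : φ (φ.symm (σ t)) = σ t := φ.right_inv ht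
    rw [Function.comp_apply, hmem _ (by rwa [hφ, extChartAt_source] at hs)
      (by rw [hφσ]; exact e.map_target htc), hφσ]
    simp only [σ, e.right_inv htc, c]
    rw [LinearMap.mem_ker]
    change chartFDeriv n p F p (e (φ p) + t • w) = 0
    rw [map_add, map_smul, hA0, hAw, smul_zero, add_zero]
  -- the velocity lives in the tangent space at `γ 0`, and `γ 0 = p` holds only propositionally
  · have key : ∀ p' : M, p' = p → ∀ u : TangentSpace (𝓡 n) p', chartDeriv n p p' u = w →
        (u : EuclideanSpace ℝ (Fin n)) = v := by
      rintro _ rfl u hu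
      exact (chartDeriv_bijective (mem_chart_source _ _)).1 hu
    refine key _ hγ0 _ ?_
    have h1 : HasMFDerivAt (𝓡 n) 𝓘(ℝ, EuclideanSpace ℝ (Fin n)) φ ((φ.symm ∘ σ) 0)
        (chartDeriv n p ((φ.symm ∘ σ) 0)) :=
      (mdifferentiableAt_extChartAt (by rw [hγ0]; exact mem_chart_source _ p)).hasMFDerivAt
    have h2 := h1.comp 0 (hγ.mdifferentiableAt (by simp)).hasMFDerivAt
    have h3 : HasMFDerivAt 𝓘(ℝ, ℝ) 𝓘(ℝ, EuclideanSpace ℝ (Fin n)) (φ ∘ (φ.symm ∘ σ)) 0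
        ((1 : ℝ →L[ℝ] ℝ).smulRight w) := by
      refine hσd.hasMFDerivAt.congr_of_eventuallyEq ?_
      filter_upwards [hσt] with t ht
      exact φ.right_inv ht
    have h4 := congrArg (fun l : ℝ →L[ℝ] EuclideanSpace ℝ (Fin n) => l 1)
      (hasMFDerivAt_unique h2 h3)
    refine Eq.trans h4 ?_
    change (1 : ℝ) • w = w
    exact one_smul _ _

/-- The tangent space of `S = {F = 0}` is the kernel of `dF`. -/
theorem LocalEquation.mem_tangentOf_iff {S : Set M} {p : M} {F : M → Fin m → ℝ}
    (h : LocalEquation n S p F) (hp : p ∈ S) (v : TangentSpace (𝓡 n) p) :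
    v ∈ tangentOf n S p ↔ mfderiv (𝓡 n) 𝓘(ℝ, Fin m → ℝ) F p v = 0 := by
  constructor
  · intro hv
    suffices tangentOf n S p ≤
        LinearMap.ker (mfderiv (𝓡 n) 𝓘(ℝ, Fin m → ℝ) F p).toLinearMap from this hv
    refine Submodule.span_le.2 ?_
    rintro _ ⟨γ, hγ, rfl, hS, rfl⟩
    have h1 := (h.smooth.self_of_nhds.mdifferentiableAt (by simp)).hasMFDerivAt
    have h2 := h1.comp 0 (hγ.mdifferentiableAt (by simp)).hasMFDerivAt
    have h3 : HasMFDerivAt 𝓘(ℝ, ℝ) 𝓘(ℝ, Fin m → ℝ) (F ∘ γ) 0 (0 : ℝ →L[ℝ] (Fin m → ℝ)) := by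
      refine (hasFDerivAt_const (0 : Fin m → ℝ) (0 : ℝ)).hasMFDerivAt.congr_of_eventuallyEq ?_
      filter_upwards [hS, hγ.continuousAt.eventually h.mem_iff] with t ht ht'
      exact ht'.1 ht
    exact congrArg (fun l : ℝ →L[ℝ] (Fin m → ℝ) => l 1) (hasMFDerivAt_unique h2 h3)
  · intro hv
    obtain ⟨γ, h1, h2, h3, h4⟩ := h.exists_curve hp hv
    exact Submodule.subset_span ⟨γ, h1, h2, h3, h4⟩

theorem LocalEquation.eventually_tangentOf {S : Set M} {p : M} {F : M → Fin m → ℝ}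
    (h : LocalEquation n S p F) :
    ∀ᶠ q in 𝓝 p, q ∈ S →
      tangentOf n S q = LinearMap.ker (formAt n p (chartFDeriv n p F) q) := by
  filter_upwards [h.eventually, eventually_mfderiv_eq_formAt h.smooth] with q hq hq' hqS
  ext v
  rw [hq.mem_tangentOf_iff hqS, LinearMap.mem_ker, ← hq' v]
  rfl

theorem LocalEquation.finrank_tangentOf {S : Set M} {p : M} {F : M → Fin m → ℝ}
    (h : LocalEquation n S p F) (hp : p ∈ S) : finrank ℝ (tangentOf n S p) + m = n := by
  have h1 : tangentOf n S p =
      (LinearMap.ker (chartFDeriv n p F p).toLinearMap).comap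
        (chartEquiv (mem_chart_source (EuclideanSpace ℝ (Fin n)) p)).toLinearMap := by
    rw [h.eventually_tangentOf.self_of_nhds hp]
    rfl
  have h2 := h.finrank_ker
  rw [h1]
  have e := ((chartEquiv (mem_chart_source (EuclideanSpace ℝ (Fin n)) p)).submoduleMap
    ((LinearMap.ker (chartFDeriv n p F p).toLinearMap).comap
        (chartEquiv (mem_chart_source (EuclideanSpace ℝ (Fin n)) p)).toLinearMap)).finrank_eq
  rw [Submodule.map_comap_eq_of_surjective
    (chartEquiv (mem_chart_source (EuclideanSpace ℝ (Fin n)) p)).surjective] at e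
  omega

omit [IsManifold (𝓡 n) ∞ M] in
theorem isTangentBasis_of_linearIndependent {S : Set M} {p : M} {k : ℕ}
    {v : Fin k → TangentSpace (𝓡 n) p} (hv : ∀ i, v i ∈ tangentOf n S p)
    (hli : LinearIndependent ℝ v) (hk : finrank ℝ (tangentOf n S p) = k) :
    IsTangentBasis S p v := by
  have h1 : LinearIndependent ℝ fun i => (⟨v i, hv i⟩ : tangentOf n S p) :=
    LinearIndependent.of_comp (tangentOf n S p).subtype hli
  let b := basisOfLinearIndependentOfCardEqFinrank' _ h1 (by simp [hk])
  exact ⟨b, fun i => by simp [b], trivial⟩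

omit [IsManifold (𝓡 n) ∞ M] in
/-- Vectors on which a linear map that vanishes on `T_p S` has nonzero determinant represent a
basis of the normal space, if their number is the codimension. -/
theorem isNormalBasis_of_det_ne_zero {S : Set M} {p : M} {k : ℕ}
    {v : Fin k → TangentSpace (𝓡 n) p} {Λ : TangentSpace (𝓡 n) p →ₗ[ℝ] (Fin k → ℝ)}
    (hΛ : tangentOf n S p ≤ LinearMap.ker Λ) (hdet : detAlong Λ v ≠ 0)
    (hk : finrank ℝ (tangentOf n S p) + k = n) : IsNormalBasis S p v := by
  have h0 := linearIndependent_of_det_ne_zero hdet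
  have h1 : LinearIndependent ℝ fun i => (tangentOf n S p).mkQ (v i) := by
    refine LinearIndependent.of_comp ((tangentOf n S p).liftQ Λ hΛ) ?_
    exact h0
  have h2 : finrank ℝ (NormalSpace n S p) + finrank ℝ (tangentOf n S p) =
      finrank ℝ (TangentSpace (𝓡 n) p) := (tangentOf n S p).finrank_quotient_add_finrank
  have h3 := finrank_tangentSpace (n := n) p
  let b := basisOfLinearIndependentOfCardEqFinrank' _ h1 (by
    rw [Fintype.card_fin]
    change k = finrank ℝ (NormalSpace n S p)
    omega)
  exact ⟨b, fun i => by simp [b], trivial⟩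

/-- A subspace of dimension `k` is mapped isomorphically onto `ℝᵏ` by some linear map on the whole
space. -/
theorem exists_linearMap_injOn {E : Type*} [NormedAddCommGroup E] [NormedSpace ℝ E]
    [FiniteDimensional ℝ E] {k : ℕ} {T : Submodule ℝ E} (hT : finrank ℝ T = k) :
    ∃ (b : Basis (Fin k) ℝ T) (l : E →L[ℝ] (Fin k → ℝ)), (∀ v ∈ T, l v = 0 → v = 0) ∧
      ∀ i, l (b i) = Pi.single i 1 := by
  let b : Basis (Fin k) ℝ T := finBasisOfFinrankEq ℝ T hT
  obtain ⟨P, hP⟩ := T.subtype.exists_leftInverse_of_injective T.ker_subtype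
  have hP' : ∀ v : T, P v = v := fun v => congrArg (fun l => l v) hP
  refine ⟨b, LinearMap.toContinuousLinearMap (b.equivFun.toLinearMap ∘ₗ P), ?_, fun i => ?_⟩
  · intro v hv h
    have h1 : b.equivFun (P v) = 0 := h
    rw [hP' ⟨v, hv⟩] at h1
    exact congrArg Subtype.val (b.equivFun.map_eq_zero_iff.1 h1)
  · change b.equivFun (P (b i)) = _
    rw [hP']
    funext j
    simp [Pi.single_apply, eq_comm]

theorem eventually_continuousAt_chartFDeriv {W : Type*} [NormedAddCommGroup W] [NormedSpace ℝ W]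
    {p : M} {F : M → W} (hF : ∀ᶠ q in 𝓝 p, ContMDiffAt (𝓡 n) 𝓘(ℝ, W) ∞ F q) :
    ∀ᶠ q in 𝓝 p, ContinuousAt (chartFDeriv n p F) q := by
  filter_upwards [(continuousAt_extChartAt (I := 𝓡 n) p).eventually
    (eventually_contDiffAt_chart hF), extChartAt_source_mem_nhds (I := 𝓡 n) p] with q h1 h2
  have h3 : ContinuousAt (fderiv ℝ (F ∘ (extChartAt (𝓡 n) p).symm)) (extChartAt (𝓡 n) p q) :=
    (h1.fderiv_right (m := 0) (by simp)).continuousAt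
  exact ContinuousAt.comp (f := extChartAt (𝓡 n) p) h3 (continuousAt_extChartAt' h2)

open scoped Classical in
/-- The vector field with given coordinates in the chart around `p`, extended by `0` to the points
outside the domain of the chart. -/
noncomputable def ofCoordinates (p : M) (Y : M → EuclideanSpace ℝ (Fin n)) (q : M) :
    TangentSpace (𝓡 n) q :=
  if h : q ∈ (chartAt (EuclideanSpace ℝ (Fin n)) p).source then (chartEquiv h).symm (Y q) else 0

theorem chartDeriv_ofCoordinates {p q : M} (Y : M → EuclideanSpace ℝ (Fin n))
    (h : q ∈ (chartAt (EuclideanSpace ℝ (Fin n)) p).source) :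
    chartDeriv n p q (ofCoordinates p Y q) = Y q := by
  rw [ofCoordinates, dif_pos h, ← chartEquiv_apply h, LinearEquiv.apply_symm_apply]

theorem continuousOn_ofCoordinates {S : Set M} {p : M} {Y : M → EuclideanSpace ℝ (Fin n)}
    {U : Set S} (hU : ∀ q ∈ U, (q : M) ∈ (chartAt (EuclideanSpace ℝ (Fin n)) p).source)
    (hY : ∀ q ∈ U, ContinuousAt Y (q : M)) :
    ContinuousOn (fun q : S => (⟨(q : M), ofCoordinates p Y q⟩ : TangentBundle (𝓡 n) M)) U := by
  refine continuousOn_of_chartDeriv (p := p) continuous_subtype_val.continuousOn hU ?_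
  have : ContinuousOn (fun q : S => Y q) U := fun q hq =>
    ((hY q hq).comp continuous_subtype_val.continuousAt).continuousWithinAt
  exact this.congr fun q hq => chartDeriv_ofCoordinates Y (hU q hq)

/-- Constant vector fields in a chart whose images under `dF_p` are a basis are a normal frame
near `p`. -/
theorem hasNormalFrames {S : Set M}
    (h : ∀ p ∈ S, ∃ F : M → Fin m → ℝ, LocalEquation n S p F) : HasNormalFrames n S m := by
  rintro ⟨p, hp⟩
  obtain ⟨F, hF⟩ := h p hp
  obtain ⟨r, hr⟩ := hF.eventually_exists_frame
  have hs : ∀ᶠ q in 𝓝 p, q ∈ (chartAt (EuclideanSpace ℝ (Fin n)) p).source :=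
    chart_source_mem_nhds (EuclideanSpace ℝ (Fin n)) p
  have hev : ∀ᶠ q in 𝓝 p, q ∈ (chartAt (EuclideanSpace ℝ (Fin n)) p).source ∧
      Matrix.det (Matrix.of fun i => chartFDeriv n p F q (r i)) ≠ 0 ∧
      (q ∈ S → tangentOf n S q = LinearMap.ker (formAt n p (chartFDeriv n p F) q)) ∧
      LocalEquation n S q F :=
    hs.and
      (hr.and (hF.eventually_tangentOf.and hF.eventually))
  refine ⟨{q | _}, continuous_subtype_val.continuousAt.eventually hev,
    fun i q => ofCoordinates p (fun _ => r i) q, fun i => ?_, ?_⟩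
  · exact continuousOn_ofCoordinates (fun q hq => hq.1) fun q _ => continuousAt_const
  · rintro q ⟨h1, h2, h3, h4⟩
    refine isNormalBasis_of_det_ne_zero (h3 q.2).le ?_ (h4.finrank_tangentOf q.2)
    simp only [detAlong_apply, formAt_apply, chartDeriv_ofCoordinates _ h1]
    exact h2

/-- A tangent frame near `p` is obtained by projecting a basis of the kernel of `dF_p`, in a chart,
to the kernels of the nearby derivatives. -/
theorem hasTangentFrames {S : Set M} {k : ℕ} (hk : k + m = n)
    (h : ∀ p ∈ S, ∃ F : M → Fin m → ℝ, LocalEquation n S p F) : HasTangentFrames n S k := by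
  rintro ⟨p, hp⟩
  obtain ⟨F, hF⟩ := h p hp
  set A := chartFDeriv n p F with hA
  obtain ⟨R₀, hR₀⟩ := (A p).toLinearMap.exists_rightInverse_of_surjective
    (LinearMap.range_eq_top.2 hF.chartFDeriv_surjective)
  let R : (Fin m → ℝ) →L[ℝ] EuclideanSpace ℝ (Fin n) := LinearMap.toContinuousLinearMap R₀
  have hR : A p ∘L R = 1 := ContinuousLinearMap.ext fun w => congrArg (fun l => l w) hR₀
  -- the projection onto the kernel of `A q` along the range of `R`
  let Y : EuclideanSpace ℝ (Fin n) → M → EuclideanSpace ℝ (Fin n) :=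
    fun a q => a - R (Ring.inverse (A q ∘L R) (A q a))
  have hAc : ∀ᶠ q in 𝓝 p, ContinuousAt A q := eventually_continuousAt_chartFDeriv hF.smooth
  have hcomp : ∀ q, ContinuousAt A q → ContinuousAt (fun q => A q ∘L R) q := fun q hq =>
    hq.clm_comp continuousAt_const
  have hunit : ∀ᶠ q in 𝓝 p, IsUnit (A q ∘L R) := by
    refine (hcomp p hAc.self_of_nhds).eventually (p := fun u => IsUnit u) ?_
    refine Units.isOpen.mem_nhds ?_
    change IsUnit (A p ∘L R)
    rw [hR]
    exact isUnit_one
  have hYc : ∀ q, ContinuousAt A q → IsUnit (A q ∘L R) → ∀ a, ContinuousAt (Y a) q := by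
    rintro q hq ⟨u, hu⟩ a
    have h1 : ContinuousAt (fun q => Ring.inverse (A q ∘L R)) q :=
      ContinuousAt.comp (g := Ring.inverse) (f := fun q => A q ∘L R)
        (by rw [← hu]; exact NormedRing.inverse_continuousAt u) (hcomp q hq)
    exact continuousAt_const.sub
      (R.continuous.continuousAt.comp (h1.clm_apply (hq.clm_apply continuousAt_const)))
  have hYk : ∀ q, IsUnit (A q ∘L R) → ∀ a, A q (Y a q) = 0 := by
    intro q hq a
    have h1 := congrArg (fun l : (Fin m → ℝ) →L[ℝ] (Fin m → ℝ) => l (A q a))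
      (Ring.mul_inverse_cancel _ hq)
    simp only [Y, map_sub]
    exact sub_eq_zero.2 h1.symm
  obtain ⟨b, l, -, hl⟩ := exists_linearMap_injOn
    (T := LinearMap.ker (A p).toLinearMap) (k := k) (by
      have h := hF.finrank_ker
      rw [← hA] at h
      omega)
  have hdet : ∀ᶠ q in 𝓝 p, Matrix.det (Matrix.of fun i => l (Y (b i) q)) ≠ 0 := by
    have hdet : Continuous fun m : Matrix (Fin k) (Fin k) ℝ => m.det := continuous_id.matrix_det
    have h1 : ContinuousAt (fun q => Matrix.det (Matrix.of fun i => l (Y (b i) q))) p :=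
      hdet.continuousAt.comp (continuousAt_pi.2 fun i => l.continuous.continuousAt.comp
        (hYc p hAc.self_of_nhds hunit.self_of_nhds _))
    refine h1.eventually_ne ?_
    have h2 : (Matrix.of fun i => l (Y (b i) p)) = (1 : Matrix (Fin k) (Fin k) ℝ) := by
      ext i j
      simp [Y, hl, Matrix.one_apply, Pi.single_apply, eq_comm]
    rw [h2, Matrix.det_one]
    exact one_ne_zero
  have hs : ∀ᶠ q in 𝓝 p, q ∈ (chartAt (EuclideanSpace ℝ (Fin n)) p).source :=
    chart_source_mem_nhds (EuclideanSpace ℝ (Fin n)) p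
  have hev : ∀ᶠ q in 𝓝 p, q ∈ (chartAt (EuclideanSpace ℝ (Fin n)) p).source ∧
      Matrix.det (Matrix.of fun i => l (Y (b i) q)) ≠ 0 ∧
      (q ∈ S → tangentOf n S q = LinearMap.ker (formAt n p A q)) ∧
      LocalEquation n S q F ∧ ContinuousAt A q ∧ IsUnit (A q ∘L R) :=
    hs.and
      (hdet.and (hF.eventually_tangentOf.and (hF.eventually.and (hAc.and hunit))))
  refine ⟨{q | _}, continuous_subtype_val.continuousAt.eventually hev,
    fun i q => ofCoordinates p (Y (b i)) q, fun i => ?_, ?_⟩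
  · exact continuousOn_ofCoordinates (fun q hq => hq.1)
      fun q hq => hYc q hq.2.2.2.2.1 hq.2.2.2.2.2 _
  · rintro q ⟨h1, h2, h3, h4, -, h5⟩
    refine isTangentBasis_of_linearIndependent (fun i => ?_) ?_ ?_
    · rw [h3 q.2, LinearMap.mem_ker, formAt_apply, chartDeriv_ofCoordinates _ h1]
      exact hYk q h5 _
    · refine LinearIndependent.of_comp (l.toLinearMap ∘ₗ (chartDeriv n p q).toLinearMap) ?_
      refine linearIndependent_of_det_ne_zero ?_
      convert h2 using 5 with i
      exact congrArg l (chartDeriv_ofCoordinates _ h1)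
    · have := h4.finrank_tangentOf q.2
      omega

end TangentSpaces

/-! ### Intersections, level sets and pull-backs of local equations -/

section Constructions

variable {n m m' : ℕ} {M : Type*} [TopologicalSpace M] [ChartedSpace (EuclideanSpace ℝ (Fin n)) M]

/-- Concatenation of vectors as a continuous linear map. -/
noncomputable def appendCLM (m m' : ℕ) :
    ((Fin m → ℝ) × (Fin m' → ℝ)) →L[ℝ] (Fin (m + m') → ℝ) :=
  LinearMap.toContinuousLinearMap
    { toFun := fun a => Fin.append a.1 a.2
      map_add' := fun a b => by
        funext i
        refine Fin.addCases (fun i => ?_) (fun i => ?_) i <;> simp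
      map_smul' := fun c a => by
        funext i
        refine Fin.addCases (fun i => ?_) (fun i => ?_) i <;> simp }

theorem append_eq_zero_iff {a : Fin m → ℝ} {b : Fin m' → ℝ} :
    Fin.append a b = 0 ↔ a = 0 ∧ b = 0 := by
  constructor
  · intro h
    exact ⟨funext fun i => by simpa using congrFun h (Fin.castAdd m' i),
      funext fun i => by simpa using congrFun h (Fin.natAdd m i)⟩
  · rintro ⟨rfl, rfl⟩
    exact (appendCLM m m').map_zero

theorem mfderiv_append {p : M} {F : M → Fin m → ℝ} {F' : M → Fin m' → ℝ}
    (hF : ContMDiffAt (𝓡 n) 𝓘(ℝ, Fin m → ℝ) ∞ F p)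
    (hF' : ContMDiffAt (𝓡 n) 𝓘(ℝ, Fin m' → ℝ) ∞ F' p) (v : TangentSpace (𝓡 n) p) :
    mfderiv (𝓡 n) 𝓘(ℝ, Fin (m + m') → ℝ) (fun q => Fin.append (F q) (F' q)) p v =
      Fin.append (mfderiv (𝓡 n) 𝓘(ℝ, Fin m → ℝ) F p v : Fin m → ℝ)
        (mfderiv (𝓡 n) 𝓘(ℝ, Fin m' → ℝ) F' p v : Fin m' → ℝ) := by
  have hd := (hF.mdifferentiableAt (by simp)).hasMFDerivAt
  have hd' := (hF'.mdifferentiableAt (by simp)).hasMFDerivAt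
  have h1 : HasMFDerivAt (𝓡 n) 𝓘(ℝ, (Fin m → ℝ) × (Fin m' → ℝ)) (fun q => (F q, F' q)) p
      ((mfderiv (𝓡 n) 𝓘(ℝ, Fin m → ℝ) F p).prod (mfderiv (𝓡 n) 𝓘(ℝ, Fin m' → ℝ) F' p)) :=
    ⟨hd.1.prodMk hd'.1, hd.2.prodMk hd'.2⟩
  have h2 := ((appendCLM m m').hasFDerivAt (x := (F p, F' p))).hasMFDerivAt.comp p h1
  exact congrArg (fun l : TangentSpace (𝓡 n) p →L[ℝ] (Fin (m + m') → ℝ) => l v) h2.mfderiv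

theorem ContMDiffAt.fin_append {p : M} {F : M → Fin m → ℝ} {F' : M → Fin m' → ℝ}
    (hF : ContMDiffAt (𝓡 n) 𝓘(ℝ, Fin m → ℝ) ∞ F p)
    (hF' : ContMDiffAt (𝓡 n) 𝓘(ℝ, Fin m' → ℝ) ∞ F' p) :
    ContMDiffAt (𝓡 n) 𝓘(ℝ, Fin (m + m') → ℝ) ∞ (fun q => Fin.append (F q) (F' q)) p :=
  (appendCLM m m').contDiff.contMDiff.contMDiffAt.comp p (hF.prodMk_space hF')

variable [IsManifold (𝓡 n) ∞ M]

/-- Transversal intersections are submanifolds. -/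
theorem LocalEquation.inter {S S' : Set M} {p : M} {F : M → Fin m → ℝ} {F' : M → Fin m' → ℝ}
    (h : LocalEquation n S p F) (h' : LocalEquation n S' p F') (hp : p ∈ S) (hp' : p ∈ S')
    (ht : tangentOf n S p ⊔ tangentOf n S' p = ⊤) :
    LocalEquation n (S ∩ S') p fun q => Fin.append (F q) (F' q) where
  smooth := by
    filter_upwards [h.smooth, h'.smooth] with q h1 h2 using h1.fin_append h2
  mem_iff := by
    filter_upwards [h.mem_iff, h'.mem_iff] with q h1 h2
    rw [mem_inter_iff, h1, h2, append_eq_zero_iff]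
  surjective := by
    intro c
    obtain ⟨u, hu⟩ := h.surjective (fun i => c (Fin.castAdd m' i))
    obtain ⟨u', hu'⟩ := h'.surjective (fun i => c (Fin.natAdd m i))
    obtain ⟨t, h1, t', h2, h3⟩ := Submodule.mem_sup.1 (ht.symm ▸ Submodule.mem_top (x := u' - u))
    rw [h.mem_tangentOf_iff hp] at h1
    rw [h'.mem_tangentOf_iff hp'] at h2
    have h4 : u + t = u' - t' := by
      rw [eq_sub_iff_add_eq, add_assoc, h3, add_sub_cancel]
    refine ⟨u + t, ?_⟩
    refine (mfderiv_append h.smooth.self_of_nhds h'.smooth.self_of_nhds _).trans ?_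
    have h5 : mfderiv (𝓡 n) 𝓘(ℝ, Fin m → ℝ) F p (u + t) = fun i => c (Fin.castAdd m' i) := by
      rw [map_add, h1, hu]
      exact add_zero _
    have h6 : mfderiv (𝓡 n) 𝓘(ℝ, Fin m' → ℝ) F' p (u + t) = fun i => c (Fin.natAdd m i) := by
      rw [h4, map_sub, h2, hu']
      exact sub_zero _
    rw [h5, h6]
    exact Fin.append_castAdd_natAdd

/-- The tangent space of a transversal intersection is the intersection of the tangent spaces. -/
theorem LocalEquation.tangentOf_inter {S S' : Set M} {p : M} {F : M → Fin m → ℝ}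
    {F' : M → Fin m' → ℝ}
    (h : LocalEquation n S p F) (h' : LocalEquation n S' p F') (hp : p ∈ S) (hp' : p ∈ S')
    (ht : tangentOf n S p ⊔ tangentOf n S' p = ⊤) :
    tangentOf n (S ∩ S') p = tangentOf n S p ⊓ tangentOf n S' p := by
  ext v
  rw [(h.inter h' hp hp' ht).mem_tangentOf_iff ⟨hp, hp'⟩, Submodule.mem_inf,
    h.mem_tangentOf_iff hp, h'.mem_tangentOf_iff hp']
  refine Iff.trans ?_ append_eq_zero_iff
  rw [← mfderiv_append h.smooth.self_of_nhds h'.smooth.self_of_nhds]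
  exact Iff.rfl

omit [IsManifold (𝓡 n) ∞ M] in
theorem mfderiv_const_fin_one {f : M → ℝ} {p : M} (hf : MDifferentiableAt (𝓡 n) 𝓘(ℝ, ℝ) f p)
    (a : ℝ) (v : TangentSpace (𝓡 n) p) (i : Fin 1) :
    (mfderiv (𝓡 n) 𝓘(ℝ, Fin 1 → ℝ) (fun q _ => f q - a : M → Fin 1 → ℝ) p v : Fin 1 → ℝ) i =
      (mfderiv (𝓡 n) 𝓘(ℝ, ℝ) f p v : ℝ) := by
  have h1 : HasFDerivAt (𝕜 := ℝ) ((fun t _ => t - a : ℝ → Fin 1 → ℝ))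
      (ContinuousLinearMap.pi fun _ => ContinuousLinearMap.id ℝ ℝ) (f p) :=
    hasFDerivAt_pi.2 fun _ => (hasFDerivAt_id _).sub_const a
  have h2 : HasMFDerivAt (𝓡 n) 𝓘(ℝ, Fin 1 → ℝ) (fun q _ => f q - a : M → Fin 1 → ℝ) p _ :=
    HasMFDerivAt.comp (g := (fun t _ => t - a : ℝ → Fin 1 → ℝ)) p h1.hasMFDerivAt hf.hasMFDerivAt
  exact congrArg (fun l : TangentSpace (𝓡 n) p →L[ℝ] (Fin 1 → ℝ) => l v i) h2.mfderiv

omit [IsManifold (𝓡 n) ∞ M] in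
/-- The level set through a point that is not critical is a submanifold near this point. -/
theorem localEquation_level {f : M → ℝ} (hf : ContMDiff (𝓡 n) 𝓘(ℝ, ℝ) ∞ f) {p : M}
    (hp : p ∉ Crit n f) (a : ℝ) : LocalEquation n (f ⁻¹' {a}) p fun q (_ : Fin 1) => f q - a where
  smooth := Eventually.of_forall fun q => by
    have h1 : ContDiff ℝ ∞ (fun (t : ℝ) (_ : Fin 1) => t - a) := by fun_prop
    exact h1.contMDiff.contMDiffAt.comp q hf.contMDiffAt
  mem_iff := Eventually.of_forall fun q => by
    constructor
    · rintro rfl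
      funext i
      exact sub_self _
    · intro h
      exact sub_eq_zero.1 (congrFun h 0)
  surjective := by
    intro c
    obtain ⟨v, hv⟩ : ∃ v, (mfderiv (𝓡 n) 𝓘(ℝ, ℝ) f p v : ℝ) ≠ 0 := by
      by_contra! h
      exact hp (ContinuousLinearMap.ext h)
    let l : ℝ := mfderiv (𝓡 n) 𝓘(ℝ, ℝ) f p v
    let s : ℝ := (c : Fin 1 → ℝ) 0 / l
    refine ⟨s • v, funext fun i => ?_⟩
    have h1 := mfderiv_const_fin_one (hf.mdifferentiableAt (by simp) (x := p)) a (s • v) i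
    refine h1.trans ?_
    rw [map_smul, Subsingleton.elim i 0]
    exact div_mul_cancel₀ ((c : Fin 1 → ℝ) 0) hv

omit [IsManifold (𝓡 n) ∞ M] in
/-- The pull-back of a local equation by a map that is submersive at `p`. -/
theorem LocalEquation.comp {S T : Set M} {p : M} {F : M → Fin m → ℝ} {ψ : M → M}
    (hψ : ContMDiff (𝓡 n) (𝓡 n) ∞ ψ) (h : LocalEquation n S (ψ p) F)
    (hs : Function.Surjective (mfderiv (𝓡 n) (𝓡 n) ψ p)) (hT : ∀ q, q ∈ T ↔ ψ q ∈ S) :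
    LocalEquation n T p (F ∘ ψ) where
  smooth := by
    filter_upwards [hψ.continuous.continuousAt.eventually h.smooth] with q hq
    exact hq.comp q hψ.contMDiffAt
  mem_iff := by
    filter_upwards [hψ.continuous.continuousAt.eventually h.mem_iff] with q hq
    rw [hT, hq]
    rfl
  surjective := by
    have h1 := mfderiv_comp p (h.smooth.self_of_nhds.mdifferentiableAt (by simp))
      (hψ.mdifferentiableAt (by simp) (x := p))
    rw [h1]
    exact h.surjective.comp hs

end Constructions

/-! ### The gradient field in charts -/

/-- An endomorphism which is self-adjoint for a scalar product is diagonalizable. -/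
theorem exists_eigenbasis {V : Type*} [AddCommGroup V] [Module ℝ V] [FiniteDimensional ℝ V] {n : ℕ}
    (hn : finrank ℝ V = n) (B : V →ₗ[ℝ] V →ₗ[ℝ] ℝ) (hsymm : ∀ v w, B v w = B w v)
    (hpos : ∀ v, v ≠ 0 → 0 < B v v) (T : V →ₗ[ℝ] V) (hT : ∀ v w, B (T v) w = B v (T w)) :
    ∃ (b : Basis (Fin n) ℝ V) (l : Fin n → ℝ), ∀ i, T (b i) = l i • b i := by
  let c : InnerProductSpace.Core ℝ V :=
    { inner := fun v w => B v w
      conj_inner_symm := fun v w => hsymm w v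
      re_inner_nonneg := fun v => by
        by_cases h : v = 0
        · simp [h]
        · exact (hpos v h).le
      add_left := fun v w u => by simp
      smul_left := fun v w r => by simp
      definite := fun v h => by
        by_contra h'
        exact (hpos v h').ne' h }
  let _ : NormedAddCommGroup V := c.toNormedAddCommGroup
  let _ : InnerProductSpace ℝ V := InnerProductSpace.ofCore c.toCore
  have h : T.IsSymmetric := hT
  exact ⟨(h.eigenvectorBasis hn).toBasis, h.eigenvalues hn, fun i => by
    simp [h.apply_eigenvectorBasis hn i]⟩

section Gradient

variable {n : ℕ} {M : Type*} [TopologicalSpace M] [ChartedSpace (EuclideanSpace ℝ (Fin n)) M]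
  [IsManifold (𝓡 n) ∞ M]

/-- A vector field in the coordinates given by the chart around `p`. -/
noncomputable def chartField (p : M) (V : ∀ q : M, TangentSpace (𝓡 n) q)
    (ξ : EuclideanSpace ℝ (Fin n)) : EuclideanSpace ℝ (Fin n) :=
  chartDeriv n p ((extChartAt (𝓡 n) p).symm ξ) (V ((extChartAt (𝓡 n) p).symm ξ))

/-- Smoothness of a vector field is smoothness of its coordinates in a chart. -/
theorem contMDiffAt_vectorField_iff {p q : M}
    (hq : q ∈ (chartAt (EuclideanSpace ℝ (Fin n)) p).source) {V : ∀ q : M, TangentSpace (𝓡 n) q} :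
    ContMDiffAt (𝓡 n) (𝓡 n).tangent ∞ (fun q => (⟨q, V q⟩ : TangentBundle (𝓡 n) M)) q ↔
      ContMDiffAt (𝓡 n) 𝓘(ℝ, EuclideanSpace ℝ (Fin n)) ∞ (fun q => chartDeriv n p q (V q)) q := by
  rw [(trivializationAt (EuclideanSpace ℝ (Fin n)) (TangentSpace (𝓡 n)) p).contMDiffAt_section_iff
    (n := ∞) (IB := 𝓡 n) (s := V) (x₀ := q) hq]
  refine Filter.EventuallyEq.contMDiffAt_iff ?_
  filter_upwards [(chartAt (EuclideanSpace ℝ (Fin n)) p).open_source.mem_nhds hq] with q' hq'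
  exact chartDeriv_eq_trivialization hq' _

theorem contDiffOn_chartField {V : ∀ q : M, TangentSpace (𝓡 n) q}
    (hV : ContMDiff (𝓡 n) (𝓡 n).tangent ∞ (fun q => (⟨q, V q⟩ : TangentBundle (𝓡 n) M))) (p : M) :
    ContDiffOn ℝ ∞ (chartField p V) (extChartAt (𝓡 n) p).target := by
  intro ξ hξ
  have hs := (extChartAt (𝓡 n) p).map_target hξ
  have h1 := contDiffAt_chart hs
    ((contMDiffAt_vectorField_iff (by rwa [extChartAt_source] at hs)).1 hV.contMDiffAt)
  rw [(extChartAt (𝓡 n) p).right_inv hξ] at h1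
  exact h1.contDiffWithinAt

/-- A Riemannian metric in the coordinates given by the chart around `p`; the value is `0` outside
the domain of the chart. -/
noncomputable def chartMetric (g : SmoothMetric n M) (p q : M) :
    EuclideanSpace ℝ (Fin n) →L[ℝ] EuclideanSpace ℝ (Fin n) →L[ℝ] ℝ :=
  open scoped Classical in
  let J : EuclideanSpace ℝ (Fin n) →ₗ[ℝ] TangentSpace (𝓡 n) q :=
    if h : q ∈ (chartAt (EuclideanSpace ℝ (Fin n)) p).source then (chartEquiv h).symm.toLinearMap
    else 0
  LinearMap.toContinuousLinearMap (LinearMap.toContinuousLinearMap.toLinearMap ∘ₗ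
    LinearMap.mk₂ ℝ (fun a b => (g.inner q (J a) (J b) : ℝ)) (by simp) (by simp) (by simp)
      (by simp))

theorem chartMetric_apply (g : SmoothMetric n M) {p q : M}
    (hq : q ∈ (chartAt (EuclideanSpace ℝ (Fin n)) p).source) (v w : TangentSpace (𝓡 n) q) :
    chartMetric g p q (chartDeriv n p q v) (chartDeriv n p q w) = g.inner q v w := by
  simp only [chartMetric, dif_pos hq]
  change g.inner q ((chartEquiv hq).symm (chartEquiv hq v)) ((chartEquiv hq).symm (chartEquiv hq w))
    = g.inner q v w
  rw [LinearEquiv.symm_apply_apply, LinearEquiv.symm_apply_apply]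

theorem contMDiffAt_chartMetric (g : SmoothMetric n M) {p q : M}
    (hq : q ∈ (chartAt (EuclideanSpace ℝ (Fin n)) p).source) (a b : EuclideanSpace ℝ (Fin n)) :
    ContMDiffAt (𝓡 n) 𝓘(ℝ, ℝ) ∞ (fun q => chartMetric g p q a b) q := by
  have hn : (chartAt (EuclideanSpace ℝ (Fin n)) p).source ∈ 𝓝 q :=
    (chartAt (EuclideanSpace ℝ (Fin n)) p).open_source.mem_nhds hq
  have h (c : EuclideanSpace ℝ (Fin n)) : ContMDiffAt (𝓡 n) (𝓡 n).tangent ∞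
      (fun q => (⟨q, ofCoordinates p (fun _ => c) q⟩ : TangentBundle (𝓡 n) M)) q := by
    refine (contMDiffAt_vectorField_iff hq).2
      ((contMDiffAt_const (c := c)).congr_of_eventuallyEq ?_)
    filter_upwards [hn] with q' hq' using chartDeriv_ofCoordinates _ hq'
  have h1 := (g.contMDiff.contMDiffAt (x := q)).clm_bundle_apply₂
    (F₃ := ℝ) (E₃ := Bundle.Trivial M ℝ) (h a) (h b)
  rw [Bundle.contMDiffAt_totalSpace] at h1
  refine h1.2.congr_of_eventuallyEq ?_
  filter_upwards [hn] with q' hq'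
  have h2 := chartMetric_apply g hq' (ofCoordinates p (fun _ => a) q')
    (ofCoordinates p (fun _ => b) q')
  rw [chartDeriv_ofCoordinates _ hq', chartDeriv_ofCoordinates _ hq'] at h2
  exact h2

theorem contDiffOn_chartMetric (g : SmoothMetric n M) (p : M) :
    ContDiffOn ℝ ∞ (chartMetric g p ∘ (extChartAt (𝓡 n) p).symm) (extChartAt (𝓡 n) p).target := by
  refine contDiffOn_clm_apply.2 fun a => contDiffOn_clm_apply.2 fun b => ?_
  intro ξ hξ
  have hs := (extChartAt (𝓡 n) p).map_target hξ
  have h1 := contDiffAt_chart hs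
    (contMDiffAt_chartMetric g (by rwa [extChartAt_source] at hs) a b)
  rw [(extChartAt (𝓡 n) p).right_inv hξ] at h1
  exact h1.contDiffWithinAt

theorem chartMetric_pos (g : SmoothMetric n M) {p q : M}
    (hq : q ∈ (chartAt (EuclideanSpace ℝ (Fin n)) p).source) {a : EuclideanSpace ℝ (Fin n)}
    (ha : a ≠ 0) : 0 < chartMetric g p q a a := by
  obtain ⟨v, rfl⟩ := (chartDeriv_bijective hq).2 a
  rw [chartMetric_apply g hq]
  exact g.pos q v (by rintro rfl; exact ha (map_zero _))

theorem chartMetric_symm (g : SmoothMetric n M) {p q : M}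
    (hq : q ∈ (chartAt (EuclideanSpace ℝ (Fin n)) p).source) (a b : EuclideanSpace ℝ (Fin n)) :
    chartMetric g p q a b = chartMetric g p q b a := by
  obtain ⟨v, rfl⟩ := (chartDeriv_bijective hq).2 a
  obtain ⟨w, rfl⟩ := (chartDeriv_bijective hq).2 b
  rw [chartMetric_apply g hq, chartMetric_apply g hq]
  exact g.symm q v w

theorem isInvertible_chartMetric (g : SmoothMetric n M) {p q : M}
    (hq : q ∈ (chartAt (EuclideanSpace ℝ (Fin n)) p).source) :
    (chartMetric g p q).IsInvertible := by
  have hinj : Function.Injective (chartMetric g p q).toLinearMap := by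
    rw [injective_iff_map_eq_zero]
    intro a ha
    by_contra h
    have h1 := chartMetric_pos g hq h
    have h2 : chartMetric g p q a = 0 := ha
    rw [h2] at h1
    exact lt_irrefl _ h1
  have hfr : finrank ℝ (EuclideanSpace ℝ (Fin n)) =
      finrank ℝ (EuclideanSpace ℝ (Fin n) →L[ℝ] ℝ) := by
    rw [← (LinearMap.toContinuousLinearMap :
      (EuclideanSpace ℝ (Fin n) →ₗ[ℝ] ℝ) ≃ₗ[ℝ] _).finrank_eq]
    exact (Subspace.dual_finrank_eq (K := ℝ) (V := EuclideanSpace ℝ (Fin n))).symm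
  exact ⟨(LinearEquiv.ofInjectiveOfFinrankEq _ hinj hfr).toContinuousLinearEquiv,
    ContinuousLinearMap.ext fun v => rfl⟩

variable {f : M → ℝ}

/-- In a chart the gradient solves the linear equation `g (-∇f) = -df`; inverting `g` gives the
smoothness of the gradient field. -/
theorem chartMetric_grad (hf : ContMDiff (𝓡 n) 𝓘(ℝ, ℝ) ∞ f) (g : SmoothMetric n M) {p q : M}
    (hq : q ∈ (chartAt (EuclideanSpace ℝ (Fin n)) p).source) :
    chartMetric g p q (chartDeriv n p q (-grad g f q)) = -chartFDeriv n p f q := by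
  ext a
  obtain ⟨v, rfl⟩ := (chartDeriv_bijective hq).2 a
  rw [chartMetric_apply g hq]
  change _ = -(chartFDeriv n p f q (chartDeriv n p q v))
  rw [← mfderiv_eq_chartFDeriv (by rwa [extChartAt_source]) hf.contMDiffAt, ← inner_grad g f q v]
  rw [map_neg]
  rfl

theorem contMDiff_neg_grad (hf : ContMDiff (𝓡 n) 𝓘(ℝ, ℝ) ∞ f) (g : SmoothMetric n M) :
    ContMDiff (𝓡 n) (𝓡 n).tangent ∞
      (fun q => (⟨q, -grad g f q⟩ : TangentBundle (𝓡 n) M)) := by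
  intro p
  have hp := mem_extChartAt_source (I := 𝓡 n) p
  rw [contMDiffAt_vectorField_iff (mem_chart_source _ p)]
  set φ := extChartAt (𝓡 n) p with hφ
  have hG : ContDiffAt ℝ ∞ (chartMetric g p ∘ φ.symm) (φ p) :=
    (contDiffOn_chartMetric g p).contDiffAt
      ((isOpen_extChartAt_target p).mem_nhds (φ.map_source hp))
  have hD : ContDiffAt ℝ ∞ (fun ξ => -fderiv ℝ (f ∘ φ.symm) ξ) (φ p) :=
    ((contDiffAt_chart hp hf.contMDiffAt).fderiv_right (m := ∞) (by simp)).neg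
  have hinv : ContDiffAt ℝ ∞ ContinuousLinearMap.inverse ((chartMetric g p ∘ φ.symm) (φ p)) := by
    rw [Function.comp_apply, φ.left_inv hp]
    exact (isInvertible_chartMetric g (mem_chart_source _ p)).contDiffAt_map_inverse
  have h1 := (hinv.comp (φ p) hG).clm_apply hD
  have h2 := h1.contMDiffAt.comp p (contMDiffAt_extChartAt (I := 𝓡 n) (x := p) (n := ∞))
  refine h2.congr_of_eventuallyEq ?_
  filter_upwards [chart_source_mem_nhds (EuclideanSpace ℝ (Fin n)) p] with q hq
  have h3 : φ.symm (φ q) = q := φ.left_inv (by rwa [hφ, extChartAt_source])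
  obtain ⟨e, he⟩ := isInvertible_chartMetric g hq
  have h4 := chartMetric_grad hf g hq
  simp only [Function.comp_apply, h3]
  change _ = (chartMetric g p q).inverse (-chartFDeriv n p f q)
  rw [← h4, ← he, ContinuousLinearMap.inverse_equiv]
  exact (e.symm_apply_apply _).symm

theorem grad_eq_zero_iff (g : SmoothMetric n M) {p : M} : grad g f p = 0 ↔ p ∈ Crit n f := by
  constructor
  · intro h
    refine ContinuousLinearMap.ext fun w => ?_
    rw [← inner_grad g f p w, h]
    simp
    rfl
  · intro hx
    by_contra h
    have h1 := g.pos p _ h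
    rw [inner_grad, show mfderiv (𝓡 n) 𝓘(ℝ, ℝ) f p = 0 from hx] at h1
    exact lt_irrefl _ h1

/-- At a nondegenerate critical point, the linearization of the negative gradient field, being
self-adjoint for the metric, is diagonalizable, and its eigenvalues are not zero. -/
theorem exists_eigenbasis_neg_grad (hf : ContMDiff (𝓡 n) 𝓘(ℝ, ℝ) ∞ f) (hM : IsMorse n f)
    (g : SmoothMetric n M) {y : M} (hy : y ∈ Crit n f) :
    ∃ (b : Basis (Fin n) ℝ (EuclideanSpace ℝ (Fin n))) (l : Fin n → ℝ), (∀ i, l i ≠ 0) ∧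
      ∀ i, fderiv ℝ (chartField y fun q => -grad g f q) (extChartAt (𝓡 n) y y) (b i) =
        l i • b i := by
  have hp := mem_extChartAt_source (I := 𝓡 n) y
  have hc := mem_chart_source (EuclideanSpace ℝ (Fin n)) y
  set φ := extChartAt (𝓡 n) y with hφ
  set X := chartField y fun q => -grad g f q with hX
  have htm : φ.target ∈ 𝓝 (φ y) := (isOpen_extChartAt_target y).mem_nhds (φ.map_source hp)
  have hG : DifferentiableAt ℝ (chartMetric g y ∘ φ.symm) (φ y) :=
    ((contDiffOn_chartMetric g y).contDiffAt htm).differentiableAt (by simp)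
  have hXd : DifferentiableAt ℝ X (φ y) :=
    ((contDiffOn_chartField (contMDiff_neg_grad hf g) y).contDiffAt htm).differentiableAt (by simp)
  have hf2 : ContDiffAt ℝ ∞ (f ∘ φ.symm) (φ y) := contDiffAt_chart hp hf.contMDiffAt
  have hD : DifferentiableAt ℝ (fderiv ℝ (f ∘ φ.symm)) (φ y) :=
    (hf2.fderiv_right (m := ∞) (by simp)).differentiableAt (by simp)
  have hX0 : X (φ y) = 0 := by
    simp only [hX, chartField]
    rw [← hφ, φ.left_inv hp, (grad_eq_zero_iff g).2 hy, neg_zero, map_zero]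
  have heq : (fun ξ => (chartMetric g y ∘ φ.symm) ξ (X ξ)) =ᶠ[𝓝 (φ y)]
      fun ξ => -fderiv ℝ (f ∘ φ.symm) ξ := by
    filter_upwards [htm] with ξ hξ
    have h1 := chartMetric_grad hf g (p := y) (q := φ.symm ξ)
      (by have := φ.map_target hξ; rwa [hφ, extChartAt_source] at this)
    rw [chartFDeriv, ← hφ, φ.right_inv hξ] at h1
    exact h1
  -- differentiating `g (X) = -df` at a zero of `X` shows that `g (X' v, w)` is minus the Hessian,
  -- which is symmetric
  have hGX : ∀ v w, chartMetric g y y (fderiv ℝ X (φ y) v) w =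
      -fderiv ℝ (fderiv ℝ (f ∘ φ.symm)) (φ y) v w := by
    intro v w
    have h1 := hG.hasFDerivAt.clm_apply hXd.hasFDerivAt
    have h2 := h1.unique (hD.hasFDerivAt.neg.congr_of_eventuallyEq heq)
    have h3 := congrArg (fun l : EuclideanSpace ℝ (Fin n) →L[ℝ] EuclideanSpace ℝ (Fin n) →L[ℝ] ℝ =>
      l v w) h2
    simpa [hX0, φ.left_inv hp] using h3
  have hsymm : ∀ v w, fderiv ℝ (fderiv ℝ (f ∘ φ.symm)) (φ y) v w =
      fderiv ℝ (fderiv ℝ (f ∘ φ.symm)) (φ y) w v := fun v w =>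
    (hf2.isSymmSndFDerivAt (by
      simpa using show ((2 : ℕ∞) : WithTop ℕ∞) ≤ ∞ from mod_cast le_top)).eq v w
  let B : EuclideanSpace ℝ (Fin n) →ₗ[ℝ] EuclideanSpace ℝ (Fin n) →ₗ[ℝ] ℝ :=
    LinearMap.mk₂ ℝ (fun a b => chartMetric g y y a b) (by simp) (by simp) (by simp) (by simp)
  obtain ⟨b, l, hl⟩ := exists_eigenbasis (n := n) (by simp) B
    (chartMetric_symm g hc) (fun v hv => chartMetric_pos g hc hv)
    (fderiv ℝ X (φ y)).toLinearMap (fun v w => by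
      change chartMetric g y y (fderiv ℝ X (φ y) v) w = chartMetric g y y v (fderiv ℝ X (φ y) w)
      rw [chartMetric_symm g hc v, hGX, hGX, hsymm])
  have hl' : ∀ i, fderiv ℝ X (φ y) (b i) = l i • b i := hl
  refine ⟨b, l, fun i hi => ?_, hl'⟩
  refine b.ne_zero i (hM y hy (b i) fun w => ?_)
  have h1 := hGX (b i) w
  rw [hl', hi, zero_smul, map_zero] at h1
  exact neg_eq_zero.1 h1.symm

end Gradient

/-! ### The flow of a vector field on a closed manifold -/

section Flow

variable {n : ℕ} {M : Type*} [TopologicalSpace M] [ChartedSpace (EuclideanSpace ℝ (Fin n)) M]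
  [IsManifold (𝓡 n) ∞ M] {V : ∀ q : M, TangentSpace (𝓡 n) q}

/-- A solution of the differential equation in a chart is an integral curve. -/
theorem hasMFDerivAt_of_hasDerivAt_chart {p : M} {σ : ℝ → EuclideanSpace ℝ (Fin n)} {t : ℝ}
    (ht : σ t ∈ (extChartAt (𝓡 n) p).target) (hσ : HasDerivAt σ (chartField p V (σ t)) t) :
    HasMFDerivAt 𝓘(ℝ, ℝ) (𝓡 n) ((extChartAt (𝓡 n) p).symm ∘ σ) t
      ((1 : ℝ →L[ℝ] ℝ).smulRight (V ((extChartAt (𝓡 n) p).symm (σ t)))) := by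
  set φ := extChartAt (𝓡 n) p with hφ
  have hs : φ.symm (σ t) ∈ φ.source := φ.map_target ht
  have hs' : φ.symm (σ t) ∈ (chartAt (EuclideanSpace ℝ (Fin n)) p).source := by
    rwa [hφ, extChartAt_source] at hs
  have hsm : ContMDiffAt 𝓘(ℝ, EuclideanSpace ℝ (Fin n)) (𝓡 n) ∞ φ.symm (σ t) :=
    (contMDiffOn_extChartAt_symm p).contMDiffAt ((isOpen_extChartAt_target p).mem_nhds ht)
  have hγ : HasMFDerivAt 𝓘(ℝ, ℝ) (𝓡 n) (φ.symm ∘ σ) t _ :=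
    (hsm.mdifferentiableAt (by simp)).hasMFDerivAt.comp t hσ.hasFDerivAt.hasMFDerivAt
  have hev : ∀ᶠ s in 𝓝 t, σ s ∈ φ.target :=
    hσ.continuousAt.eventually ((isOpen_extChartAt_target p).mem_nhds ht)
  have h1 : HasMFDerivAt (𝓡 n) 𝓘(ℝ, EuclideanSpace ℝ (Fin n)) φ ((φ.symm ∘ σ) t)
      (chartDeriv n p ((φ.symm ∘ σ) t)) := (mdifferentiableAt_extChartAt hs').hasMFDerivAt
  have h2 := h1.comp t hγ
  have h3 : HasMFDerivAt 𝓘(ℝ, ℝ) 𝓘(ℝ, EuclideanSpace ℝ (Fin n)) (φ ∘ (φ.symm ∘ σ)) t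
      ((1 : ℝ →L[ℝ] ℝ).smulRight (chartField p V (σ t))) := by
    refine hσ.hasFDerivAt.hasMFDerivAt.congr_of_eventuallyEq ?_
    filter_upwards [hev] with s hs
    exact φ.right_inv hs
  have h4 := hasMFDerivAt_unique h2 h3
  refine hγ.congr_mfderiv (ContinuousLinearMap.ext fun a => (chartDeriv_bijective hs').1 ?_)
  refine (congrArg (fun l : ℝ →L[ℝ] EuclideanSpace ℝ (Fin n) => l a) h4).trans ?_
  exact ((chartDeriv n p (φ.symm (σ t))).map_smul (a : ℝ) (V (φ.symm (σ t)))).symm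

variable
  (hV : ContMDiff (𝓡 n) (𝓡 n).tangent ∞ (fun q => (⟨q, V q⟩ : TangentBundle (𝓡 n) M)))
include hV

/-- The local flow in a chart. The coordinates of the field are first replaced by a globally smooth
field that agrees with them near the point. -/
theorem exists_chart_flow (p : M) : ∃ (δ : ℝ) (U : Set (EuclideanSpace ℝ (Fin n)))
    (Φ : ℝ → EuclideanSpace ℝ (Fin n) → EuclideanSpace ℝ (Fin n)), 0 < δ ∧ IsOpen U ∧
      extChartAt (𝓡 n) p p ∈ U ∧ (∀ t ∈ Ioo (-δ) δ, ContDiffOn ℝ ∞ (Φ t) U) ∧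
      (∀ ξ ∈ U, Φ 0 ξ = ξ) ∧ (∀ ξ ∈ U, ∀ t ∈ Ioo (-δ) δ, Φ t ξ ∈ (extChartAt (𝓡 n) p).target) ∧
      (∀ ξ ∈ U, IsMIntegralCurveOn (fun t => (extChartAt (𝓡 n) p).symm (Φ t ξ)) V (Ioo (-δ) δ)) ∧
      (V p = 0 → (∀ N ∈ 𝓝 (extChartAt (𝓡 n) p p), ∀ᶠ ξ in 𝓝 (extChartAt (𝓡 n) p p),
          ∀ t ∈ Ioo (-δ) δ, Φ t ξ ∈ N) ∧
        ∀ (c : ℝ) (e : EuclideanSpace ℝ (Fin n)),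
          fderiv ℝ (chartField p V) (extChartAt (𝓡 n) p p) e = c • e →
          ∀ t ∈ Ioo (-δ) δ, fderiv ℝ (Φ t) (extChartAt (𝓡 n) p p) e = Real.exp (c * t) • e) := by
  have hp := mem_extChartAt_source (I := 𝓡 n) p
  set φ := extChartAt (𝓡 n) p with hφ
  have htm : φ.target ∈ 𝓝 (φ p) := (isOpen_extChartAt_target p).mem_nhds (φ.map_source hp)
  obtain ⟨X, hX, hXe⟩ := exists_contDiff_eventuallyEq htm (contDiffOn_chartField hV p)
  obtain ⟨δ, U, Φ, hδ, hU, hpU, hsm, h0, hW, hder, hz⟩ :=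
    exists_local_flow hX (φ p) (inter_mem htm hXe)
  refine ⟨δ, U, Φ, hδ, hU, hpU, hsm, h0, fun ξ hξ t ht => (hW ξ hξ t ht).1, ?_, ?_⟩
  · intro ξ hξ t ht
    have h1 := hder ξ hξ t ht
    have h2 : X (Φ t ξ) = chartField p V (Φ t ξ) := (hW ξ hξ t ht).2
    rw [h2] at h1
    exact (hasMFDerivAt_of_hasDerivAt_chart (σ := fun t => Φ t ξ)
      (hW ξ hξ t ht).1 h1).hasMFDerivWithinAt
  · intro hVp
    have hX0 : X (φ p) = 0 := by
      rw [hXe.self_of_nhds, chartField, ← hφ, φ.left_inv hp, hVp, map_zero]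
    refine ⟨(hz hX0).1, fun c e hc => (hz hX0).2 c e ?_⟩
    rw [hXe.fderiv_eq, hc]

/-- The flow of a smooth vector field on a closed manifold. The clauses are: the orbits are integral
curves, they are the only ones, the flow is a one-parameter group, the time-`t` maps are smooth for
small `t`, and at a zero of the field the flow is stable for small times and linearizes on
eigenvectors as the exponential. -/
theorem exists_flow [T2Space M] [CompactSpace M] : ∃ θ : ℝ → M → M,
    (∀ q, IsMIntegralCurve (I := 𝓡 n) (fun t => θ t q) V ∧ θ 0 q = q) ∧
    (∀ (γ : ℝ → M), IsMIntegralCurve (I := 𝓡 n) γ V → ∀ t, γ t = θ t (γ 0)) ∧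
    (∀ s t q, θ (s + t) q = θ s (θ t q)) ∧
    (∃ ε > 0, ∀ t ∈ Ioo (-ε) ε, ContMDiff (𝓡 n) (𝓡 n) ∞ (θ t)) ∧
    ∀ p, V p = 0 → ∃ δ > 0, (∀ N ∈ 𝓝 p, ∀ᶠ q in 𝓝 p, ∀ t ∈ Ioo (-δ) δ, θ t q ∈ N) ∧
      ∀ (c : ℝ) (e : EuclideanSpace ℝ (Fin n)),
        fderiv ℝ (chartField p V) (extChartAt (𝓡 n) p p) e = c • e → ∀ t ∈ Ioo (-δ) δ,
          fderiv ℝ (extChartAt (𝓡 n) p ∘ θ t ∘ (extChartAt (𝓡 n) p).symm)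
            (extChartAt (𝓡 n) p p) e = Real.exp (c * t) • e := by
  choose δ U Φ hδ hU hpU hsm h0 htgt hint hz using fun p => exists_chart_flow hV p
  have hV1 : ContMDiff (𝓡 n) (𝓡 n).tangent 1
      (fun q => (⟨q, V q⟩ : TangentBundle (𝓡 n) M)) := hV.of_le (by simp)
  have hn : ∀ p : M, {q | q ∈ (extChartAt (𝓡 n) p).source ∧ extChartAt (𝓡 n) p q ∈ U p} ∈ 𝓝 p :=
    fun p => inter_mem (extChartAt_source_mem_nhds p)
      ((continuousAt_extChartAt (I := 𝓡 n) p).eventually ((hU p).mem_nhds (hpU p)))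
  -- finitely many of these neighbourhoods cover the manifold
  obtain ⟨T, -, hT⟩ := isCompact_univ.elim_nhds_subcover _ fun p _ => hn p
  obtain ⟨ε, hε, hεT⟩ : ∃ ε > 0, ∀ p ∈ T, ε ≤ δ p := by
    rcases T.eq_empty_or_nonempty with rfl | hne
    · exact ⟨1, one_pos, by simp⟩
    · exact ⟨T.inf' hne δ, (Finset.lt_inf'_iff _).2 fun p _ => hδ p,
        fun p hp => Finset.inf'_le _ hp⟩
  have hcov : ∀ q : M, ∃ p ∈ T, q ∈ (extChartAt (𝓡 n) p).source ∧ extChartAt (𝓡 n) p q ∈ U p := by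
    intro q
    obtain ⟨p, hp⟩ := mem_iUnion.1 (hT (mem_univ q))
    obtain ⟨hpT, hq⟩ := mem_iUnion.1 hp
    exact ⟨p, hpT, hq⟩
  choose θ' hθ0 hθ using exists_isMIntegralCurve_of_isMIntegralCurveOn hV1 hε fun q => by
    obtain ⟨p, hpT, hq, hqU⟩ := hcov q
    refine ⟨fun t => (extChartAt (𝓡 n) p).symm (Φ p t (extChartAt (𝓡 n) p q)), ?_,
      (hint p _ hqU).mono (Ioo_subset_Ioo (neg_le_neg (hεT p hpT)) (hεT p hpT))⟩
    change (extChartAt (𝓡 n) p).symm (Φ p 0 (extChartAt (𝓡 n) p q)) = q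
    rw [h0 p _ hqU, (extChartAt (𝓡 n) p).left_inv hq]
  have huniq : ∀ (γ : ℝ → M), IsMIntegralCurve (I := 𝓡 n) γ V → ∀ t, γ t = θ' (γ 0) t := by
    intro γ hγ t
    exact congrFun (isMIntegralCurve_Ioo_eq_of_contMDiff_boundaryless (t₀ := 0) hV1 hγ (hθ _)
      (hθ0 _).symm) t
  have hloc : ∀ p q, q ∈ (extChartAt (𝓡 n) p).source → extChartAt (𝓡 n) p q ∈ U p →
      ∀ t ∈ Ioo (-δ p) (δ p),
        θ' q t = (extChartAt (𝓡 n) p).symm (Φ p t (extChartAt (𝓡 n) p q)) := by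
    intro p q hq hqU t ht
    refine isMIntegralCurveOn_Ioo_eqOn_of_contMDiff_boundaryless (t₀ := 0)
      ⟨neg_lt_zero.2 (hδ p), hδ p⟩ hV1 ((hθ q).isMIntegralCurveOn _) (hint p _ hqU) ?_ ht
    rw [hθ0, h0 p _ hqU, (extChartAt (𝓡 n) p).left_inv hq]
  refine ⟨fun t q => θ' q t, fun q => ⟨hθ q, hθ0 q⟩, huniq, ?_, ⟨ε, hε, ?_⟩, ?_⟩
  · intro s t q
    have h1 := huniq _ ((hθ q).comp_add t) s
    simpa using h1
  · intro t ht q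
    obtain ⟨p, hpT, hq, hqU⟩ := hcov q
    have ht' : t ∈ Ioo (-δ p) (δ p) :=
      Ioo_subset_Ioo (neg_le_neg (hεT p hpT)) (hεT p hpT) ht
    have h1 : ContMDiffAt (𝓡 n) 𝓘(ℝ, EuclideanSpace ℝ (Fin n)) ∞ (extChartAt (𝓡 n) p) q :=
      contMDiffAt_extChartAt' (by rwa [extChartAt_source] at hq)
    have h2 : ContMDiffAt (𝓡 n) 𝓘(ℝ, EuclideanSpace ℝ (Fin n)) ∞
        (Φ p t ∘ extChartAt (𝓡 n) p) q :=
      ((hsm p t ht').contDiffAt ((hU p).mem_nhds hqU)).contMDiffAt.comp q h1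
    have h3 : ContMDiffAt (𝓡 n) (𝓡 n) ∞
        ((extChartAt (𝓡 n) p).symm ∘ (Φ p t ∘ extChartAt (𝓡 n) p)) q :=
      ((contMDiffOn_extChartAt_symm p).contMDiffAt
        ((isOpen_extChartAt_target p).mem_nhds (htgt p _ hqU t ht'))).comp q h2
    refine h3.congr_of_eventuallyEq ?_
    filter_upwards [(isOpen_extChartAt_source (I := 𝓡 n) p).mem_nhds hq,
      h1.continuousAt.eventually ((hU p).mem_nhds hqU)] with q' hq' hqU'
    exact hloc p q' hq' hqU' t ht'
  · intro p hVp
    obtain ⟨hz1, hz2⟩ := hz p hVp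
    have hp := mem_extChartAt_source (I := 𝓡 n) p
    refine ⟨δ p, hδ p, fun N hN => ?_, fun c e hc t ht => ?_⟩
    · have h1 : Tendsto (extChartAt (𝓡 n) p).symm (𝓝 (extChartAt (𝓡 n) p p)) (𝓝 p) := by
        have := continuousAt_extChartAt_symm (I := 𝓡 n) p
        rwa [ContinuousAt, (extChartAt (𝓡 n) p).left_inv hp] at this
      filter_upwards [hn p, (continuousAt_extChartAt (I := 𝓡 n) p).eventually (hz1 _ (h1 hN))]
        with q hq hq2 t ht
      rw [hloc p q hq.1 hq.2 t ht]
      exact hq2 t ht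
    · rw [← hz2 c e hc t ht]
      have h1 : extChartAt (𝓡 n) p ∘ (fun q => θ' q t) ∘ (extChartAt (𝓡 n) p).symm
          =ᶠ[𝓝 (extChartAt (𝓡 n) p p)] Φ p t := by
        filter_upwards [(hU p).mem_nhds (hpU p), (isOpen_extChartAt_target (I := 𝓡 n) p).mem_nhds
          ((extChartAt (𝓡 n) p).map_source hp)] with ξ hξ hξt
        have h2 := (extChartAt (𝓡 n) p).right_inv hξt
        simp only [Function.comp_apply]
        rw [hloc p _ ((extChartAt (𝓡 n) p).map_target hξt) (by rwa [h2]) t ht, h2,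
          (extChartAt (𝓡 n) p).right_inv (htgt p ξ hξ t ht)]
      rw [h1.fderiv_eq]

end Flow

/-! ### Orbits of the gradient flow near a critical point -/

section GradientFlow

variable {n : ℕ} {M : Type*} [TopologicalSpace M] [ChartedSpace (EuclideanSpace ℝ (Fin n)) M]
  [IsManifold (𝓡 n) ∞ M]

/-- `θ` is the flow of the negative gradient field of `f`. Smoothness is required only of the
time-`t` maps with small `t`. The last field expresses that points near a critical point stay near
it for small times, and that the derivative there of the time-`t` map is the exponential of `t`
times the linearization of the field, as far as eigenvectors are concerned. -/
structure IsGradientFlow (g : SmoothMetric n M) (f : M → ℝ) (θ : ℝ → M → M) : Prop where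
  integralCurve : ∀ q, IsMIntegralCurve (I := 𝓡 n) (fun t => θ t q) fun p => -grad g f p
  zero_apply : ∀ q, θ 0 q = q
  unique : ∀ γ : ℝ → M, IsMIntegralCurve (I := 𝓡 n) γ (fun p => -grad g f p) →
    ∀ t, γ t = θ t (γ 0)
  add_apply : ∀ s t q, θ (s + t) q = θ s (θ t q)
  smooth : ∃ ε > 0, ∀ t ∈ Ioo (-ε) ε, ContMDiff (𝓡 n) (𝓡 n) ∞ (θ t)
  linearization : ∀ p ∈ Crit n f, ∃ δ > 0,
    (∀ N ∈ 𝓝 p, ∀ᶠ q in 𝓝 p, ∀ t ∈ Ioo (-δ) δ, θ t q ∈ N) ∧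
      ∀ (c : ℝ) (e : EuclideanSpace ℝ (Fin n)),
        fderiv ℝ (chartField p fun q => -grad g f q) (extChartAt (𝓡 n) p p) e = c • e →
        ∀ t ∈ Ioo (-δ) δ, fderiv ℝ (extChartAt (𝓡 n) p ∘ θ t ∘ (extChartAt (𝓡 n) p).symm)
            (extChartAt (𝓡 n) p p) e = Real.exp (c * t) • e

theorem exists_isGradientFlow [T2Space M] [CompactSpace M] {f : M → ℝ}
    (hf : ContMDiff (𝓡 n) 𝓘(ℝ, ℝ) ∞ f) (g : SmoothMetric n M) :
    ∃ θ : ℝ → M → M, IsGradientFlow g f θ := by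
  obtain ⟨θ, h1, h2, h3, h4, h5⟩ := exists_flow (contMDiff_neg_grad hf g)
  exact ⟨θ, fun q => (h1 q).1, fun q => (h1 q).2, h2, h3, h4, fun p hp =>
    h5 p (by rw [(grad_eq_zero_iff g).2 hp, neg_zero])⟩

namespace IsGradientFlow

variable {g : SmoothMetric n M} {f : M → ℝ} {θ : ℝ → M → M} (h : IsGradientFlow g f θ)
include h

theorem isTrajectory_iff {q : M} {γ : ℝ → M} : IsTrajectory g f q γ ↔ γ = fun t => θ t q := by
  constructor
  · rintro ⟨h1, rfl⟩
    exact funext (h.unique γ h1)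
  · rintro rfl
    exact ⟨h.integralCurve q, h.zero_apply q⟩

theorem mem_stable_iff {y q : M} : q ∈ stable g f y ↔ omegaLimitSet (fun t => θ t q) = {y} := by
  constructor
  · rintro ⟨γ, hγ, hω⟩
    rwa [h.isTrajectory_iff.1 hγ] at hω
  · exact fun hω => ⟨_, h.isTrajectory_iff.2 rfl, hω⟩

theorem apply_of_mem_crit {y : M} (hy : y ∈ Crit n f) (t : ℝ) : θ t y = y :=
  congrFun (h.isTrajectory_iff.1 (isTrajectory_const g f hy)).symm t

theorem mem_crit_of_apply {q : M} {t : ℝ} (hq : θ t q ∈ Crit n f) : q ∈ Crit n f := by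
  have h1 := h.apply_of_mem_crit hq (-t)
  rw [← h.add_apply, neg_add_cancel, h.zero_apply] at h1
  rwa [h1]

theorem iterate (t : ℝ) (k : ℕ) (q : M) : (θ t)^[k] q = θ (k * t) q := by
  induction k with
  | zero => simp [h.zero_apply]
  | succ k ih =>
    rw [Function.iterate_succ_apply', ih, ← h.add_apply]
    congr 1
    push_cast
    ring

/-- Along an orbit `f` has derivative `-‖∇f‖²`. -/
theorem hasDerivAt (hf : ContMDiff (𝓡 n) 𝓘(ℝ, ℝ) ∞ f) (q : M) (t : ℝ) :
    HasDerivAt (fun t => f (θ t q))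
      (-(g.inner (θ t q) (grad g f (θ t q)) (grad g f (θ t q)))) t := by
  have h1 := (hf.mdifferentiableAt (by simp) (x := θ t q)).hasMFDerivAt.comp t (h.integralCurve q t)
  have h3 : (mfderiv (𝓡 n) 𝓘(ℝ, ℝ) f (θ t q) (-grad g f (θ t q)) : ℝ) =
      -(g.inner (θ t q) (grad g f (θ t q)) (grad g f (θ t q))) := by
    rw [map_neg, inner_grad]
    rfl
  obtain ⟨L, hL, hL1⟩ : ∃ L : ℝ →L[ℝ] ℝ, HasFDerivAt (fun t => f (θ t q)) L t ∧
      L 1 = -(g.inner (θ t q) (grad g f (θ t q)) (grad g f (θ t q))) :=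
    ⟨_, hasMFDerivAt_iff_hasFDerivAt.1 h1, (congrArg (mfderiv (𝓡 n) 𝓘(ℝ, ℝ) f (θ t q))
      (one_smul ℝ (-grad g f (θ t q)))).trans h3⟩
  exact hL.hasDerivAt.congr_deriv hL1

theorem antitone (hf : ContMDiff (𝓡 n) 𝓘(ℝ, ℝ) ∞ f) (q : M) : Antitone fun t => f (θ t q) := by
  refine antitone_of_deriv_nonpos (fun t => (h.hasDerivAt hf q t).differentiableAt) fun t => ?_
  rw [(h.hasDerivAt hf q t).deriv, neg_nonpos]
  by_cases h0 : grad g f (θ t q) = 0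
  · rw [h0]
    simp
  · exact (g.pos _ _ h0).le

theorem apply_lt (hf : ContMDiff (𝓡 n) 𝓘(ℝ, ℝ) ∞ f) {q : M} (hq : q ∉ Crit n f) {τ : ℝ}
    (hτ : 0 < τ) : f (θ τ q) < f q := by
  have h1 : StrictAnti fun t => f (θ t q) := strictAnti_of_deriv_neg fun t => by
    rw [(h.hasDerivAt hf q t).deriv, neg_lt_zero]
    exact g.pos _ _ fun h0 => hq (h.mem_crit_of_apply ((grad_eq_zero_iff g).1 h0))
  simpa [h.zero_apply] using h1 hτ

end IsGradientFlow

/-- A nondegenerate critical point is isolated. -/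
theorem eventually_eq_of_mem_crit {f : M → ℝ} (hf : ContMDiff (𝓡 n) 𝓘(ℝ, ℝ) ∞ f) (hM : IsMorse n f)
    {y : M} (hy : y ∈ Crit n f) : ∀ᶠ q in 𝓝 y, q ∈ Crit n f → q = y := by
  have hp := mem_extChartAt_source (I := 𝓡 n) y
  set φ := extChartAt (𝓡 n) y with hφ
  have hf2 : ContDiffAt ℝ ∞ (f ∘ φ.symm) (φ y) := contDiffAt_chart hp hf.contMDiffAt
  have hD : HasFDerivAt (fderiv ℝ (f ∘ φ.symm)) _ (φ y) :=
    ((hf2.fderiv_right (m := ∞) (by simp)).differentiableAt (by simp)).hasFDerivAt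
  have hker : LinearMap.ker (fderiv ℝ (fderiv ℝ (f ∘ φ.symm)) (φ y)).toLinearMap = ⊥ := by
    refine LinearMap.ker_eq_bot'.2 fun v hv => hM y hy v fun w => ?_
    exact congrArg (fun l : EuclideanSpace ℝ (Fin n) →L[ℝ] ℝ => l w) hv
  obtain ⟨K, -, hK⟩ := LinearMap.exists_antilipschitzWith _ hker
  have h1 := hD.eventually_ne (c := 0) ⟨K, hK⟩
  have hcrit : ∀ q ∈ φ.source, q ∈ Crit n f → fderiv ℝ (f ∘ φ.symm) (φ q) = 0 := by
    intro q hq hqc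
    ext a
    obtain ⟨v, rfl⟩ := (chartDeriv_bijective (p := y) (q := q)
      (by rwa [hφ, extChartAt_source] at hq)).2 a
    have h2 := mfderiv_eq_chartFDeriv hq hf.contMDiffAt v
    rw [show mfderiv (𝓡 n) 𝓘(ℝ, ℝ) f q = 0 from hqc] at h2
    exact h2.symm
  have h3 := (continuousAt_extChartAt (I := 𝓡 n) y).eventually (eventually_nhdsWithin_iff.1 h1)
  filter_upwards [h3, extChartAt_source_mem_nhds (I := 𝓡 n) y] with q hq hqs hqc
  by_contra hne
  exact hq (fun h4 => hne (φ.injOn hqs hp h4)) (hcrit q hqs hqc)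

section Compact

variable [T2Space M] [CompactSpace M]

omit [ChartedSpace (EuclideanSpace ℝ (Fin n)) M] [IsManifold (𝓡 n) ∞ M] [T2Space M] in
/-- A sequence in a compact set converges to `y` if `y` is the only possible limit of its
subsequences. -/
theorem tendsto_of_unique_limit [FirstCountableTopology M] {x : ℕ → M} {y : M} {B : Set M}
    (hB : IsClosed B) (hxB : ∀ k, x k ∈ B)
    (hx : ∀ (u : ℕ → ℕ) (z : M), z ∈ B → Tendsto u atTop atTop →
      Tendsto (fun k => x (u k)) atTop (𝓝 z) → z = y) : Tendsto x atTop (𝓝 y) := by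
  refine tendsto_of_subseq_tendsto fun u hu => ?_
  obtain ⟨z, hz, v, hv, hlim⟩ := hB.isCompact.tendsto_subseq fun k => hxB (u k)
  refine ⟨v, ?_⟩
  rwa [← hx (fun k => u (v k)) z hz (hu.comp hv.tendsto_atTop) hlim]

variable {g : SmoothMetric n M} {f : M → ℝ} {θ : ℝ → M → M} (h : IsGradientFlow g f θ)
include h

/-- A point lies in the stable manifold of `y` if and only if its orbit under the time `τ` map
converges to `y`. -/
theorem IsGradientFlow.mem_stable_iff_tendsto {y : M} {δ τ : ℝ} (hτ : 0 < τ) (hτδ : τ < δ)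
    (hδ : ∀ N ∈ 𝓝 y, ∀ᶠ q in 𝓝 y, ∀ t ∈ Ioo (-δ) δ, θ t q ∈ N) {q : M} :
    q ∈ stable g f y ↔ Tendsto (fun k => (θ τ)^[k] q) atTop (𝓝 y) := by
  have : SecondCountableTopology M :=
    ChartedSpace.secondCountable_of_sigmaCompact (EuclideanSpace ℝ (Fin n)) M
  have hmul : Tendsto (fun k : ℕ => (k : ℝ) * τ) atTop atTop :=
    tendsto_natCast_atTop_atTop.atTop_mul_const hτ
  rw [h.mem_stable_iff]
  simp only [h.iterate]
  constructor
  · intro hω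
    -- a limit point of the discrete orbit is a limit point of the trajectory
    refine tendsto_of_unique_limit isClosed_univ (fun _ => mem_univ _) fun u z _ hu hz => ?_
    have : z ∈ omegaLimitSet fun t => θ t q := ⟨_, hmul.comp hu, hz⟩
    rwa [hω] at this
  · intro hlim
    refine Subset.antisymm ?_ (singleton_subset_iff.2 ⟨_, hmul, hlim⟩)
    rintro p ⟨t, ht, hp⟩
    refine tendsto_nhds_unique hp fun N hN => ?_
    -- compare an arbitrary time with the largest multiple of `τ` below it
    have h1 : Tendsto (fun j => ⌊t j / τ⌋₊) atTop atTop :=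
      tendsto_nat_floor_atTop.comp (ht.atTop_div_const hτ)
    change ∀ᶠ j in atTop, θ (t j) q ∈ N
    filter_upwards [(hlim.comp h1).eventually (hδ N hN), ht.eventually_ge_atTop 0] with j hj ht0
    have h2 := Nat.floor_le (div_nonneg ht0 hτ.le)
    have h3 := Nat.lt_floor_add_one (t j / τ)
    rw [le_div_iff₀ hτ] at h2
    rw [div_lt_iff₀ hτ, add_mul, one_mul] at h3
    have h4 := hj (t j - ⌊t j / τ⌋₊ * τ) ⟨by linarith, by linarith⟩
    rwa [Function.comp_apply, ← h.add_apply, sub_add_cancel] at h4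

/-- A forward orbit which stays in a compact set without critical points besides `y` converges
to `y`, because `f` is constant on the set of its limit points. -/
theorem IsGradientFlow.tendsto_of_forall_mem (hf : ContMDiff (𝓡 n) 𝓘(ℝ, ℝ) ∞ f) {y : M} {τ : ℝ}
    (hτ : 0 < τ) (hc : Continuous (θ τ)) {B : Set M} (hB : IsClosed B)
    (hBc : ∀ q ∈ B, q ∈ Crit n f → q = y) {q : M} (hq : ∀ k, (θ τ)^[k] q ∈ B) :
    Tendsto (fun k => (θ τ)^[k] q) atTop (𝓝 y) := by
  have : SecondCountableTopology M :=
    ChartedSpace.secondCountable_of_sigmaCompact (EuclideanSpace ℝ (Fin n)) M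
  refine tendsto_of_unique_limit hB hq fun u z hzB hu hz => hBc z hzB ?_
  -- if the limit point `z` is not critical, then `f` takes a smaller value at `θ τ z`, although
  -- both values are the limit of `f` along the orbit
  by_contra hzc
  have hanti : Antitone fun k => f ((θ τ)^[k] q) := by
    intro k l hkl
    simp only [h.iterate]
    exact h.antitone hf q (mul_le_mul_of_nonneg_right (by exact_mod_cast hkl) hτ.le)
  have hbdd : BddBelow (range fun k => f ((θ τ)^[k] q)) :=
    (isCompact_univ.image hf.continuous).bddBelow.mono (by
      rintro _ ⟨k, rfl⟩
      exact ⟨_, mem_univ _, rfl⟩)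
  have h1 := tendsto_atTop_ciInf hanti hbdd
  have h2 := tendsto_nhds_unique (h1.comp hu) ((hf.continuous.tendsto z).comp hz)
  have h3 : Tendsto (fun k => f ((θ τ)^[u k + 1] q)) atTop (𝓝 (f (θ τ z))) := by
    simp only [Function.iterate_succ_apply']
    exact ((hf.continuous.comp hc).tendsto z).comp hz
  have h4 := tendsto_nhds_unique (h1.comp (tendsto_add_atTop_nat 1 |>.comp hu)) h3
  exact (h.apply_lt hf hzc hτ).ne (h4.symm.trans h2)

/-- Points of the stable manifold near `y` stay near `y` forever: the function `f` decreases by a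
fixed amount in each step outside a neighbourhood of `y`, and cannot drop below `f y`. -/
theorem IsGradientFlow.eventually_forall_mem (hf : ContMDiff (𝓡 n) 𝓘(ℝ, ℝ) ∞ f)
    (hM : IsMorse n f) {y : M} (hy : y ∈ Crit n f) {τ : ℝ} (hτ : 0 < τ) (hc : Continuous (θ τ))
    {N : Set M} (hN : N ∈ 𝓝 y) :
    ∀ᶠ q in 𝓝 y, Tendsto (fun k => (θ τ)^[k] q) atTop (𝓝 y) → ∀ k, (θ τ)^[k] q ∈ N := by
  obtain ⟨B, hBn, hB, hBs⟩ : ∃ B ∈ 𝓝 y, IsClosed B ∧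
      B ⊆ N ∩ {q | q ∈ Crit n f → q = y} :=
    exists_mem_nhds_isClosed_subset (inter_mem hN (eventually_eq_of_mem_crit hf hM hy))
  -- the compact set of points at which an orbit can leave the neighbourhood `B`
  set C := θ τ '' B \ interior B with hC
  have hCc : IsCompact C := (hB.isCompact.image hc).diff isOpen_interior
  have hψ : Continuous fun z => f z - f (θ τ z) :=
    hf.continuous.sub (hf.continuous.comp hc)
  obtain ⟨δ, hδ, hδC⟩ : ∃ δ > 0, ∀ z ∈ C, δ ≤ f z - f (θ τ z) := by
    rcases C.eq_empty_or_nonempty with h0 | hne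
    · exact ⟨1, one_pos, by simp [h0]⟩
    · obtain ⟨z, hz, hmin⟩ := hCc.exists_isMinOn hne hψ.continuousOn
      refine ⟨f z - f (θ τ z), sub_pos.2 (h.apply_lt hf ?_ hτ), fun w hw => hmin hw⟩
      intro hzc
      obtain ⟨⟨b, hb, rfl⟩, hz2⟩ := hz
      have hby : b = y := (hBs hb).2 (h.mem_crit_of_apply hzc)
      rw [hby, h.apply_of_mem_crit hy] at hz2
      exact hz2 (mem_interior_iff_mem_nhds.2 hBn)
  have hfy : ∀ᶠ q in 𝓝 y, f q < f y + δ :=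
    hf.continuous.continuousAt.eventually (gt_mem_nhds (lt_add_of_pos_right _ hδ))
  filter_upwards [hfy, interior_mem_nhds.2 hBn] with q hq hqB hlim
  have hanti : Antitone fun k => f ((θ τ)^[k] q) := by
    intro k l hkl
    simp only [h.iterate]
    exact h.antitone hf q (mul_le_mul_of_nonneg_right (by exact_mod_cast hkl) hτ.le)
  have hge : ∀ k, f y ≤ f ((θ τ)^[k] q) :=
    fun k => hanti.le_of_tendsto ((hf.continuous.tendsto y).comp hlim) k
  suffices ∀ k, (θ τ)^[k] q ∈ interior B from fun k => (hBs (interior_subset (this k))).1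
  intro k
  induction k with
  | zero => exact hqB
  | succ k ih =>
    by_contra hk
    have h1 : (θ τ)^[k + 1] q ∈ C := by
      refine ⟨?_, hk⟩
      rw [Function.iterate_succ_apply']
      exact mem_image_of_mem _ (interior_subset ih)
    have h2 := hδC _ h1
    rw [← Function.iterate_succ_apply' (θ τ)] at h2
    have h3 := hge (k + 1 + 1)
    have h4 : f ((θ τ)^[k + 1] q) ≤ f q := hanti (Nat.zero_le (k + 1))
    linarith

end Compact

end GradientFlow

/-! ### Equations of stable manifolds -/

section StableEquation

variable {n m : ℕ} {M : Type*} [TopologicalSpace M] [ChartedSpace (EuclideanSpace ℝ (Fin n)) M]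
  [IsManifold (𝓡 n) ∞ M]

/-- A local equation `F` of the stable manifold of `y` at the point `y`, together with a
local diffeomorphism `ψ` that preserves the stable manifold and contracts it to `y`. At `y`, the
derivatives of `F` and `F ∘ ψ` induce the same orientation of the normal space: their determinants
are positive on a common frame. -/
structure StableEquation (g : SmoothMetric n M) (f : M → ℝ) (y : M) (ψ : M → M)
    (F : M → Fin m → ℝ) : Prop where
  smooth : ContMDiff (𝓡 n) (𝓡 n) ∞ ψ
  apply_self : ψ y = y
  surjective : ∀ q, Function.Surjective (mfderiv (𝓡 n) (𝓡 n) ψ q)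
  mem_iff : ∀ q, q ∈ stable g f y ↔ ψ q ∈ stable g f y
  tendsto : ∀ q ∈ stable g f y, Tendsto (fun k => ψ^[k] q) atTop (𝓝 y)
  eventually_mem : ∀ N ∈ 𝓝 y, ∀ᶠ q in 𝓝 y, q ∈ stable g f y → ∀ k, ψ^[k] q ∈ N
  equation : LocalEquation n (stable g f y) y F
  frame : ∃ r : Fin m → EuclideanSpace ℝ (Fin n),
    0 < Matrix.det (Matrix.of fun i => chartFDeriv n y F y (r i)) ∧
    0 < Matrix.det (Matrix.of fun i => chartFDeriv n y (F ∘ ψ) y (r i))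

/-- The local stable manifold theorem on a manifold, at a fixed point of a smooth map whose
linearization is diagonalizable with positive eigenvalues different from `1`. -/
theorem exists_local_stable_equation {ψ : M → M} (hψ : ContMDiff (𝓡 n) (𝓡 n) ∞ ψ) {y : M}
    (hy : ψ y = y) (b : Basis (Fin n) ℝ (EuclideanSpace ℝ (Fin n))) {μ : Fin n → ℝ}
    (hpos : ∀ i, 0 < μ i) (hne : ∀ i, μ i ≠ 1)
    (hb : ∀ i, fderiv ℝ (extChartAt (𝓡 n) y ∘ ψ ∘ (extChartAt (𝓡 n) y).symm)
      (extChartAt (𝓡 n) y y) (b i) = μ i • b i) (e : Fin m ≃ {i // 1 < μ i}) :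
    ∃ F : M → Fin m → ℝ, (∀ᶠ q in 𝓝 y, ContMDiffAt (𝓡 n) 𝓘(ℝ, Fin m → ℝ) ∞ F q) ∧
      (∀ j, chartFDeriv n y F y (b (e j)) = Pi.single j 1) ∧
      (∀ j, chartFDeriv n y (F ∘ ψ) y (b (e j)) = μ (e j) • Pi.single j 1) ∧
      (∀ N ∈ 𝓝 y, ∀ᶠ q in 𝓝 y, F q = 0 → ∀ k, ψ^[k] q ∈ N) ∧
      ∃ N ∈ 𝓝 y, ∀ q, (∀ k, ψ^[k] q ∈ N) → F q = 0 := by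
  have hp := mem_extChartAt_source (I := 𝓡 n) y
  set φ := extChartAt (𝓡 n) y with hφ
  have htm : φ.target ∈ 𝓝 (φ y) := (isOpen_extChartAt_target y).mem_nhds (φ.map_source hp)
  have hsn : φ.source ∈ 𝓝 y := extChartAt_source_mem_nhds y
  have hφc : ContinuousAt φ y := continuousAt_extChartAt (I := 𝓡 n) y
  have hψs : ∀ᶠ q in 𝓝 y, ψ q ∈ φ.source :=
    hψ.continuous.continuousAt.eventually (by rw [hy]; exact hsn)
  set χ := φ ∘ ψ ∘ φ.symm with hχ
  have hχs : ∀ᶠ z in 𝓝 (φ y), ContDiffAt ℝ ∞ χ z := by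
    refine eventually_contDiffAt_chart (F := φ ∘ ψ) ?_
    filter_upwards [hψs] with q hq
    exact (contMDiffAt_extChartAt' (by rwa [hφ, extChartAt_source] at hq)).comp q hψ.contMDiffAt
  have hχy : χ (φ y) = φ y := by simp [χ, φ.left_inv hp, hy]
  obtain ⟨χ', hχ', hχe⟩ := exists_contDiff_eventuallyEq (f := χ) hχs
    (fun z hz => ContDiffAt.contDiffWithinAt hz)
  -- linear coordinates with respect to the eigenbasis
  let L : (Fin n → ℝ) ≃L[ℝ] EuclideanSpace ℝ (Fin n) := b.equivFun.symm.toContinuousLinearEquiv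
  have hL : ∀ v, L v = ∑ i, v i • b i := fun v => b.equivFun_symm_apply v
  have hLb : ∀ i, L.symm (b i) = Pi.single i 1 := fun i => by
    rw [L.symm_apply_eq, hL]
    simp [Pi.single_apply]
  -- the map in these coordinates, modified far from the fixed point so that it is globally smooth
  let Ψ : (Fin n → ℝ) → Fin n → ℝ := fun v => L.symm (χ' (φ y + L v) - φ y)
  have hΨ : ContDiff ℝ ∞ Ψ := L.symm.contDiff.comp
    ((hχ'.comp (contDiff_const.add L.contDiff)).sub contDiff_const)
  have hΨ0 : Ψ 0 = 0 := by
    simp only [Ψ, map_zero, add_zero, hχe.self_of_nhds, hχy, sub_self]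
  have hΨd : ∀ v i, fderiv ℝ Ψ 0 v i = μ i * v i := by
    have h1 : HasFDerivAt χ' (fderiv ℝ χ (φ y)) (φ y + L 0) := by
      rw [map_zero, add_zero, ← hχe.fderiv_eq]
      exact (hχ'.differentiable (by simp) _).hasFDerivAt
    have h2 : HasFDerivAt Ψ _ 0 := L.symm.hasFDerivAt.comp (0 : Fin n → ℝ)
      ((h1.comp (0 : Fin n → ℝ) (L.hasFDerivAt.const_add (φ y))).sub_const (φ y))
    intro v i
    rw [h2.fderiv]
    change L.symm (fderiv ℝ χ (φ y) (L v)) i = _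
    have h3 : fderiv ℝ χ (φ y) (L v) = L fun i => μ i * v i := by
      simp only [hL, map_sum, map_smul, hb, smul_smul, mul_comm]
    rw [h3, L.symm_apply_apply]
  obtain ⟨F₀, O, hO, h0O, hF₀, hF₀0, hF₀d, hF₀s, W₁, hW₁, hF₀u⟩ :=
    exists_local_stable_diagonal hΨ hΨ0 μ hpos hne hΨd
  let κ : M → Fin n → ℝ := fun q => L.symm (φ q - φ y)
  have hκ0 : κ y = 0 := by simp [κ]
  have hκs : ∀ q ∈ φ.source, ContMDiffAt (𝓡 n) 𝓘(ℝ, Fin n → ℝ) ∞ κ q := fun q hq => by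
    have h1 : ContDiff ℝ ∞ fun ξ => L.symm (ξ - φ y) :=
      L.symm.contDiff.comp (contDiff_id.sub contDiff_const)
    exact h1.contMDiff.contMDiffAt.comp q
      (contMDiffAt_extChartAt' (by rwa [hφ, extChartAt_source] at hq))
  have hκc : ContinuousAt κ y := (hκs y hp).continuousAt
  have hκt : ∀ {W}, W ∈ 𝓝 (0 : Fin n → ℝ) → ∀ᶠ q in 𝓝 y, κ q ∈ W := fun hW =>
    hκc.eventually (by rw [hκ0]; exact hW)
  have hκi : ∀ q ∈ φ.source, φ.symm (φ y + L (κ q)) = q := fun q hq => by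
    simp only [κ, L.apply_symm_apply, add_sub_cancel, φ.left_inv hq]
  -- the points at which `ψ` is given by `Ψ` in the coordinates `κ`
  let N₀ : Set M := {q | q ∈ φ.source ∧ ψ q ∈ φ.source ∧ κ (ψ q) = Ψ (κ q)}
  have hN₀ : N₀ ∈ 𝓝 y := by
    filter_upwards [hsn, hψs, hφc.eventually hχe] with q h1 h2 h3
    refine ⟨h1, h2, ?_⟩
    simp only [κ, Ψ, L.apply_symm_apply, add_sub_cancel, h3, χ, Function.comp_apply, φ.left_inv h1]
  let R : ({i // 1 < μ i} → ℝ) →L[ℝ] (Fin m → ℝ) :=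
    ContinuousLinearMap.pi fun j => ContinuousLinearMap.proj (e j)
  have hR : ∀ w, R w = 0 ↔ w = 0 := fun w => by
    refine ⟨fun h => funext fun i => ?_, fun h => by rw [h, map_zero]⟩
    have h1 := congrFun h (e.symm i)
    simpa [R] using h1
  let F : M → Fin m → ℝ := fun q => R (F₀ (κ q))
  have hFs : ∀ᶠ q in 𝓝 y, ContMDiffAt (𝓡 n) 𝓘(ℝ, Fin m → ℝ) ∞ F q := by
    filter_upwards [hsn, hκt (hO.mem_nhds h0O)] with q hq hqO
    exact (R.contDiff.contDiffAt.comp _ (hF₀.contDiffAt (hO.mem_nhds hqO))).contMDiffAt.comp q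
      (hκs q hq)
  have hFd : ∀ j, chartFDeriv n y F y (b (e j)) = Pi.single j 1 := by
    intro j
    have h1 : F ∘ φ.symm =ᶠ[𝓝 (φ y)] fun ξ => R (F₀ (L.symm (ξ - φ y))) := by
      filter_upwards [htm] with ξ hξ
      simp only [F, κ, Function.comp_apply, φ.right_inv hξ]
    have h2 : HasFDerivAt F₀ (fderiv ℝ F₀ 0) (L.symm (φ y - φ y)) := by
      rw [sub_self, map_zero]
      exact ((hF₀.contDiffAt (hO.mem_nhds h0O)).differentiableAt (by simp)).hasFDerivAt
    have h3 : HasFDerivAt (fun ξ => R (F₀ (L.symm (ξ - φ y)))) _ (φ y) :=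
      R.hasFDerivAt.comp (φ y) (h2.comp (φ y) (L.symm.hasFDerivAt.comp (φ y)
        ((hasFDerivAt_id (φ y)).sub_const (φ y))))
    rw [chartFDeriv, ← hφ, h1.fderiv_eq, h3.fderiv]
    change R (fderiv ℝ F₀ 0 (L.symm (b (e j)))) = _
    rw [hLb, hF₀d _ fun i hi => Pi.single_eq_of_ne (fun h4 : i = (e j : Fin n) => hi (by
      rw [h4]
      exact (e j).2)) _]
    funext k
    simp [R, Pi.single_apply, Subtype.val_inj]
  refine ⟨F, hFs, hFd, fun j => ?_, fun N hN => ?_, N₀ ∩ κ ⁻¹' W₁, inter_mem hN₀ (hκt hW₁), ?_⟩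
  · have h1 : (F ∘ ψ) ∘ φ.symm =ᶠ[𝓝 (φ y)] (F ∘ φ.symm) ∘ χ := by
      have h2 : Tendsto φ.symm (𝓝 (φ y)) (𝓝 y) := by
        have := continuousAt_extChartAt_symm (I := 𝓡 n) y
        rwa [ContinuousAt, ← hφ, φ.left_inv hp] at this
      filter_upwards [h2.eventually hψs] with ξ hξ
      simp only [Function.comp_apply, χ, φ.left_inv hξ]
    have h3 : HasFDerivAt (F ∘ φ.symm) (chartFDeriv n y F y) (χ (φ y)) := by
      rw [hχy]
      exact ((eventually_contDiffAt_chart hFs).self_of_nhds.differentiableAt (by simp)).hasFDerivAt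
    have h4 := h3.comp (φ y) (hχs.self_of_nhds.differentiableAt (by simp)).hasFDerivAt
    rw [chartFDeriv, ← hφ, h1.fderiv_eq, h4.fderiv, ContinuousLinearMap.comp_apply, hb, map_smul,
      hFd]
  · let W : Set (Fin n → ℝ) := {v | φ.symm (φ y + L v) ∈ N ∩ N₀}
    have hW : W ∈ 𝓝 0 := by
      have h1 : ContinuousAt (fun v => φ.symm (φ y + L v)) 0 := by
        refine ContinuousAt.comp (g := φ.symm) ?_ (by fun_prop)
        rw [map_zero, add_zero]
        exact continuousAt_extChartAt_symm y
      refine h1.preimage_mem_nhds ?_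
      rw [map_zero, add_zero, φ.left_inv hp]
      exact inter_mem hN hN₀
    filter_upwards [hκc.eventually (by rw [hκ0]; exact hF₀s W hW), inter_mem hN hN₀]
      with q hq hqN hFq k
    have h1 := hq ((hR _).1 hFq)
    suffices ψ^[k] q ∈ N ∩ N₀ ∧ κ (ψ^[k] q) = Ψ^[k] (κ q) from this.1.1
    induction k with
    | zero => exact ⟨hqN, rfl⟩
    | succ k ih =>
      obtain ⟨⟨-, h2, h3, h4⟩, h5⟩ := ih
      rw [Function.iterate_succ_apply', Function.iterate_succ_apply']
      have h6 : κ (ψ (ψ^[k] q)) = Ψ (Ψ^[k] (κ q)) := by rw [h4, h5]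
      refine ⟨?_, h6⟩
      have h7 := h1 (k + 1)
      rw [Function.iterate_succ_apply', ← h6] at h7
      have h8 : φ.symm (φ y + L (κ (ψ (ψ^[k] q)))) ∈ N ∩ N₀ := h7
      rwa [hκi _ h3] at h8
  · intro q hq
    refine (hR _).2 (hF₀u _ fun k => ?_)
    suffices κ (ψ^[k] q) = Ψ^[k] (κ q) by
      rw [← this]
      exact (hq k).2
    induction k with
    | zero => rfl
    | succ k ih =>
      rw [Function.iterate_succ_apply', Function.iterate_succ_apply', (hq k).1.2.2, ih]

/-- The time-`τ` map of the gradient flow with small `τ > 0` serves as `ψ`; the codimension of the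
stable manifold is the number of positive eigenvalues of the linearization of `-∇f`. -/
theorem exists_stableEquation [T2Space M] [CompactSpace M] {f : M → ℝ}
    (hf : ContMDiff (𝓡 n) 𝓘(ℝ, ℝ) ∞ f) (hM : IsMorse n f) (g : SmoothMetric n M) {y : M}
    (hy : y ∈ Crit n f) (b : Basis (Fin n) ℝ (EuclideanSpace ℝ (Fin n))) {l : Fin n → ℝ}
    (hl : ∀ i, l i ≠ 0)
    (hb : ∀ i, fderiv ℝ (chartField y fun q => -grad g f q) (extChartAt (𝓡 n) y y) (b i) =
      l i • b i) (e : Fin m ≃ {i // 0 < l i}) :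
    ∃ (ψ : M → M) (F : M → Fin m → ℝ), StableEquation g f y ψ F := by
  obtain ⟨θ, h⟩ := exists_isGradientFlow hf g
  obtain ⟨ε, hε, hsm⟩ := h.smooth
  obtain ⟨δ, hδ, hloc, hlin⟩ := h.linearization y hy
  obtain ⟨τ, hτ, hτm⟩ := exists_between (lt_min hε hδ)
  have hτε : τ < ε := hτm.trans_le (min_le_left _ _)
  have hτδ : τ < δ := hτm.trans_le (min_le_right _ _)
  have hψ := hsm τ ⟨by linarith, hτε⟩
  have hψ' := hsm (-τ) ⟨by linarith, by linarith⟩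
  have hinv : ∀ q, θ (-τ) (θ τ q) = q := fun q => by
    rw [← h.add_apply, neg_add_cancel, h.zero_apply]
  have hinv' : ∀ q, θ τ (θ (-τ) q) = q := fun q => by
    rw [← h.add_apply, add_neg_cancel, h.zero_apply]
  have hiff : ∀ i, 1 < Real.exp (l i * τ) ↔ 0 < l i := fun i => by
    rw [Real.one_lt_exp_iff, mul_pos_iff_of_pos_right hτ]
  obtain ⟨F, hF, hF1, hF2, hF3, N₁, hN₁, hF4⟩ := exists_local_stable_equation hψ
    (h.apply_of_mem_crit hy τ) b (μ := fun i => Real.exp (l i * τ)) (fun i => Real.exp_pos _)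
    (fun i => by
      rw [Ne, Real.exp_eq_one_iff]
      exact mul_ne_zero (hl i) hτ.ne')
    (fun i => hlin (l i) (b i) (hb i) τ ⟨by linarith, hτδ⟩)
    (e.trans (Equiv.subtypeEquivRight hiff).symm)
  have hst : ∀ q, q ∈ stable g f y ↔ Tendsto (fun k => (θ τ)^[k] q) atTop (𝓝 y) := fun q =>
    h.mem_stable_iff_tendsto hτ hτδ hloc
  have hdet : Matrix.det (Matrix.of fun j => chartFDeriv n y F y (b (e j))) = 1 := by
    have h1 : (Matrix.of fun j => chartFDeriv n y F y (b (e j))) =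
        (1 : Matrix (Fin m) (Fin m) ℝ) := by
      ext i j
      exact (congrFun (hF1 i) j).trans (by simp [Matrix.one_apply, Pi.single_apply, eq_comm])
    rw [h1, Matrix.det_one]
  refine ⟨θ τ, F, hψ, h.apply_of_mem_crit hy τ, ?_, ?_,
    fun q hq => (hst q).1 hq, ?_, ⟨hF, ?_, ?_⟩, fun j => b (e j), ?_, ?_⟩
  · have h1 : ∀ p, Function.Surjective (mfderiv (𝓡 n) (𝓡 n) (θ τ) (θ (-τ) p)) := by
      intro p v
      have h2 := (hψ.mdifferentiableAt (by simp) (x := θ (-τ) p)).hasMFDerivAt.comp p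
        (hψ'.mdifferentiableAt (by simp) (x := p)).hasMFDerivAt
      have h3 : θ τ ∘ θ (-τ) = id := funext hinv'
      rw [h3] at h2
      have h4 := hasMFDerivAt_unique h2 (hasMFDerivAt_id p)
      have h5 : θ τ (θ (-τ) p) = p := hinv' p
      exact ⟨mfderiv (𝓡 n) (𝓡 n) (θ (-τ)) p v, congrArg
        (fun l : EuclideanSpace ℝ (Fin n) →L[ℝ] EuclideanSpace ℝ (Fin n) => l v) h4⟩
    intro q
    have h2 := h1 (θ τ q)
    rwa [hinv] at h2
  · intro q
    rw [hst, hst, ← tendsto_add_atTop_iff_nat (f := fun k => (θ τ)^[k] q) 1]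
    rfl
  · intro N hN
    filter_upwards [h.eventually_forall_mem hf hM hy hτ hψ.continuous hN] with q hq hqs
    exact hq ((hst q).1 hqs)
  · intro c
    obtain ⟨v, hv⟩ := surjective_of_det_ne_zero (L := (chartFDeriv n y F y).toLinearMap)
      (r := fun j => b (e j)) (hdet.trans_ne one_ne_zero) c
    obtain ⟨u, rfl⟩ := (chartDeriv_bijective (mem_chart_source _ y)).2 v
    exact ⟨u, (mfderiv_eq_chartFDeriv (mem_extChartAt_source y) hF.self_of_nhds u).trans hv⟩
  · obtain ⟨B, hBn, hB, hBs⟩ :=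
      exists_mem_nhds_isClosed_subset (eventually_eq_of_mem_crit hf hM hy)
    filter_upwards [hF3 B hBn, h.eventually_forall_mem hf hM hy hτ hψ.continuous hN₁]
      with q h1 h2
    rw [hst]
    exact ⟨fun h3 => hF4 q (h2 h3), fun h3 =>
      h.tendsto_of_forall_mem hf hτ hψ.continuous hB (fun z hz => hBs hz) (h1 h3)⟩
  · rw [hdet]
    exact one_pos
  · have h1 : (Matrix.of fun j => chartFDeriv n y (F ∘ θ τ) y (b (e j))) =
        Matrix.diagonal fun j => Real.exp (l (e j) * τ) := by
      ext i j
      refine (congrFun (hF2 i) j).trans ?_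
      simp [Matrix.diagonal_apply, Pi.single_apply, eq_comm]
    rw [h1, Matrix.det_diagonal]
    exact Finset.prod_pos fun j _ => Real.exp_pos _

end StableEquation

/-! ### Stable and unstable manifolds at arbitrary points -/

section Global

variable {n m : ℕ} {M : Type*} [TopologicalSpace M] [ChartedSpace (EuclideanSpace ℝ (Fin n)) M]
  [IsManifold (𝓡 n) ∞ M]

omit [IsManifold (𝓡 n) ∞ M] in
theorem contMDiff_iterate {ψ : M → M} (hψ : ContMDiff (𝓡 n) (𝓡 n) ∞ ψ) (k : ℕ) :
    ContMDiff (𝓡 n) (𝓡 n) ∞ ψ^[k] := by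
  induction k with
  | zero => exact contMDiff_id
  | succ k ih => exact ih.comp hψ

omit [IsManifold (𝓡 n) ∞ M] in
theorem surjective_mfderiv_iterate {ψ : M → M} (hψ : ContMDiff (𝓡 n) (𝓡 n) ∞ ψ)
    (hs : ∀ q, Function.Surjective (mfderiv (𝓡 n) (𝓡 n) ψ q)) (k : ℕ) (q : M) :
    Function.Surjective (mfderiv (𝓡 n) (𝓡 n) ψ^[k] q) := by
  induction k generalizing q with
  | zero =>
    rw [Function.iterate_zero, mfderiv_id]
    exact Function.surjective_id
  | succ k ih =>
    rw [Function.iterate_succ, mfderiv_comp q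
      ((contMDiff_iterate hψ k).mdifferentiableAt (by simp)) (hψ.mdifferentiableAt (by simp))]
    exact (ih (ψ q)).comp (hs q)

namespace StableEquation

variable {g : SmoothMetric n M} {f : M → ℝ} {y : M} {ψ : M → M} {F : M → Fin m → ℝ}
  (h : StableEquation g f y ψ F)
include h

theorem iterate_mem_iff (k : ℕ) (q : M) : q ∈ stable g f y ↔ ψ^[k] q ∈ stable g f y := by
  induction k with
  | zero => rfl
  | succ k ih => rw [ih, Function.iterate_succ_apply', h.mem_iff]

/-- The equation at `y` is transported to a point `p` of the stable manifold by an iterate of `ψ`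
that brings `p` close to `y`. -/
theorem comp_iterate {p : M} {k : ℕ} (hk : LocalEquation n (stable g f y) (ψ^[k] p) F) :
    LocalEquation n (stable g f y) p (F ∘ ψ^[k]) :=
  hk.comp (contMDiff_iterate h.smooth k) (surjective_mfderiv_iterate h.smooth h.surjective k p)
    (h.iterate_mem_iff k)

theorem exists_localEquation {p : M} (hp : p ∈ stable g f y) :
    ∃ F' : M → Fin m → ℝ, LocalEquation n (stable g f y) p F' := by
  obtain ⟨k, hk⟩ := ((h.tendsto p hp).eventually h.equation.eventually).exists
  exact ⟨_, h.comp_iterate hk⟩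

end StableEquation

section Duality

variable (g : SmoothMetric n M) (f : M → ℝ)

/-- The gradient of `-f` is `-∇f`. Replacing `f` by `-f` reverses the flow, which reduces statements
on unstable manifolds to those on stable ones. -/
theorem grad_neg (p : M) : grad g (-f) p = -grad g f p := by
  have h1 : ∀ w, g.inner p (grad g (-f) p + grad g f p) w = 0 := fun w => by
    have h2 := inner_grad g (-f) p w
    rw [mfderiv_neg] at h2
    have h3 := inner_grad g f p w
    have h4 : g.inner p (grad g (-f) p + grad g f p) w =
        g.inner p (grad g (-f) p) w + g.inner p (grad g f p) w := by rw [map_add]; rfl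
    rw [h4, h2, h3]
    exact neg_add_cancel _
  by_contra h
  have h2 : grad g (-f) p + grad g f p ≠ 0 := fun h3 => h (eq_neg_of_add_eq_zero_left h3)
  exact (g.pos p _ h2).ne' (h1 _)

omit [IsManifold (𝓡 n) ∞ M] in
theorem crit_neg : Crit n (-f) = Crit n f := by
  ext p
  change mfderiv (𝓡 n) 𝓘(ℝ, ℝ) (-f) p = 0 ↔ mfderiv (𝓡 n) 𝓘(ℝ, ℝ) f p = 0
  rw [mfderiv_neg]
  exact neg_eq_zero

omit [IsManifold (𝓡 n) ∞ M] in
variable {f} in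
theorem IsMorse.neg (hM : IsMorse n f) : IsMorse n (-f) := by
  intro x hx v hv
  rw [crit_neg] at hx
  refine hM x hx v fun w => ?_
  have h1 := hv w
  have h2 : (-f) ∘ (extChartAt (𝓡 n) x).symm = -(f ∘ (extChartAt (𝓡 n) x).symm) := rfl
  have h3 : fderiv ℝ (-(f ∘ (extChartAt (𝓡 n) x).symm)) =
      -fderiv ℝ (f ∘ (extChartAt (𝓡 n) x).symm) := funext fun z => fderiv_neg
  rw [hessian, h2, h3, fderiv_neg] at h1
  exact neg_eq_zero.1 h1

variable {f} in
theorem IsTrajectory.neg {q : M} {γ : ℝ → M} (h : IsTrajectory g f q γ) :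
    IsTrajectory g (-f) q fun t => γ (-t) := by
  refine ⟨?_, by simpa using h.2⟩
  have h1 := h.1.comp_mul (-1)
  have h2 : (γ ∘ fun t => t * (-1)) = fun t => γ (-t) := funext fun t => by simp
  rw [h2] at h1
  convert h1 using 1
  funext p
  simp [grad_neg]

/-- The unstable manifolds of `f` are the stable manifolds of `-f`. -/
theorem unstable_eq_stable_neg (x : M) : unstable g f x = stable g (-f) x := by
  have h1 : ∀ γ : ℝ → M, alphaLimitSet γ = omegaLimitSet fun t => γ (-t) := by
    intro γ
    ext p
    constructor
    · rintro ⟨t, ht, h⟩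
      exact ⟨fun k => -t k, tendsto_neg_atBot_atTop.comp ht, by simpa using h⟩
    · rintro ⟨t, ht, h⟩
      exact ⟨fun k => -t k, tendsto_neg_atTop_atBot.comp ht, h⟩
  ext q
  constructor
  · rintro ⟨γ, h2, h3⟩
    exact ⟨_, h2.neg, (h1 γ).symm.trans h3⟩
  · rintro ⟨γ, h2, h3⟩
    refine ⟨fun t => γ (-t), by simpa using h2.neg, ?_⟩
    rw [h1]
    simpa using h3

end Duality

/-- The stable and unstable manifolds of a critical point have complementary dimensions: both are
given by the signs of the eigenvalues of the linearization in one and the same eigenbasis. -/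
theorem exists_stableEquation_pair [T2Space M] [CompactSpace M] {f : M → ℝ}
    (hf : ContMDiff (𝓡 n) 𝓘(ℝ, ℝ) ∞ f) (hM : IsMorse n f) (g : SmoothMetric n M) {y : M}
    (hy : y ∈ Crit n f) :
    ∃ (ms mu : ℕ) (ψ : M → M) (F : M → Fin ms → ℝ) (ψ' : M → M) (F' : M → Fin mu → ℝ),
      ms + mu = n ∧ StableEquation g f y ψ F ∧ StableEquation g (-f) y ψ' F' := by
  obtain ⟨b, l, hl, hb⟩ := exists_eigenbasis_neg_grad hf hM g hy
  have hf' : ContMDiff (𝓡 n) 𝓘(ℝ, ℝ) ∞ (-f) := hf.neg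
  obtain ⟨ψ, F, h1⟩ := exists_stableEquation hf hM g hy b hl hb (Fintype.equivFin _).symm
  obtain ⟨ψ', F', h2⟩ := exists_stableEquation hf' hM.neg g (by rwa [crit_neg]) b
    (l := fun i => -l i) (fun i => neg_ne_zero.2 (hl i)) (fun i => by
      have h3 : (chartField y fun q => -grad g (-f) q) =
          -chartField y fun q => -grad g f q := by
        funext ξ
        simp only [chartField, grad_neg, Pi.neg_apply, ← map_neg]
      rw [h3, fderiv_neg, neg_smul, ← hb i]
      rfl) (Fintype.equivFin _).symm
  refine ⟨_, _, ψ, F, ψ', F', ?_, h1, h2⟩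
  have h3 : ∀ i, 0 < -l i ↔ ¬ 0 < l i := fun i => by
    rw [neg_pos, not_lt]
    exact ⟨le_of_lt, fun h4 => lt_of_le_of_ne h4 (hl i)⟩
  rw [Fintype.card_congr (Equiv.subtypeEquivRight h3), Fintype.card_subtype_compl, Fintype.card_fin]
  have := Fintype.card_subtype_le fun i : Fin n => 0 < l i
  rw [Fintype.card_fin] at this
  omega

/-- Stable manifolds are invariant under the flow. -/
theorem mem_stable_of_isTrajectory {g : SmoothMetric n M} {f : M → ℝ} {y q : M} {γ : ℝ → M}
    (hγ : IsTrajectory g f q γ) (hω : omegaLimitSet γ = {y}) (s : ℝ) : γ s ∈ stable g f y := by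
  refine ⟨fun t => γ (t + s), ⟨hγ.1.comp_add s, by simp⟩, ?_⟩
  rw [← hω]
  ext p
  constructor
  · rintro ⟨t, ht, h⟩
    exact ⟨fun k => t k + s, tendsto_atTop_add_const_right _ s ht, h⟩
  · rintro ⟨t, ht, h⟩
    exact ⟨fun k => t k - s, by simpa [sub_eq_add_neg] using
      tendsto_atTop_add_const_right _ (-s) ht, by simpa using h⟩

/-- The gradient field is tangent to the stable manifolds, which consist of trajectories. -/
theorem LocalEquation.neg_grad_mem {g : SmoothMetric n M} {f : M → ℝ} {y p : M}
    {F : M → Fin m → ℝ} (h : LocalEquation n (stable g f y) p F) (hp : p ∈ stable g f y) :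
    -grad g f p ∈ tangentOf n (stable g f y) p := by
  rw [h.mem_tangentOf_iff hp]
  obtain ⟨γ, hγ, hω⟩ := hp
  obtain ⟨h1, rfl⟩ := hγ
  have h2 := (h.smooth.self_of_nhds.mdifferentiableAt (by simp)).hasMFDerivAt.comp 0 (h1 0)
  have h3 : HasMFDerivAt 𝓘(ℝ, ℝ) 𝓘(ℝ, Fin m → ℝ) (F ∘ γ) 0 (0 : ℝ →L[ℝ] (Fin m → ℝ)) := by
    refine (hasFDerivAt_const (0 : Fin m → ℝ) (0 : ℝ)).hasMFDerivAt.congr_of_eventuallyEq ?_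
    filter_upwards [h1.continuous.continuousAt.eventually h.mem_iff] with t ht
    exact ht.1 (mem_stable_of_isTrajectory ⟨h1, rfl⟩ hω t)
  have h4 := congrArg (fun l : ℝ →L[ℝ] (Fin m → ℝ) => l 1) (hasMFDerivAt_unique h2 h3)
  exact (congrArg (mfderiv (𝓡 n) 𝓘(ℝ, Fin m → ℝ) F (γ 0))
    (one_smul ℝ (-grad g f (γ 0)))).symm.trans h4

end Global

/-! ### Determinants along linear maps -/

section Determinants

variable {V : Type*} [AddCommGroup V] [Module ℝ V] {k m : ℕ}

/-- If the kernel of `Λ'` contains that of `Λ`, then `Λ'` is the composition of `Λ` with an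
endomorphism of the target, whose determinant relates the two. -/
theorem exists_detAlong_eq_mul {Λ Λ' : V →ₗ[ℝ] (Fin m → ℝ)} (hs : Function.Surjective Λ)
    (hker : ∀ v, Λ v = 0 → Λ' v = 0) : ∃ c : ℝ, ∀ v, detAlong Λ' v = c * detAlong Λ v := by
  obtain ⟨R, hR⟩ := Λ.exists_rightInverse_of_surjective (LinearMap.range_eq_top.2 hs)
  have h1 : ∀ v, Λ' v = (Λ' ∘ₗ R) (Λ v) := fun v => by
    have h2 : Λ (v - R (Λ v)) = 0 := by
      rw [map_sub, show Λ (R (Λ v)) = Λ v from congrArg (fun l => l (Λ v)) hR, sub_self]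
    have h3 := hker _ h2
    rw [map_sub, sub_eq_zero] at h3
    exact h3
  refine ⟨LinearMap.det (Λ' ∘ₗ R), fun v => ?_⟩
  have h4 := (Pi.basisFun ℝ (Fin m)).det_comp (Λ' ∘ₗ R) (fun i => Λ (v i))
  rw [Pi.basisFun_det] at h4
  rw [detAlong_apply, detAlong_apply]
  refine Eq.trans ?_ h4
  congr 1
  funext i
  exact h1 (v i)

/-- The matrix is block triangular, because `Λ₂` vanishes on `a`. This is the determinant behind the
splitting `T_p U ≅ T_p (U ∩ S) ⊕ T_p M / T_p S`. -/
theorem detAlong_append {Λ : V →ₗ[ℝ] (Fin (k + m) → ℝ)} {Λ₁ : V →ₗ[ℝ] (Fin k → ℝ)}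
    {Λ₂ : V →ₗ[ℝ] (Fin m → ℝ)} (hΛ : ∀ v, Λ v = Fin.append (Λ₁ v) (Λ₂ v)) {a : Fin k → V}
    (ha : ∀ i, Λ₂ (a i) = 0) (w : Fin m → V) :
    detAlong Λ (Fin.append a w) = detAlong Λ₁ a * detAlong Λ₂ w := by
  rw [detAlong_apply, detAlong_apply, detAlong_apply,
    ← Matrix.det_submatrix_equiv_self (finSumFinEquiv (m := k) (n := m)),
    ← Matrix.det_fromBlocks_zero₁₂ _ (Matrix.of fun i j => Λ₁ (w i) j)]
  congr 1
  ext i j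
  rcases i with i | i <;> rcases j with j | j <;> simp [hΛ, ha]

/-- The first column of the matrix has a single nonzero entry. This is the determinant behind the
splitting of a tangent space into the gradient line and the tangent space of a level set. -/
theorem detAlong_cons {Λ : V →ₗ[ℝ] (Fin (k + 1) → ℝ)} {l : V →ₗ[ℝ] ℝ} {Λ₁ : V →ₗ[ℝ] (Fin k → ℝ)}
    (hΛ : ∀ v, Λ v = Fin.cons (l v) (Λ₁ v)) {c : Fin k → V} (hc : ∀ i, l (c i) = 0) (u : V) :
    detAlong Λ (Fin.cons u c : Fin (k + 1) → V) = l u * detAlong Λ₁ c := by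
  rw [detAlong_apply, detAlong_apply, Matrix.det_succ_column_zero, Fin.sum_univ_succ]
  have h1 : ∀ i : Fin k, (Matrix.of fun i => Λ ((Fin.cons u c : Fin (k + 1) → V) i)) i.succ 0 = 0 :=
    fun i => by simp [hΛ, hc]
  simp only [h1, mul_zero, zero_mul, Finset.sum_const_zero, add_zero]
  have h2 : (Matrix.of fun i => Λ ((Fin.cons u c : Fin (k + 1) → V) i)) 0 0 = l u := by simp [hΛ]
  rw [h2, Fin.val_zero, pow_zero, one_mul]
  congr 2
  ext i j
  simp [hΛ]

/-- The numbers `s * (c * d)` and `t * d` have the same sign if and only if `s * t * c` is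
positive. -/
theorem iff_iff_mul_pos {s t c d : ℝ} (ht : t ≠ 0) (hd : d ≠ 0) (hs : s ≠ 0) (hc : c ≠ 0) :
    ((0 < s * (c * d)) ↔ 0 < t * d) ↔ 0 < s * t * c := by
  rcases lt_or_gt_of_ne ht with ht | ht <;> rcases lt_or_gt_of_ne hd with hd | hd <;>
    rcases lt_or_gt_of_ne hs with hs | hs <;> rcases lt_or_gt_of_ne hc with hc | hc <;>
    simp [mul_pos_iff, mul_neg_iff, ht, hd, hs, hc, ht.le, hd.le, hs.le, hc.le, not_lt.2, lt_asymm]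

end Determinants

/-! ### Frames, and comparison of coorientations -/

section Frames

variable {n m : ℕ} {M : Type*} [TopologicalSpace M] [ChartedSpace (EuclideanSpace ℝ (Fin n)) M]

theorem IsTangentBasis.finrank_eq {S : Set M} {p : M} {k : ℕ} {v : Fin k → TangentSpace (𝓡 n) p}
    (h : IsTangentBasis S p v) : finrank ℝ (tangentOf n S p) = k := by
  obtain ⟨b, -⟩ := h
  simp [finrank_eq_card_basis b]

theorem IsNormalBasis.finrank_eq {S : Set M} {p : M} {k : ℕ} {v : Fin k → TangentSpace (𝓡 n) p}
    (h : IsNormalBasis S p v) : finrank ℝ (tangentOf n S p) + k = n := by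
  obtain ⟨b, -⟩ := h
  have h2 : finrank ℝ (NormalSpace n S p) + finrank ℝ (tangentOf n S p) =
      finrank ℝ (TangentSpace (𝓡 n) p) := (tangentOf n S p).finrank_quotient_add_finrank
  rw [finrank_eq_card_basis b, Fintype.card_fin, finrank_tangentSpace] at h2
  omega

theorem IsTangentBasis.mem {S : Set M} {p : M} {k : ℕ} {v : Fin k → TangentSpace (𝓡 n) p}
    (h : IsTangentBasis S p v) (i : Fin k) : v i ∈ tangentOf n S p := by
  obtain ⟨b, hb, -⟩ := h
  rw [← hb]
  exact (b i).2

theorem IsTangentBasis.detAlong_ne_zero {S : Set M} {p : M} {k : ℕ}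
    {v : Fin k → TangentSpace (𝓡 n) p} (h : IsTangentBasis S p v)
    {Λ : TangentSpace (𝓡 n) p →ₗ[ℝ] (Fin k → ℝ)} (hΛ : ∀ v ∈ tangentOf n S p, Λ v = 0 → v = 0) :
    detAlong Λ v ≠ 0 := by
  obtain ⟨b, hb, -⟩ := h
  rw [← detAlong_subtype Λ hb]
  exact MorseFlow.detAlong_ne_zero (fun u hu => Subtype.ext (hΛ u u.2 hu)) b

theorem IsNormalBasis.detAlong_ne_zero {S : Set M} {p : M} {k : ℕ}
    {v : Fin k → TangentSpace (𝓡 n) p} (h : IsNormalBasis S p v)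
    {Λ : TangentSpace (𝓡 n) p →ₗ[ℝ] (Fin k → ℝ)} (hΛ : tangentOf n S p = LinearMap.ker Λ) :
    detAlong Λ v ≠ 0 := by
  obtain ⟨b, hb, -⟩ := h
  rw [← detAlong_liftQ Λ hΛ.le hb]
  refine MorseFlow.detAlong_ne_zero (fun u hu => ?_) b
  have h1 : LinearMap.ker ((tangentOf n S p).liftQ Λ hΛ.le) = ⊥ := by
    rw [Submodule.ker_liftQ, ← hΛ, Submodule.mkQ_map_self]
  exact LinearMap.ker_eq_bot'.1 h1 u hu

variable [IsManifold (𝓡 n) ∞ M]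

/-- A continuous family of linear maps which is injective on `T_p S` is injective on the nearby
tangent spaces of `S`. -/
theorem HasTangentFrames.eventually_detAlong_ne_zero {S : Set M} {k : ℕ}
    (hS : HasTangentFrames n S k) (p : S)
    {A : M → EuclideanSpace ℝ (Fin n) →L[ℝ] (Fin k → ℝ)} (hA : ContinuousAt A p)
    (hinj : ∀ v ∈ tangentOf n S (p : M), formAt n (p : M) A p v = 0 → v = 0) :
    ∀ᶠ q : S in 𝓝 p, ∀ v : Fin k → TangentSpace (𝓡 n) (q : M), IsTangentBasis S (q : M) v →
      detAlong (formAt n (p : M) A q) v ≠ 0 := by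
  obtain ⟨U, hU, X, hX, hb⟩ := hS p
  have hc : ContinuousAt (fun q : S => detAlong (formAt n (p : M) A q) fun i => X i q) p :=
    continuousAt_det_form continuousAt_subtype_val hA fun i =>
      continuousAt_chartDeriv (π := Subtype.val) ((hX i).continuousAt hU)
  have h0 := hc.eventually_ne ((hb p (mem_of_mem_nhds hU)).detAlong_ne_zero hinj)
  filter_upwards [h0, hU] with q hq hqU v hv
  obtain ⟨b, hbv, -⟩ := hv
  obtain ⟨b', hb', -⟩ := hb q hqU
  rw [← detAlong_subtype _ hbv, detAlong_basis _ b' b, detAlong_subtype _ hb']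
  exact mul_ne_zero hq (b'.isUnit_det b).ne_zero

/-- A set with local equations has continuous tangent frames, and its tangent spaces have constant
dimension. -/
theorem exists_hasTangentFrames {S : Set M}
    (h : ∀ p ∈ S, ∃ F : M → Fin m → ℝ, LocalEquation n S p F) :
    ∃ k, HasTangentFrames n S k ∧ ∀ p ∈ S, finrank ℝ (tangentOf n S p) = k := by
  have h1 : ∀ p ∈ S, finrank ℝ (tangentOf n S p) = n - m := fun p hp => by
    obtain ⟨F, hF⟩ := h p hp
    have := hF.finrank_tangentOf hp
    omega
  refine ⟨n - m, ?_, h1⟩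
  intro p
  obtain ⟨F, hF⟩ := h p p.2
  have := hF.finrank_tangentOf p.2
  exact hasTangentFrames (by omega) h p

theorem NormalOrientation.ext_fibre {S : Set M} {ν ν' : NormalOrientation (n := n) S}
    (h : ∀ q, ν.fibre q = ν'.fibre q) : ν = ν' := by
  cases ν
  cases ν'
  congr
  exact funext h

theorem NormalOrientation.fibre_eq_iff {S : Set M} {ν ν' : NormalOrientation (n := n) S} {q : S}
    {k : ℕ} {v : Fin k → TangentSpace (𝓡 n) (q : M)} (hv : IsNormalBasis S (q : M) v) :
    ν.fibre q = ν'.fibre q ↔ (ν.Pos q v ↔ ν'.Pos q v) := by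
  obtain ⟨b, hb, -⟩ := hv
  rw [ν.pos_of_basis q hb, ν'.pos_of_basis q hb]
  exact ⟨fun h => by rw [h], vectorOrientation_ext⟩

theorem NormalOrientation.fibre_eq_of_pos_iff {S : Set M} {ν ν' : NormalOrientation (n := n) S}
    {p : M} (hp : p ∈ S) {k : ℕ} {v : Fin k → TangentSpace (𝓡 n) p} (hv : IsNormalBasis S p v)
    (h : ν.Pos ⟨p, hp⟩ v ↔ ν'.Pos ⟨p, hp⟩ v) : ν.fibre ⟨p, hp⟩ = ν'.fibre ⟨p, hp⟩ :=
  (NormalOrientation.fibre_eq_iff (q := ⟨p, hp⟩) hv).2 h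

/-- Two coorientations agree or disagree on whole components. -/
theorem NormalOrientation.isLocallyConstant {S : Set M} (ν ν' : NormalOrientation (n := n) S)
    (h : ∀ p ∈ S, ∃ F : M → Fin m → ℝ, LocalEquation n S p F) :
    IsLocallyConstant fun q : S => ν.fibre q = ν'.fibre q := by
  refine (IsLocallyConstant.iff_eventually_eq _).2 fun p => ?_
  obtain ⟨F, hF⟩ := h p p.2
  have hker : ∀ᶠ q : S in 𝓝 p,
      tangentOf n S (q : M) = LinearMap.ker (formAt n (p : M) (chartFDeriv n p F) q) := by
    filter_upwards [continuousAt_subtype_val.eventually hF.eventually_tangentOf] with q hq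
    exact hq q.2
  obtain ⟨s, hs, h1⟩ := ν.exists_sign p (continuousAt_chartFDeriv hF.smooth) hker
  obtain ⟨t, ht, h2⟩ := ν'.exists_sign p (continuousAt_chartFDeriv hF.smooth) hker
  have key : ∀ᶠ q : S in 𝓝 p, (ν.fibre q = ν'.fibre q ↔ 0 < s * t) := by
    filter_upwards [h1, h2, hker] with q h1 h2 hq
    obtain ⟨U, hU, X, -, hb⟩ := hasNormalFrames h q
    have hv := hb q (mem_of_mem_nhds hU)
    have hd := hv.detAlong_ne_zero hq
    rw [NormalOrientation.fibre_eq_iff hv, h1 _ hv, h2 _ hv]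
    have := iff_iff_mul_pos ht hd hs one_ne_zero
    simpa using this
  filter_upwards [key] with q hq
  exact propext (hq.trans key.self_of_nhds.symm)

end Frames

/-! ### The coorientation of a stable manifold -/

section Coorientation

variable {n m : ℕ} {M : Type*} [TopologicalSpace M] [ChartedSpace (EuclideanSpace ℝ (Fin n)) M]

/-- The derivative of `F` at `q` as a linear map without topology. -/
noncomputable def derivAt (n : ℕ) {M : Type*} [TopologicalSpace M]
    [ChartedSpace (EuclideanSpace ℝ (Fin n)) M] (F : M → Fin m → ℝ) (q : M) :
    TangentSpace (𝓡 n) q →ₗ[ℝ] (Fin m → ℝ) :=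
  (mfderiv (𝓡 n) 𝓘(ℝ, Fin m → ℝ) F q).toLinearMap

theorem derivAt_comp {F : M → Fin m → ℝ} {ψ : M → M} {q : M}
    (hF : ContMDiffAt (𝓡 n) 𝓘(ℝ, Fin m → ℝ) ∞ F (ψ q)) (hψ : ContMDiff (𝓡 n) (𝓡 n) ∞ ψ)
    {k : ℕ} (v : Fin k → TangentSpace (𝓡 n) q) (i : Fin k) :
    derivAt n (F ∘ ψ) q (v i) = derivAt n F (ψ q) (mfderiv (𝓡 n) (𝓡 n) ψ q (v i)) := by
  change mfderiv (𝓡 n) 𝓘(ℝ, Fin m → ℝ) (F ∘ ψ) q (v i) = _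
  rw [mfderiv_comp q (hF.mdifferentiableAt (by simp)) (hψ.mdifferentiableAt (by simp))]
  rfl

/-- The chain rule for determinants. -/
theorem detAlong_derivAt_comp {F : M → Fin m → ℝ} {ψ : M → M} {q : M}
    (hF : ContMDiffAt (𝓡 n) 𝓘(ℝ, Fin m → ℝ) ∞ F (ψ q)) (hψ : ContMDiff (𝓡 n) (𝓡 n) ∞ ψ)
    (v : Fin m → TangentSpace (𝓡 n) q) :
    detAlong (derivAt n (F ∘ ψ) q) v =
      detAlong (derivAt n F (ψ q)) fun i => mfderiv (𝓡 n) (𝓡 n) ψ q (v i) := by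
  rw [detAlong_apply, detAlong_apply]
  congr 1
  funext i
  exact derivAt_comp hF hψ v i

variable [IsManifold (𝓡 n) ∞ M]

theorem eventually_derivAt_eq {p : M} {F : M → Fin m → ℝ}
    (hF : ∀ᶠ q in 𝓝 p, ContMDiffAt (𝓡 n) 𝓘(ℝ, Fin m → ℝ) ∞ F q) :
    ∀ᶠ q in 𝓝 p, derivAt n F q = formAt n p (chartFDeriv n p F) q := by
  filter_upwards [eventually_mfderiv_eq_formAt hF] with q hq
  exact LinearMap.ext hq

namespace StableEquation

variable {g : SmoothMetric n M} {f : M → ℝ} {y : M} {ψ : M → M} {F : M → Fin m → ℝ}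
  (h : StableEquation g f y ψ F)
include h

/-- Near `y`, the equations `F` and `F ∘ ψ` induce the same coorientation. -/
theorem eventually_derivAt_comp :
    ∀ᶠ q in 𝓝 y, q ∈ stable g f y → ∃ c > 0, ∀ v : Fin m → TangentSpace (𝓡 n) q,
      detAlong (derivAt n (F ∘ ψ) q) v = c * detAlong (derivAt n F q) v := by
  have h' : LocalEquation n (stable g f y) y (F ∘ ψ) :=
    LocalEquation.comp h.smooth (by rw [h.apply_self]; exact h.equation) (h.surjective y) h.mem_iff
  obtain ⟨r, hr, hr'⟩ := h.frame
  have hdet : Continuous fun m : Matrix (Fin m) (Fin m) ℝ => m.det := continuous_id.matrix_det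
  have hpos : ∀ G : M → Fin m → ℝ, LocalEquation n (stable g f y) y G →
      0 < Matrix.det (Matrix.of fun i => chartFDeriv n y G y (r i)) →
      ∀ᶠ q in 𝓝 y, 0 < detAlong (derivAt n G q) fun i => ofCoordinates y (fun _ => r i) q := by
    intro G hG hG0
    have h1 : ContinuousAt (fun q => Matrix.det (Matrix.of fun i => chartFDeriv n y G q (r i))) y :=
      hdet.continuousAt.comp (continuousAt_pi.2 fun i =>
        (continuousAt_chartFDeriv hG.smooth).clm_apply continuousAt_const)
    filter_upwards [h1.eventually (lt_mem_nhds hG0), eventually_derivAt_eq hG.smooth,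
      chart_source_mem_nhds (EuclideanSpace ℝ (Fin n)) y] with q h2 h3 h4
    rw [h3, detAlong_apply]
    simp only [formAt_apply, chartDeriv_ofCoordinates _ h4]
    exact h2
  filter_upwards [hpos F h.equation hr, hpos _ h' hr', h.equation.eventually, h'.eventually]
    with q h1 h2 h3 h4 hq
  obtain ⟨c, hc⟩ := exists_detAlong_eq_mul (Λ := derivAt n F q) (Λ' := derivAt n (F ∘ ψ) q)
    h3.surjective fun v hv => (h4.mem_tangentOf_iff hq v).1 ((h3.mem_tangentOf_iff hq v).2 hv)
  refine ⟨c, ?_, hc⟩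
  rw [hc] at h2
  exact (pos_iff_pos_of_mul_pos h2).2 h1

/-- Near `y`, all the equations `F ∘ ψᵏ` induce the same coorientation, because the forward orbits
of points of the stable manifold near `y` stay near `y`. -/
theorem eventually_derivAt_iterate :
    ∀ᶠ q in 𝓝 y, q ∈ stable g f y →
      (∀ k, ContMDiffAt (𝓡 n) 𝓘(ℝ, Fin m → ℝ) ∞ (F ∘ ψ^[k]) q) ∧
      ∀ k, ∃ c > 0, ∀ v : Fin m → TangentSpace (𝓡 n) q,
        detAlong (derivAt n (F ∘ ψ^[k]) q) v = c * detAlong (derivAt n F q) v := by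
  filter_upwards [h.eventually_mem _ (h.equation.smooth.and h.eventually_derivAt_comp)]
    with q hq hqS
  refine ⟨fun k => (hq hqS k).1.comp q (contMDiff_iterate h.smooth k).contMDiffAt, fun k => ?_⟩
  induction k with
  | zero => exact ⟨1, one_pos, fun v => by rw [one_mul]; rfl⟩
  | succ k ih =>
    obtain ⟨c, hc, hcv⟩ := ih
    obtain ⟨hk1, hk2⟩ := hq hqS k
    obtain ⟨d, hd, hdv⟩ := hk2 ((h.iterate_mem_iff k q).1 hqS)
    have h1 : ContMDiffAt (𝓡 n) 𝓘(ℝ, Fin m → ℝ) ∞ (F ∘ ψ) (ψ^[k] q) := by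
      refine ContMDiffAt.comp _ ?_ h.smooth.contMDiffAt
      rw [← Function.iterate_succ_apply' ψ]
      exact (hq hqS (k + 1)).1
    refine ⟨d * c, mul_pos hd hc, fun v => ?_⟩
    have h2 : F ∘ ψ^[k + 1] = (F ∘ ψ) ∘ ψ^[k] := by
      rw [Function.iterate_succ', Function.comp_assoc]
    rw [h2, detAlong_derivAt_comp h1 (contMDiff_iterate h.smooth k), hdv,
      ← detAlong_derivAt_comp hk1 (contMDiff_iterate h.smooth k), hcv, mul_assoc]

/-- Around each point of the stable manifold, all equations `F ∘ ψᵏ` with large `k` induce the same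
coorientation. -/
theorem exists_eventually_derivAt {p : M} (hp : p ∈ stable g f y) :
    ∃ K, LocalEquation n (stable g f y) p (F ∘ ψ^[K]) ∧ ∀ᶠ q in 𝓝 p, q ∈ stable g f y →
      ∀ k ≥ K, ∃ c > 0, ∀ v : Fin m → TangentSpace (𝓡 n) q,
        detAlong (derivAt n (F ∘ ψ^[k]) q) v = c * detAlong (derivAt n (F ∘ ψ^[K]) q) v := by
  obtain ⟨K, hK1, hK2⟩ := ((h.tendsto p hp).eventually (h.equation.eventually.and
    (eventually_eventually_nhds.2 h.eventually_derivAt_iterate))).exists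
  have hc := contMDiff_iterate h.smooth K
  refine ⟨K, h.comp_iterate hK1, ?_⟩
  filter_upwards [hc.continuous.continuousAt.eventually hK2] with q hq hqS k hk
  obtain ⟨j, rfl⟩ := Nat.exists_eq_add_of_le' hk
  obtain ⟨h1, h2⟩ := hq ((h.iterate_mem_iff K q).1 hqS)
  obtain ⟨c, hc0, hcv⟩ := h2 j
  refine ⟨c, hc0, fun v => ?_⟩
  rw [Function.iterate_add, ← Function.comp_assoc, detAlong_derivAt_comp (h1 j) hc, hcv]
  exact congrArg (c * ·) (detAlong_derivAt_comp (F := F) (h1 0) hc v).symm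

/-- The coorientation of the stable manifold for which the positive bases are eventually mapped to
bases on which `s * det dF` is positive. -/
theorem exists_coorientation {s : ℝ} (hs : s ≠ 0) :
    ∃ ν : NormalOrientation (n := n) (stable g f y), ∀ (hy : y ∈ stable g f y)
      (v : Fin m → TangentSpace (𝓡 n) y), IsNormalBasis (stable g f y) y v →
        (ν.Pos ⟨y, hy⟩ v ↔ 0 < s * detAlong (derivAt n F y) v) := by
  -- once the signs are independent of `k ≥ K`, the eventual sign is the sign for `k = K`
  have hev : ∀ {q : M} {v : Fin m → TangentSpace (𝓡 n) q} {K : ℕ}, (∀ k ≥ K, ∃ c > 0,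
      ∀ v : Fin m → TangentSpace (𝓡 n) q,
        detAlong (derivAt n (F ∘ ψ^[k]) q) v = c * detAlong (derivAt n (F ∘ ψ^[K]) q) v) →
      ((∀ᶠ k in atTop, 0 < s * detAlong (derivAt n (F ∘ ψ^[k]) q) v) ↔
        0 < s * detAlong (derivAt n (F ∘ ψ^[K]) q) v) := by
    intro q v K hK
    have h1 : ∀ k ≥ K, (0 < s * detAlong (derivAt n (F ∘ ψ^[k]) q) v ↔
        0 < s * detAlong (derivAt n (F ∘ ψ^[K]) q) v) := fun k hk => by
      obtain ⟨c, hc, hcv⟩ := hK k hk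
      rw [hcv, mul_left_comm, mul_pos_iff_of_pos_left hc]
    constructor
    · intro h2
      obtain ⟨k, hk, hkK⟩ := (h2.and (eventually_ge_atTop K)).exists
      exact (h1 k hkK).1 hk
    · intro h2
      filter_upwards [eventually_ge_atTop K] with k hk using (h1 k hk).2 h2
  obtain ⟨ν, hν⟩ := exists_normalOrientation
    (hasNormalFrames fun p hp => h.exists_localEquation hp)
    (fun q v => ∀ᶠ k in atTop, 0 < s * detAlong (derivAt n (F ∘ ψ^[k]) q) v) fun p => by
      obtain ⟨K, hK, hev'⟩ := h.exists_eventually_derivAt p.2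
      refine ⟨chartFDeriv n p (F ∘ ψ^[K]), s, continuousAt_chartFDeriv hK.smooth, hs,
        hK.eventually_tangentOf.self_of_nhds p.2, ?_⟩
      filter_upwards [continuousAt_subtype_val.eventually hev',
        continuousAt_subtype_val.eventually (eventually_derivAt_eq hK.smooth)] with q hq1 hq2 v _
      rw [hev (hq1 q.2), hq2]
  refine ⟨ν, fun hy v hv => ?_⟩
  obtain ⟨-, h1⟩ := h.eventually_derivAt_iterate.self_of_nhds hy
  refine (hν ⟨y, hy⟩ v hv).trans (hev (K := 0) fun k _ => h1 k)

/-- A coorientation of the stable manifold is determined by its value at `y`, because the stable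
manifold is connected. -/
theorem coorientation_ext {ν ν' : NormalOrientation (n := n) (stable g f y)}
    (hy : y ∈ stable g f y) (hν : ν.fibre ⟨y, hy⟩ = ν'.fibre ⟨y, hy⟩) : ν = ν' := by
  have hloc := NormalOrientation.isLocallyConstant ν ν' fun p hp => h.exists_localEquation hp
  refine NormalOrientation.ext_fibre fun p => ?_
  obtain ⟨γ, hγ, hω⟩ := id p.2
  have hmem := mem_stable_of_isTrajectory hγ hω
  let c : ℝ → stable g f y := fun t => ⟨γ t, hmem t⟩
  have hc : Continuous c := hγ.1.continuous.subtype_mk hmem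
  have hp0 : c 0 = p := Subtype.ext hγ.2
  have hyω : y ∈ omegaLimitSet γ := by
    rw [hω]
    rfl
  obtain ⟨t, -, ht⟩ := hyω
  -- the trajectory connects `p` to points arbitrarily close to `y`
  have h1 : Tendsto (fun k => c (t k)) atTop (𝓝 ⟨y, hy⟩) := tendsto_subtype_rng.2 ht
  obtain ⟨k, hk⟩ := (h1.eventually (hloc.eventually_eq ⟨y, hy⟩)).exists
  have h2 := (hloc.comp_continuous hc).apply_eq_of_preconnectedSpace 0 (t k)
  simp only [Function.comp_apply] at h2
  rw [← hp0, h2, hk]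
  exact hν

end StableEquation

end Coorientation

/-! ### Induced coorientations and orientations -/

section Induced

variable {n m m' : ℕ} {M : Type*} [TopologicalSpace M] [ChartedSpace (EuclideanSpace ℝ (Fin n)) M]
  [IsManifold (𝓡 n) ∞ M]

/-- The derivative at `y` of an equation of the stable manifold is an isomorphism on the tangent
space of the unstable manifold; it realizes the isomorphism `T_y Wᵘ ≅ T_y M / T_y Wˢ`. -/
theorem StableEquation.formAt_injOn {g : SmoothMetric n M} {f : M → ℝ}
    {y : M} {ψ : M → M} {F : M → Fin m → ℝ} (h : StableEquation g f y ψ F) (hys : y ∈ stable g f y)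
    (hu : finrank ℝ (tangentOf n (unstable g f y) y) = m)
    (ht : tangentOf n (unstable g f y) y ⊔ tangentOf n (stable g f y) y = ⊤) :
    ∀ v ∈ tangentOf n (unstable g f y) y, formAt n y (chartFDeriv n y F) y v = 0 → v = 0 := by
  have hfs := h.equation.finrank_tangentOf hys
  have hker := h.equation.eventually_tangentOf.self_of_nhds hys
  have hinf : tangentOf n (unstable g f y) y ⊓ tangentOf n (stable g f y) y = ⊥ := by
    have h1 := Submodule.finrank_sup_add_finrank_inf_eq (tangentOf n (unstable g f y) y)
      (tangentOf n (stable g f y) y)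
    rw [ht, finrank_top, finrank_tangentSpace] at h1
    exact Submodule.finrank_eq_zero.1 (by omega)
  intro v hv h0
  have h1 : v ∈ tangentOf n (unstable g f y) y ⊓ tangentOf n (stable g f y) y :=
    ⟨hv, by rw [hker]; exact h0⟩
  rwa [hinf, Submodule.mem_bot] at h1

/-- A basis of the tangent space at `y` of the unstable manifold represents a basis of the normal
space of the stable manifold. -/
theorem StableEquation.isNormalBasis {g : SmoothMetric n M} {f : M → ℝ}
    {y : M} {ψ : M → M} {F : M → Fin m → ℝ} (h : StableEquation g f y ψ F) (hys : y ∈ stable g f y)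
    (hu : finrank ℝ (tangentOf n (unstable g f y) y) = m)
    (ht : tangentOf n (unstable g f y) y ⊔ tangentOf n (stable g f y) y = ⊤)
    {v : Fin m → TangentSpace (𝓡 n) y} (hv : IsTangentBasis (unstable g f y) y v) :
    IsNormalBasis (stable g f y) y v :=
  isNormalBasis_of_det_ne_zero (h.equation.eventually_tangentOf.self_of_nhds hys).le
    (hv.detAlong_ne_zero (h.formAt_injOn hys hu ht)) (h.equation.finrank_tangentOf hys)

/-- An orientation of the unstable manifold at `y` extends to a coorientation of the whole stable
manifold. -/
theorem StableEquation.exists_inducedCoorientation [T2Space M] {g : SmoothMetric n M} {f : M → ℝ}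
    {y : M} {ψ : M → M} {F : M → Fin m → ℝ} (h : StableEquation g f y ψ F) (hy : y ∈ Crit n f)
    (hu : finrank ℝ (tangentOf n (unstable g f y) y) = m)
    (ht : tangentOf n (unstable g f y) y ⊔ tangentOf n (stable g f y) y = ⊤)
    (o : TangentOrientation (n := n) (unstable g f y)) :
    ∃ ν, IsInducedCoorientation g f hy o ν := by
  have hys := mem_stable_self g f hy
  have hd : derivAt n F y = formAt n y (chartFDeriv n y F) y :=
    (eventually_derivAt_eq h.equation.smooth).self_of_nhds
  obtain ⟨s, hs, hso⟩ := o.exists_sign ⟨y, mem_unstable_self g f hy⟩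
    (continuousAt_chartFDeriv h.equation.smooth) (h.formAt_injOn hys hu ht)
  obtain ⟨ν, hν⟩ := h.exists_coorientation hs
  refine ⟨ν, fun k v hv => ?_⟩
  obtain rfl : m = k := hu.symm.trans hv.finrank_eq
  rw [hν hys v (h.isNormalBasis hys hu ht hv), hd]
  exact (hso.self_of_nhds v hv).symm

theorem StableEquation.inducedCoorientation_unique [T2Space M] {g : SmoothMetric n M} {f : M → ℝ}
    {y : M} {ψ : M → M} {F : M → Fin m → ℝ} (h : StableEquation g f y ψ F) (hy : y ∈ Crit n f)
    (hu : finrank ℝ (tangentOf n (unstable g f y) y) = m)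
    (ht : tangentOf n (unstable g f y) y ⊔ tangentOf n (stable g f y) y = ⊤)
    {o : TangentOrientation (n := n) (unstable g f y)}
    {ν ν' : NormalOrientation (n := n) (stable g f y)} (hν : IsInducedCoorientation g f hy o ν)
    (hν' : IsInducedCoorientation g f hy o ν') : ν' = ν := by
  have hys := mem_stable_self g f hy
  obtain ⟨v, hv⟩ : ∃ v : Fin m → TangentSpace (𝓡 n) y, IsTangentBasis (unstable g f y) y v :=
    ⟨_, finBasisOfFinrankEq ℝ (tangentOf n (unstable g f y) y) hu, fun i => rfl, trivial⟩
  refine h.coorientation_ext hys ?_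
  have h2 : ν'.Pos ⟨y, hys⟩ v ↔ ν.Pos ⟨y, hys⟩ v := (hν' m v hv).trans (hν m v hv).symm
  exact NormalOrientation.fibre_eq_of_pos_iff hys (h.isNormalBasis hys hu ht hv) h2

/-- A tangent basis of `U ∩ S`, followed by vectors tangent to `U` that represent a basis of the
normal space of `S`, is a tangent basis of `U`. -/
theorem isTangentBasis_append {U S : Set M} {p : M} {G : M → Fin m' → ℝ} {F : M → Fin m → ℝ}
    (hG : LocalEquation n U p G) (hF : LocalEquation n S p F) (hpU : p ∈ U) (hpS : p ∈ S)
    (ht : tangentOf n U p ⊔ tangentOf n S p = ⊤) {k : ℕ} {a : Fin k → TangentSpace (𝓡 n) p}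
    {w : Fin m → TangentSpace (𝓡 n) p} (ha : IsTangentBasis (U ∩ S) p a)
    (hw : ∀ j, w j ∈ tangentOf n U p) (hwn : IsNormalBasis S p w) :
    IsTangentBasis U p (Fin.append a w) := by
  have hT := hG.tangentOf_inter hF hpU hpS ht
  have h1 := (hG.inter hF hpU hpS ht).finrank_tangentOf ⟨hpU, hpS⟩
  have h2 := hG.finrank_tangentOf hpU
  have hker : tangentOf n S p = LinearMap.ker (derivAt n F p) :=
    Submodule.ext fun v => hF.mem_tangentOf_iff hpS v
  obtain ⟨-, l, hl, -⟩ := exists_linearMap_injOn (E := EuclideanSpace ℝ (Fin n))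
    (T := tangentOf n (U ∩ S) p) ha.finrank_eq
  refine isTangentBasis_of_linearIndependent (fun i => ?_) ?_ (by have := ha.finrank_eq; omega)
  · refine Fin.addCases (fun i => ?_) (fun i => ?_) i
    · rw [Fin.append_left]
      exact (hT ▸ ha.mem i : a i ∈ tangentOf n U p ⊓ tangentOf n S p).1
    · rw [Fin.append_right]
      exact hw i
  · let Λ : TangentSpace (𝓡 n) p →ₗ[ℝ] (Fin (k + m) → ℝ) :=
      (appendCLM k m).toLinearMap ∘ₗ LinearMap.prod l.toLinearMap (derivAt n F p)
    refine LinearIndependent.of_comp Λ (linearIndependent_of_det_ne_zero ?_)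
    have h3 := detAlong_append (Λ := Λ) (Λ₁ := l.toLinearMap) (Λ₂ := derivAt n F p) (a := a)
      (fun v => rfl) (fun i => by
        have : a i ∈ tangentOf n U p ⊓ tangentOf n S p := hT ▸ ha.mem i
        rw [hker] at this
        exact this.2) w
    have h4 : detAlong Λ (Fin.append a w) ≠ 0 := by
      rw [h3]
      exact mul_ne_zero (ha.detAlong_ne_zero hl) (hwn.detAlong_ne_zero hker)
    exact h4

theorem exists_linearMap_chart_injOn {S : Set M} {p : M} {k : ℕ}
    (hk : finrank ℝ (tangentOf n S p) = k) : ∃ l : EuclideanSpace ℝ (Fin n) →L[ℝ] (Fin k → ℝ),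
      ∀ v ∈ tangentOf n S p, formAt n p (fun _ => l) p v = 0 → v = 0 := by
  let e := chartEquiv (mem_chart_source (EuclideanSpace ℝ (Fin n)) p)
  obtain ⟨-, l, hl, -⟩ := exists_linearMap_injOn (k := k) (T := (tangentOf n S p).map e.toLinearMap)
    ((e.submoduleMap (tangentOf n S p)).finrank_eq.symm.trans hk)
  exact ⟨l, fun v hv h0 => e.map_eq_zero_iff.1 (hl _ ⟨v, hv, rfl⟩ h0)⟩

/-- Near each point of `U ∩ S`, an orientation of `U` and a coorientation of `S` combine to the sign
of a determinant on the bases of the tangent spaces of `U ∩ S`, whatever basis `w` of the normal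
space is used for the comparison. -/
theorem exists_eventually_inducedOrientation {U S : Set M} {p : M} (hp : p ∈ U ∩ S)
    (hU : ∀ q ∈ U, ∃ G : M → Fin m' → ℝ, LocalEquation n U q G)
    (hS : ∀ q ∈ S, ∃ F : M → Fin m → ℝ, LocalEquation n S q F)
    (ht : ∀ q ∈ U ∩ S, tangentOf n U q ⊔ tangentOf n S q = ⊤)
    (o : TangentOrientation (n := n) U) (ν : NormalOrientation (n := n) S) {k : ℕ}
    (hk : finrank ℝ (tangentOf n (U ∩ S) p) = k) (hfr : HasTangentFrames n (U ∩ S) k) :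
    ∃ (A : M → EuclideanSpace ℝ (Fin n) →L[ℝ] (Fin k → ℝ)) (s : ℝ), ContinuousAt A p ∧ s ≠ 0 ∧
      (∀ v ∈ tangentOf n (U ∩ S) p, formAt n p A p v = 0 → v = 0) ∧
      ∀ᶠ q : ↑(U ∩ S) in 𝓝 ⟨p, hp⟩, ∀ (a : Fin k → TangentSpace (𝓡 n) (q : M))
        (w : Fin m → TangentSpace (𝓡 n) (q : M)), IsTangentBasis (U ∩ S) (q : M) a →
        (∀ j, w j ∈ tangentOf n U (q : M)) → IsNormalBasis S (q : M) w →
        ((o.Pos ⟨q, q.2.1⟩ (Fin.append a w) ↔ ν.Pos ⟨q, q.2.2⟩ w) ↔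
          0 < s * detAlong (formAt n p A q) a) := by
  obtain ⟨G, hG⟩ := hU p hp.1
  obtain ⟨F, hF⟩ := hS p hp.2
  have hT := hG.tangentOf_inter hF hp.1 hp.2 (ht p hp)
  have hker : ∀ᶠ q in 𝓝 p, q ∈ S →
      tangentOf n S q = LinearMap.ker (formAt n p (chartFDeriv n p F) q) :=
    hF.eventually_tangentOf
  -- `l` is injective on `T_p (U ∩ S)`, so `(l, dF)` is injective on `T_p U`, and its determinant on
  -- `(a, w)` is the product of the determinant of `l` on `a` and that of `dF` on `w`
  obtain ⟨l, hl⟩ := exists_linearMap_chart_injOn hk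
  let B : M → EuclideanSpace ℝ (Fin n) →L[ℝ] (Fin (k + m) → ℝ) := fun q =>
    (appendCLM k m ∘L ContinuousLinearMap.inl ℝ _ _) ∘L l +
      (appendCLM k m ∘L ContinuousLinearMap.inr ℝ _ _) ∘L chartFDeriv n p F q
  have hB : ∀ q v, formAt n p B q v =
      Fin.append (formAt n p (fun _ => l) q v) (formAt n p (chartFDeriv n p F) q v) := by
    intro q v
    change appendCLM k m (l (chartDeriv n p q v), 0) +
      appendCLM k m (0, chartFDeriv n p F q (chartDeriv n p q v)) = _
    rw [← map_add, Prod.mk_add_mk, add_zero, zero_add]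
    rfl
  have hBc : ContinuousAt B p := continuousAt_const.add
    (continuousAt_const.clm_comp (continuousAt_chartFDeriv hF.smooth))
  have hBi : ∀ v ∈ tangentOf n U p, formAt n p B p v = 0 → v = 0 := by
    intro v hv h0
    rw [hB] at h0
    obtain ⟨h1, h2⟩ := append_eq_zero_iff.1 h0
    refine hl v ?_ h1
    rw [hT]
    refine ⟨hv, ?_⟩
    rw [hker.self_of_nhds hp.2]
    exact h2
  obtain ⟨s, hs, ho⟩ := o.exists_sign ⟨p, hp.1⟩ hBc hBi
  obtain ⟨t, ht0, hν⟩ := ν.exists_sign ⟨p, hp.2⟩ (continuousAt_chartFDeriv hF.smooth) (by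
    filter_upwards [continuousAt_subtype_val.eventually hker] with q hq using hq q.2)
  have hne := hfr.eventually_detAlong_ne_zero ⟨p, hp⟩ (A := fun _ => l) continuousAt_const hl
  have i1 : Tendsto (inclusion (inter_subset_left (s := U) (t := S))) (𝓝 ⟨p, hp⟩)
      (𝓝 ⟨p, hp.1⟩) := (continuous_inclusion inter_subset_left).continuousAt
  have i2 : Tendsto (inclusion (inter_subset_right (s := U) (t := S))) (𝓝 ⟨p, hp⟩)
      (𝓝 ⟨p, hp.2⟩) := (continuous_inclusion inter_subset_right).continuousAt
  refine ⟨fun _ => l, s * t, continuousAt_const, mul_ne_zero hs ht0, hl, ?_⟩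
  filter_upwards [i1.eventually ho, i2.eventually hν, hne,
    continuousAt_subtype_val.eventually hker] with q ho hν hne hker a w ha hw hwn
  obtain ⟨G', hG'⟩ := hU q q.2.1
  obtain ⟨F', hF'⟩ := hS q q.2.2
  have hq := hker q.2.2
  rw [show o.Pos ⟨q, q.2.1⟩ (Fin.append a w) ↔ _ from
      ho _ (isTangentBasis_append hG' hF' q.2.1 q.2.2 (ht q q.2) ha hw hwn),
    show ν.Pos ⟨q, q.2.2⟩ w ↔ _ from hν w hwn]
  have h3 := detAlong_append (hB q) (a := a) (fun i => by
    have h4 : a i ∈ tangentOf n U (q : M) ⊓ tangentOf n S (q : M) :=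
      hG'.tangentOf_inter hF' q.2.1 q.2.2 (ht q q.2) ▸ ha.mem i
    rw [hq] at h4
    exact h4.2) w
  change (0 < s * detAlong (formAt n p B q) (Fin.append a w) ↔
    0 < t * detAlong (formAt n p (chartFDeriv n p F) q) w) ↔ _
  rw [h3]
  exact iff_iff_mul_pos ht0 (hwn.detAlong_ne_zero hq) hs (hne a ha)

/-- In the tangent space of `U` there are representatives of a basis of the normal space of `S`. -/
theorem exists_normalBasis_mem {U S : Set M}
    (hS : ∀ q ∈ S, ∃ F : M → Fin m → ℝ, LocalEquation n S q F) {p : M} (hp : p ∈ S)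
    (ht : tangentOf n U p ⊔ tangentOf n S p = ⊤) :
    ∃ w : Fin m → TangentSpace (𝓡 n) p, (∀ j, w j ∈ tangentOf n U p) ∧ IsNormalBasis S p w := by
  obtain ⟨N, hN, X, -, hX⟩ := hasNormalFrames hS ⟨p, hp⟩
  obtain ⟨b, hb, -⟩ := hX ⟨p, hp⟩ (mem_of_mem_nhds hN)
  have h1 : ∀ i, ∃ u ∈ tangentOf n U p, ∃ s ∈ tangentOf n S p, u + s = X i ⟨p, hp⟩ := fun i =>
    Submodule.mem_sup.1 (ht.symm ▸ Submodule.mem_top)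
  choose w hw s hs hws using h1
  refine ⟨w, hw, b, fun i => ?_, trivial⟩
  have h2 : (tangentOf n S p).mkQ (s i) = 0 := (Submodule.Quotient.mk_eq_zero _).2 (hs i)
  have h3 : (tangentOf n S p).mkQ (X i ⟨p, hp⟩) = (tangentOf n S p).mkQ (w i) := by
    rw [← hws, map_add, h2, add_zero]
  exact (hb i).trans h3

/-- An orientation of `U` and a coorientation of `S` induce a unique orientation of the transversal
intersection `U ∩ S`. -/
theorem existsUnique_inducedOrientation {U S : Set M}
    (hU : ∀ q ∈ U, ∃ G : M → Fin m' → ℝ, LocalEquation n U q G)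
    (hS : ∀ q ∈ S, ∃ F : M → Fin m → ℝ, LocalEquation n S q F)
    (ht : ∀ q ∈ U ∩ S, tangentOf n U q ⊔ tangentOf n S q = ⊤)
    (o : TangentOrientation (n := n) U) (ν : NormalOrientation (n := n) S) :
    ∃! o' : TangentOrientation (n := n) (U ∩ S), ∀ (p : M) (hp : p ∈ U ∩ S) (k m : ℕ)
      (a : Fin k → TangentSpace (𝓡 n) p) (w : Fin m → TangentSpace (𝓡 n) p),
      IsTangentBasis (U ∩ S) p a → (∀ j, w j ∈ tangentOf n U p) → IsNormalBasis S p w →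
      (o.Pos ⟨p, hp.1⟩ (Fin.append a w) ↔ (o'.Pos ⟨p, hp⟩ a ↔ ν.Pos ⟨p, hp.2⟩ w)) := by
  obtain ⟨k, hfr, hk⟩ := exists_hasTangentFrames (n := n) (m := m' + m) (S := U ∩ S) fun p hp => by
    obtain ⟨G, hG⟩ := hU p hp.1
    obtain ⟨F, hF⟩ := hS p hp.2
    exact ⟨_, hG.inter hF hp.1 hp.2 (ht p hp)⟩
  let Q : ∀ q : ↑(U ∩ S), (Fin k → TangentSpace (𝓡 n) (q : M)) → Prop := fun q a =>
    ∀ w : Fin m → TangentSpace (𝓡 n) (q : M), (∀ j, w j ∈ tangentOf n U (q : M)) →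
      IsNormalBasis S (q : M) w →
      (o.Pos ⟨q, q.2.1⟩ (Fin.append a w) ↔ ν.Pos ⟨q, q.2.2⟩ w)
  have hloc := fun (p : M) (hp : p ∈ U ∩ S) =>
    exists_eventually_inducedOrientation hp hU hS ht o ν (hk p hp) hfr
  -- the condition `Q` does not depend on the choice of `w`
  have hQ : ∀ (p : M) (hp : p ∈ U ∩ S) (a : Fin k → TangentSpace (𝓡 n) p)
      (w : Fin m → TangentSpace (𝓡 n) p), IsTangentBasis (U ∩ S) p a →
      (∀ j, w j ∈ tangentOf n U p) → IsNormalBasis S p w →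
      (Q ⟨p, hp⟩ a ↔ (o.Pos ⟨p, hp.1⟩ (Fin.append a w) ↔ ν.Pos ⟨p, hp.2⟩ w)) := by
    intro p hp a w ha hw hwn
    obtain ⟨A, s, -, -, -, hev⟩ := hloc p hp
    have h1 := hev.self_of_nhds
    exact ⟨fun h => h w hw hwn, fun h w' hw' hwn' =>
      (h1 a w' ha hw' hwn').2 ((h1 a w ha hw hwn).1 h)⟩
  obtain ⟨o', ho', huniq⟩ := existsUnique_tangentOrientation hfr Q fun p => by
    obtain ⟨A, s, hA, hs, hinj, hev⟩ := hloc p p.2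
    refine ⟨A, s, hA, hs, hinj, ?_⟩
    filter_upwards [hev] with q hq a ha
    obtain ⟨w, hw, hwn⟩ := exists_normalBasis_mem hS q.2.2 (ht q q.2)
    exact (hQ q q.2 a w ha hw hwn).trans (hq a w ha hw hwn)
  refine ⟨o', fun p hp k' l a w ha hw hwn => ?_, fun o₁ ho₁ => huniq o₁ fun q a ha => ?_⟩
  · obtain rfl : k = k' := (hk p hp).symm.trans ha.finrank_eq
    obtain rfl : m = l := by
      obtain ⟨F, hF⟩ := hS p hp.2
      have h1 := hF.finrank_tangentOf hp.2
      have h2 := hwn.finrank_eq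
      omega
    have h1 := hQ p hp a w ha hw hwn
    have h2 : o'.Pos ⟨p, hp⟩ a ↔ Q ⟨p, hp⟩ a := ho' ⟨p, hp⟩ a ha
    rw [h2, h1]
    tauto
  · obtain ⟨w, hw, hwn⟩ := exists_normalBasis_mem hS q.2.2 (ht q q.2)
    have h1 := hQ q q.2 a w ha hw hwn
    have h2 := ho₁ q q.2 k m a w ha hw hwn
    refine Iff.trans ?_ h1.symm
    rw [h2]
    change o₁.Pos q a ↔ ((o₁.Pos q a ↔ _) ↔ _)
    tauto

/-- Prepending a number to a vector as a continuous linear map. -/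
noncomputable def consCLM (k : ℕ) : (ℝ × (Fin k → ℝ)) →L[ℝ] (Fin (k + 1) → ℝ) :=
  LinearMap.toContinuousLinearMap
    { toFun := fun a => Fin.cons a.1 a.2
      map_add' := fun a b => by
        funext i
        refine Fin.cases ?_ (fun i => ?_) i <;> simp
      map_smul' := fun c a => by
        funext i
        refine Fin.cases ?_ (fun i => ?_) i <;> simp }

theorem cons_eq_zero_iff {k : ℕ} {c : ℝ} {a : Fin k → ℝ} :
    (Fin.cons c a : Fin (k + 1) → ℝ) = 0 ↔ c = 0 ∧ a = 0 := by
  constructor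
  · intro h
    exact ⟨congrFun h 0, funext fun i => congrFun h i.succ⟩
  · rintro ⟨rfl, rfl⟩
    exact (consCLM k).map_zero

/-- The form `-df` is positive on `-∇f`, away from the critical points. -/
theorem exists_pos_neg_mfderiv_neg_grad {g : SmoothMetric n M} {f : M → ℝ} {p : M}
    (hp : p ∉ Crit n f) : ∃ d : TangentSpace (𝓡 n) p →ₗ[ℝ] ℝ,
      (∀ v, d v = -(mfderiv (𝓡 n) 𝓘(ℝ, ℝ) f p v : ℝ)) ∧ 0 < d (-grad g f p) := by
  refine ⟨-(mfderiv (𝓡 n) 𝓘(ℝ, ℝ) f p).toLinearMap, fun v => rfl, ?_⟩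
  refine (g.pos p _ fun h => hp ((grad_eq_zero_iff g).1 h)).trans_eq
    (b := g.inner p (grad g f p) (grad g f p)) ?_
  rw [inner_grad]
  exact ((congrArg Neg.neg ((mfderiv (𝓡 n) 𝓘(ℝ, ℝ) f p).map_neg _)).trans
    (neg_neg (G := ℝ) _)).symm

variable {g : SmoothMetric n M} {f : M → ℝ} (hf : ContMDiff (𝓡 n) 𝓘(ℝ, ℝ) ∞ f)
include hf

theorem mem_tangentOf_level_iff {p : M} (hp : p ∉ Crit n f) {a : ℝ} (ha : f p = a)
    (v : TangentSpace (𝓡 n) p) : v ∈ tangentOf n (f ⁻¹' {a}) p ↔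
      (mfderiv (𝓡 n) 𝓘(ℝ, ℝ) f p v : ℝ) = 0 := by
  have hd := hf.mdifferentiableAt (by simp) (x := p)
  rw [(localEquation_level hf hp a).mem_tangentOf_iff ha]
  constructor
  · intro h
    rw [← mfderiv_const_fin_one hd a v 0]
    exact congrFun h 0
  · intro h
    funext i
    exact (mfderiv_const_fin_one hd a v i).trans h

/-- A set to which the gradient field is tangent is transversal to the level sets at noncritical
points. -/
theorem tangentOf_sup_level {C : Set M} {p : M} (hp : p ∉ Crit n f) {a : ℝ} (ha : f p = a)
    (hgr : -grad g f p ∈ tangentOf n C p) :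
    tangentOf n C p ⊔ tangentOf n (f ⁻¹' {a}) p = ⊤ := by
  refine eq_top_iff.2 fun v _ => ?_
  obtain ⟨d, hd', hd⟩ := exists_pos_neg_mfderiv_neg_grad (g := g) hp
  refine Submodule.mem_sup.2 ⟨(d v / d (-grad g f p)) • (-grad g f p),
    Submodule.smul_mem _ _ hgr, v - (d v / d (-grad g f p)) • (-grad g f p), ?_,
    add_sub_cancel _ _⟩
  rw [mem_tangentOf_level_iff hf hp ha]
  refine neg_eq_zero.1 ((hd' _).symm.trans ?_)
  rw [map_sub, map_smul, smul_eq_mul, div_mul_cancel₀ _ hd.ne', sub_self]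
  rfl

/-- A basis of the tangent space of a level set of `C`, preceded by `-∇f`, is a basis of the tangent
space of `C`. -/
theorem isTangentBasis_cons {C : Set M} {p : M} {G : M → Fin m → ℝ} (hG : LocalEquation n C p G)
    (hpC : p ∈ C) (hp : p ∉ Crit n f) {a : ℝ} (ha : f p = a)
    (hgr : -grad g f p ∈ tangentOf n C p) {k : ℕ} {c : Fin k → TangentSpace (𝓡 n) p}
    (hc : IsTangentBasis (C ∩ f ⁻¹' {a}) p c) :
    IsTangentBasis C p (Fin.cons (-grad g f p) c : Fin (k + 1) → TangentSpace (𝓡 n) p) := by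
  have hL := localEquation_level hf hp a
  have ht := tangentOf_sup_level hf hp ha hgr
  have hT := hG.tangentOf_inter hL hpC ha ht
  have h1 := (hG.inter hL hpC ha ht).finrank_tangentOf ⟨hpC, ha⟩
  have h2 := hG.finrank_tangentOf hpC
  have hmem : ∀ i, c i ∈ tangentOf n C p ⊓ tangentOf n (f ⁻¹' {a}) p := fun i => hT ▸ hc.mem i
  obtain ⟨-, l, hl, -⟩ := exists_linearMap_injOn (E := EuclideanSpace ℝ (Fin n))
    (T := tangentOf n (C ∩ f ⁻¹' {a}) p) hc.finrank_eq
  refine isTangentBasis_of_linearIndependent (fun i => ?_) ?_ (by have := hc.finrank_eq; omega)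
  · refine Fin.cases hgr (fun i => ?_) i
    exact (hmem i).1
  · obtain ⟨d, hd', hd⟩ := exists_pos_neg_mfderiv_neg_grad (g := g) hp
    let Λ : TangentSpace (𝓡 n) p →ₗ[ℝ] (Fin (k + 1) → ℝ) :=
      (consCLM k).toLinearMap ∘ₗ LinearMap.prod d l.toLinearMap
    refine LinearIndependent.of_comp Λ (linearIndependent_of_det_ne_zero ?_)
    have h3 := detAlong_cons (Λ := Λ) (l := d) (Λ₁ := l.toLinearMap) (c := c) (fun v => rfl)
      (fun i => (hd' _).trans <|
        neg_eq_zero.2 ((mem_tangentOf_level_iff hf hp ha _).1 (hmem i).2)) (-grad g f p)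
    have h4 : detAlong Λ (Fin.cons (-grad g f p) c : Fin (k + 1) → TangentSpace (𝓡 n) p) ≠ 0 := by
      rw [h3]
      exact mul_ne_zero hd.ne' (hc.detAlong_ne_zero hl)
    exact h4

/-- An orientation of a submanifold to which the gradient field is tangent induces an orientation
of its intersection with a regular level set. -/
theorem existsUnique_inducedLevelOrientation {C : Set M}
    (hC : ∀ q ∈ C, ∃ G : M → Fin m → ℝ, LocalEquation n C q G)
    (hgr : ∀ q ∈ C, -grad g f q ∈ tangentOf n C q) {a : ℝ} (ha : IsRegularValue n f a)
    (o : TangentOrientation (n := n) C) :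
    ∃! o' : TangentOrientation (n := n) (C ∩ f ⁻¹' {a}), ∀ (p : M) (hp : p ∈ C ∩ f ⁻¹' {a}) (k : ℕ)
      (c : Fin k → TangentSpace (𝓡 n) p), IsTangentBasis (C ∩ f ⁻¹' {a}) p c →
      (o.Pos ⟨p, hp.1⟩ (Fin.cons (-grad g f p) c : Fin (k + 1) → TangentSpace (𝓡 n) p) ↔
        o'.Pos ⟨p, hp⟩ c) := by
  obtain ⟨k, hfr, hk⟩ := exists_hasTangentFrames (n := n) (m := m + 1) (S := C ∩ f ⁻¹' {a})
    fun p hp => by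
      obtain ⟨G, hG⟩ := hC p hp.1
      exact ⟨_, hG.inter (localEquation_level hf (ha p hp.2) a) hp.1 hp.2
        (tangentOf_sup_level hf (ha p hp.2) hp.2 (hgr p hp.1))⟩
  obtain ⟨o', ho', huniq⟩ := existsUnique_tangentOrientation hfr
    (fun q c => o.Pos ⟨q, q.2.1⟩
      (Fin.cons (-grad g f q) c : Fin (k + 1) → TangentSpace (𝓡 n) (q : M))) fun ⟨p, hp⟩ => by
    obtain ⟨G, hG⟩ := hC p hp.1
    have hT := hG.tangentOf_inter (localEquation_level hf (ha p hp.2) a) hp.1 hp.2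
      (tangentOf_sup_level hf (ha p hp.2) hp.2 (hgr p hp.1))
    obtain ⟨l, hl⟩ := exists_linearMap_chart_injOn (hk p hp)
    -- the determinant of `(-df, l)` on `(-∇f, c)` is a positive multiple of that of `l` on `c`
    let d : ∀ q, TangentSpace (𝓡 n) q →ₗ[ℝ] ℝ := fun q =>
      -((chartFDeriv n p f q).toLinearMap ∘ₗ (chartDeriv n p q).toLinearMap)
    have hd : ∀ q ∈ (extChartAt (𝓡 n) p).source, ∀ v : TangentSpace (𝓡 n) q,
        d q v = -(mfderiv (𝓡 n) 𝓘(ℝ, ℝ) f q v : ℝ) := fun q hq v => by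
      rw [mfderiv_eq_chartFDeriv hq hf.contMDiffAt]
      rfl
    let B : M → EuclideanSpace ℝ (Fin n) →L[ℝ] (Fin (k + 1) → ℝ) := fun q =>
      (consCLM k ∘L ContinuousLinearMap.inl ℝ _ _) ∘L (-chartFDeriv n p f q) +
        (consCLM k ∘L ContinuousLinearMap.inr ℝ _ _) ∘L l
    have hB : ∀ q v, formAt n p B q v = Fin.cons (d q v) (formAt n p (fun _ => l) q v) := by
      intro q v
      change consCLM k (-(chartFDeriv n p f q (chartDeriv n p q v)), 0) +
        consCLM k (0, l (chartDeriv n p q v)) = _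
      rw [← map_add, Prod.mk_add_mk, add_zero, zero_add]
      rfl
    have hBc : ContinuousAt B p := (continuousAt_const.clm_comp (continuousAt_chartFDeriv
      (Eventually.of_forall fun q => hf.contMDiffAt)).neg).add continuousAt_const
    have hps := mem_extChartAt_source (I := 𝓡 n) p
    have hBi : ∀ v ∈ tangentOf n C p, formAt n p B p v = 0 → v = 0 := by
      intro v hv h0
      rw [hB] at h0
      obtain ⟨h1, h2⟩ := cons_eq_zero_iff.1 h0
      rw [hd p hps] at h1
      refine hl v ?_ h2
      rw [hT]
      exact ⟨hv, (mem_tangentOf_level_iff hf (ha p hp.2) hp.2 v).2 (neg_eq_zero.1 h1)⟩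
    obtain ⟨s, hs, ho⟩ := o.exists_sign ⟨p, hp.1⟩ hBc hBi
    have i1 : Tendsto (inclusion (inter_subset_left (s := C) (t := f ⁻¹' {a}))) (𝓝 ⟨p, hp⟩)
        (𝓝 ⟨p, hp.1⟩) := (continuous_inclusion inter_subset_left).continuousAt
    refine ⟨fun _ => l, s, continuousAt_const, hs, hl, ?_⟩
    filter_upwards [i1.eventually ho, continuousAt_subtype_val.eventually
      (extChartAt_source_mem_nhds (I := 𝓡 n) p)] with q hq hqs c hc
    obtain ⟨G', hG'⟩ := hC q q.2.1
    have hqc := ha q q.2.2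
    have hT' := hG'.tangentOf_inter (localEquation_level hf hqc a) q.2.1 q.2.2
      (tangentOf_sup_level hf hqc q.2.2 (hgr q q.2.1))
    rw [show o.Pos ⟨q, q.2.1⟩ _ ↔ _ from
      hq _ (isTangentBasis_cons hf hG' q.2.1 hqc q.2.2 (hgr q q.2.1) hc)]
    have h3 := detAlong_cons (hB q) (c := c) (fun i => by
      have h4 : c i ∈ tangentOf n C (q : M) ⊓ tangentOf n (f ⁻¹' {a}) (q : M) := hT' ▸ hc.mem i
      rw [hd q hqs]
      exact neg_eq_zero.2 ((mem_tangentOf_level_iff hf hqc q.2.2 _).1 h4.2)) (-grad g f q)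
    change 0 < s * detAlong (formAt n p B q) (Fin.cons (-grad g f q) c) ↔ _
    obtain ⟨d', hd', hd0⟩ := exists_pos_neg_mfderiv_neg_grad (g := g) hqc
    have hpos : 0 < d q (-grad g f q) := hd0.trans_eq ((hd' _).trans (hd q hqs _).symm)
    rw [h3, mul_left_comm, mul_pos_iff_of_pos_left hpos]
  refine ⟨o', fun p hp k' c hc => ?_, fun o₁ ho₁ => huniq o₁ fun q c hc => ?_⟩
  · obtain rfl : k = k' := (hk p hp).symm.trans hc.finrank_eq
    exact (ho' ⟨p, hp⟩ c hc).symm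
  · exact (ho₁ q q.2 k c hc).symm

end Induced

end MorseFlow

theorem mainTheorem8 {n : ℕ} {M : Type*} [TopologicalSpace M] [T2Space M] [CompactSpace M]
    [ChartedSpace (EuclideanSpace ℝ (Fin n)) M] [IsManifold (𝓡 n) ∞ M]
    (f : M → ℝ) (hf : ContMDiff (𝓡 n) 𝓘(ℝ, ℝ) ∞ f) (hMorse : IsMorse n f)
    (g : SmoothMetric n M) (hMS : IsMorseSmale g f)
    (o : ∀ x : Crit n f, TangentOrientation (n := n) (unstable g f (x : M))) :
    ∀ x y : Crit n f,
      IsSubmanifold (n := n) (connecting g f (x : M) (y : M)) ∧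
      ∃ ν : NormalOrientation (n := n) (stable g f (y : M)),
        (IsInducedCoorientation g f y.2 (o y) ν ∧
          ∀ ν', IsInducedCoorientation g f y.2 (o y) ν' → ν' = ν) ∧
        ∃ o' : TangentOrientation (n := n) (connecting g f (x : M) (y : M)),
          (IsInducedOrientation g f x y (o x) ν o' ∧
            ∀ o₁, IsInducedOrientation g f x y (o x) ν o₁ → o₁ = o') ∧
          ∀ a ∈ Ioo (f y) (f x), IsRegularValue n f a →
            IsSubmanifold (n := n) (orbitSpace g f (x : M) (y : M) a) ∧
            ∃! o'' : TangentOrientation (n := n) (orbitSpace g f (x : M) (y : M) a),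
              IsInducedOrbitOrientation g f x y a o' o'' := by
  rintro ⟨x, hx⟩ ⟨y, hy⟩
  -- `ms` and `mu` are the codimensions at `y` of the stable and unstable manifolds
  obtain ⟨ms, mu, ψ, F, ψ', F', hdim, hs, hu⟩ := exists_stableEquation_pair hf hMorse g hy
  obtain ⟨-, mux, -, -, ψx, Fx, -, -, hux⟩ := exists_stableEquation_pair hf hMorse g hx
  have hS : ∀ q ∈ stable g f y, ∃ F : M → Fin ms → ℝ, LocalEquation n (stable g f y) q F :=
    fun q hq => hs.exists_localEquation hq
  have hU : ∀ q ∈ unstable g f x, ∃ G : M → Fin mux → ℝ, LocalEquation n (unstable g f x) q G := by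
    rw [unstable_eq_stable_neg]
    exact fun q hq => hux.exists_localEquation hq
  have ht : ∀ q ∈ unstable g f x ∩ stable g f y,
      tangentOf n (unstable g f x) q ⊔ tangentOf n (stable g f y) q = ⊤ := hMS x hx y hy
  have hC : ∀ q ∈ connecting g f x y, ∃ G : M → Fin (mux + ms) → ℝ,
      LocalEquation n (connecting g f x y) q G := fun q hq => by
    obtain ⟨G, hG⟩ := hU q hq.1
    obtain ⟨F, hF⟩ := hS q hq.2
    exact ⟨_, hG.inter hF hq.1 hq.2 (ht q hq)⟩
  have hgr : ∀ q ∈ connecting g f x y, -grad g f q ∈ tangentOf n (connecting g f x y) q := by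
    intro q hq
    obtain ⟨G, hG⟩ := hU q hq.1
    obtain ⟨F, hF⟩ := hS q hq.2
    refine (hG.tangentOf_inter hF hq.1 hq.2 (ht q hq)).symm ▸ ⟨?_, hF.neg_grad_mem hq.2⟩
    have hq1 := hq.1
    rw [unstable_eq_stable_neg] at hG hq1 ⊢
    have h1 := hG.neg_grad_mem hq1
    rw [grad_neg, neg_neg] at h1
    exact Submodule.neg_mem _ h1
  -- the unstable manifold of `y` has the dimension `ms` of the normal spaces of the stable manifold
  have hfu : finrank ℝ (tangentOf n (unstable g f y) y) = ms := by
    rw [unstable_eq_stable_neg]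
    have h1 := hu.equation.finrank_tangentOf (mem_stable_self g (-f) (by rwa [crit_neg]))
    omega
  have hty := hMS y hy y hy y ⟨mem_unstable_self g f hy, mem_stable_self g f hy⟩
  refine ⟨isSubmanifold_of_localEquation hC, ?_⟩
  obtain ⟨ν, hν⟩ := hs.exists_inducedCoorientation hy hfu hty (o ⟨y, hy⟩)
  refine ⟨ν, ⟨hν, fun ν' hν' => hs.inducedCoorientation_unique hy hfu hty hν hν'⟩, ?_⟩
  obtain ⟨o', ho', huniq⟩ := existsUnique_inducedOrientation hU hS ht (o ⟨x, hx⟩) ν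
  refine ⟨o', ⟨ho', huniq⟩, fun a _ ha => ⟨?_, ?_⟩⟩
  · refine isSubmanifold_of_localEquation (m := mux + ms + 1) fun p hp => ?_
    obtain ⟨G, hG⟩ := hC p hp.1
    exact ⟨_, hG.inter (localEquation_level hf (ha p hp.2) a) hp.1 hp.2
      (tangentOf_sup_level hf (ha p hp.2) hp.2 (hgr p hp.1))⟩
  · exact existsUnique_inducedLevelOrientation hf hC hgr ha o'
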